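/- Let $d\in\{2,3\}$ and let $\Omega\subset\mathbb R^d$ be a bounded open polygonal/polyhedral set. Let $X=H^1_0(\Omega)^d$, let $(\cdot,\cdot)$, $\|\cdot\|$ denote the $L^2(\Omega)$ inner product and norm, $\|\cdot\|_\infty$ the $L^\infty(\Omega)$ norm (with the Frobenius norm for matrices), $(\nabla u)_{ij}=\partial_j u_i$, $\mathbb D(u)=\frac12(\nabla u+\nabla u^T)$, and for $f\in X^*=H^{-1}(\Omega)^d$ let $\|f\|_{-1}$ be the least $M\ge 0$ with $|(f,v)|\le M\|\nabla v\|$ for all $v\in X$. Let $C_K>0$ be a Korn constant: $\|\nabla\phi\|\le C_K\|\mathbb D(\phi)\|$ for all $\phi\in X$. Let $\tau_h$ be a finite conforming simplicial mesh of $\Omega$ (that is, $\Omega$ is the interior of the union of its closed $d$-simplices) with maximal element diameter $h$, quasi-uniform with constant $\rho>0$ (every element contains a ball of radius $\rho h$). Let $X_h\subset X$ be a space of continuous piecewise polynomials of some bounded degree that vanish on $\partial\Omega$, let $Q_h\subset L^2_0(\Omega)$, and let $V_h=\{v\in X_h:(\nabla\cdot v,q)=0\ \forall q\in Q_h\}$.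 Let $\Sigma_h$ be a space of symmetric-tensor-valued, possibly discontinuous, piecewise polynomials $\tau$ of degree at most $m$ such that the distribution $u\cdot\nabla\tau$ belongs to $L^2(\Omega)^{d\times d}$ for all $u\in V_h$. Put $\|(v,s)\|_*=(\|\mathbb D(v)\|^2+\|s\|^2)^{1/2}$ on $V_h\times\Sigma_h$, and $$b(u,\sigma,\tau)=((u\cdot\nabla)\sigma,\tau)+\tfrac12((\nabla\cdot u)\sigma,\tau),\qquad c(u,\sigma,\tau)=b(u,\sigma,\tau)-(\nabla u\,\sigma,\tau)-(\sigma\nabla u^T,\tau).$$ Let $\lambda>0$, $0<\alpha<1$, $f\in H^{-1}(\Omega)^d$. The Picard solution operator $G=(G_1,G_2)$ of the discrete Oldroyd-B system maps $(u,\sigma)\in V_h\times\Sigma_h$ to the solution $(\tilde u,\tilde\sigma)\in V_h\times\Sigma_h$ of $$(\tilde\sigma,\tau)+\lambda c(u,\tilde\sigma,\tau)-2\alpha(\mathbb D(\tilde u),\tau)=0\quad\forall\tau\in\Sigma_h,$$ $$(\tilde\sigma,\mathbb D(v))+2(1-\alpha)(\mathbb D(\tilde u),\mathbb D(v))=(f,v)\quad\forall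 v\in V_h,$$ and $G'(u,\sigma;t,s)=(w,\zeta)\in V_h\times\Sigma_h$ is the solution of $$(\zeta,\tau)+\lambda\big(c(u,\zeta,\tau)+c(t,G_2(u,\sigma),\tau)\big)-2\alpha(\mathbb D(w),\tau)=0\quad\forall\tau\in\Sigma_h,$$ $$(\zeta,\mathbb D(v))+2(1-\alpha)(\mathbb D(w),\mathbb D(v))=0\quad\forall v\in V_h.$$ Then, at every $(u,\sigma)\in V_h\times\Sigma_h$ with $1-2\lambda\|\nabla u\|_\infty>0$, both systems are uniquely solvable (the second for every $(t,s)\in V_h\times\Sigma_h$), and $G'(u,\sigma;\cdot,\cdot)$ is linear, bounded, and the Fréchet derivative of $G$ at $(u,\sigma)$ with respect to $\|\cdot\|_*$. Moreover, there is a constant $C>0$ depending only on $d$, $\Omega$, $\rho$ and $m$ (and not on the mesh, $h$, the spaces $X_h,Q_h,\Sigma_h$, $C_K$, $\lambda$, $\alpha$ or $f$) such that for all $(u,\sigma),(t,s),(\phi,\xi)\in V_h\times\Sigma_h$ for which $M:=\max\{\|\nabla u\|_\infty,\|\nabla(u+t)\|_\infty\}$ satisfies $1-2\lambda M-2\lambda>0$,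 $$\|G'(u+t,\sigma+s;\phi,\xi)-G'(u,\sigma;\phi,\xi)\|_*\le\hat C_L\,\|(\phi,\xi)\|_*\,\|(t,s)\|_*,\qquad \hat C_L=\frac{C_L\,C_K\,C}{2h^2\sqrt{S\lambda^{-1}}},$$ where $$C_L=\frac{C\,C_K^2\,\|f\|_{-1}}{h^2\sqrt{2S\lambda^{-1}C_0(1-\alpha)}},\quad S=\min\{1-2\lambda M-2\lambda,\ 4\alpha(1-\alpha)\},\quad C_0=\min\Big\{\frac{1-2\lambda M}{2\alpha},\ 1-\alpha\Big\}.$$ -/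

import Mathlib

open MeasureTheory Set Filter Topology
open scoped ContDiff ENNReal

noncomputable section

namespace OldroydB

/-- The Euclidean space `ℝ^d`. -/
abbrev E (d : ℕ) := EuclideanSpace ℝ (Fin d)

/-- Tensor fields on `ℝ^d`. -/
abbrev TensorField (d : ℕ) := E d → Matrix (Fin d) (Fin d) ℝ

/-- The space `L²(Ω; F)`. -/
abbrev L2 {d : ℕ} (Ω : Set (E d)) (F : Type) [NormedAddCommGroup F] :=
  Lp F 2 (volume.restrict Ω)

/-- Test functions `φ ∈ C_c^∞(Ω)`. -/
def IsTestFunction {d : ℕ} (Ω : Set (E d)) (φ : E d → ℝ) : Prop :=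
  ContDiff ℝ ∞ φ ∧ HasCompactSupport φ ∧ tsupport φ ⊆ Ω

/-- The Sobolev space `H¹₀(Ω)`: the closure in `H¹` of the test functions. Its elements are
recorded as pairs `(v, ∇v) ∈ L²(Ω) × L²(Ω)^d`, so `H¹`-convergence is convergence of pairs. -/
def H10 {d : ℕ} (Ω : Set (E d)) : Submodule ℝ (L2 Ω ℝ × L2 Ω (E d)) :=
  (Submodule.span ℝ {p : L2 Ω ℝ × L2 Ω (E d) | ∃ φ : E d → ℝ, IsTestFunction Ω φ ∧
    p.1 =ᵐ[volume.restrict Ω] φ ∧ p.2 =ᵐ[volume.restrict Ω] gradient φ}).topologicalClosure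

/-- The velocity space `X = H¹₀(Ω)^d`. -/
abbrev VelocitySpace {d : ℕ} (Ω : Set (E d)) := Fin d → H10 Ω

variable {d : ℕ} {Ω : Set (E d)}

/-- The `i`-th component of a velocity. -/
def comp (v : VelocitySpace Ω) (i : Fin d) (x : E d) : ℝ := (v i).1.1 x

/-- The velocity gradient, `(∇v)_{ij} = ∂_j v_i`. -/
def grad (v : VelocitySpace Ω) : TensorField d :=
  fun x => Matrix.of fun i j => (v i).1.2 x j

/-- The deformation tensor `𝔻(v) = (∇v + ∇vᵀ) / 2`. -/
def symGrad (v : VelocitySpace Ω) : TensorField d :=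
  fun x => (1 / 2 : ℝ) • (grad v x + (grad v x).transpose)

/-- The divergence `∇·v`. -/
def div (v : VelocitySpace Ω) : L2 Ω ℝ :=
  ∑ i, (EuclideanSpace.proj (𝕜 := ℝ) i : E d →L[ℝ] ℝ).compLpL 2 (volume.restrict Ω) (v i).1.2

/-- The `L²(Ω)` inner product of tensor fields. -/
def ip (Ω : Set (E d)) (A B : TensorField d) : ℝ :=
  ∫ x in Ω, ∑ i, ∑ j, A x i j * B x i j

/-- The `L²(Ω)` norm of a tensor field. -/
def l2norm (Ω : Set (E d)) (A : TensorField d) : ℝ := Real.sqrt (ip Ω A A)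

/-- The `L^∞(Ω)` norm of a tensor field, for the Frobenius norm of matrices. It is used below only
for the gradients of piecewise polynomials, which are bounded. -/
def supNorm (Ω : Set (E d)) (A : TensorField d) : ℝ :=
  (eLpNorm (fun x => Real.sqrt (∑ i, ∑ j, A x i j ^ 2)) ∞ (volume.restrict Ω)).toReal

/-- `C_K` is a constant in the Korn inequality `‖∇φ‖ ≤ C_K ‖𝔻(φ)‖` on `X`. -/
def IsKornConstant (Ω : Set (E d)) (CK : ℝ) : Prop :=
  0 < CK ∧ ∀ φ : VelocitySpace Ω, l2norm Ω (grad φ) ≤ CK * l2norm Ω (symGrad φ)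

/-- The norm `‖f‖₋₁` of a functional `f ∈ H⁻¹(Ω)^d` on `X`, dual to `‖∇v‖`. -/
def dualNorm (f : VelocitySpace Ω →L[ℝ] ℝ) : ℝ :=
  sInf {M : ℝ | 0 ≤ M ∧ ∀ v, |f v| ≤ M * l2norm Ω (grad v)}

/-! ### Meshes and finite element spaces -/

/-- The elements of a mesh: the `d`-dimensional closed simplices. -/
def elements (T : Geometry.SimplicialComplex ℝ (E d)) : Set (Set (E d)) :=
  {K | ∃ s ∈ T.faces, s.card = d + 1 ∧ K = convexHull ℝ (s : Set (E d))}

/-- The maximal element diameter `h`. -/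
def meshSize (T : Geometry.SimplicialComplex ℝ (E d)) : ℝ :=
  sSup (Metric.diam '' elements T)

/-- `T` is a finite conforming simplicial mesh of `Ω`. -/
def IsMesh (Ω : Set (E d)) (T : Geometry.SimplicialComplex ℝ (E d)) : Prop :=
  T.faces.Finite ∧ Ω = interior (⋃₀ elements T)

/-- Quasi-uniformity: each element contains a ball of radius `ρ h`. -/
def IsQuasiUniform (ρ : ℝ) (T : Geometry.SimplicialComplex ℝ (E d)) : Prop :=
  ∀ K ∈ elements T, ∃ c, Metric.closedBall c (ρ * meshSize T) ⊆ K

/-- `g` coincides, inside each element, with a polynomial of degree at most `m`. -/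
def IsPiecewisePoly (T : Geometry.SimplicialComplex ℝ (E d)) (m : ℕ) (g : E d → ℝ) : Prop :=
  ∀ K ∈ elements T, ∃ p : MvPolynomial (Fin d) ℝ, p.totalDegree ≤ m ∧
    ∀ x ∈ interior K, g x = MvPolynomial.eval (fun i => x i) p

/-- The discretely divergence free velocities `V_h`. -/
def discDivFree (Xh : Submodule ℝ (VelocitySpace Ω)) (Qh : Submodule ℝ (L2 Ω ℝ)) :
    Submodule ℝ (VelocitySpace Ω) where
  carrier := {v | v ∈ Xh ∧ ∀ q ∈ Qh, inner ℝ (div v) q = 0}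
  zero_mem' := by
    refine ⟨Xh.zero_mem, fun q _ => ?_⟩
    have : div (0 : VelocitySpace Ω) = 0 := by
      simp [div]
    rw [this, inner_zero_left]
  add_mem' := by
    rintro v w ⟨hv, hv'⟩ ⟨hw, hw'⟩
    refine ⟨Xh.add_mem hv hw, fun q hq => ?_⟩
    have : div (v + w) = div v + div w := by
      simp [div, Finset.sum_add_distrib]
    rw [this, inner_add_left, hv' q hq, hw' q hq, add_zero]
  smul_mem' := by
    rintro c v ⟨hv, hv'⟩
    refine ⟨Xh.smul_mem c hv, fun q hq => ?_⟩
    have : div (c • v) = c • div v := by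
      simp [div, Finset.smul_sum]
    rw [this, inner_smul_left, hv' q hq, mul_zero]

/-- The directional derivative `u·∇g`, taken in the sense of distributions on `Ω`, lies in
`L²(Ω)`: `⟨u·∇g, φ⟩ = -∫ g ∇·(φ u)`. -/
def TransportInL2 (u : VelocitySpace Ω) (g : E d → ℝ) : Prop :=
  ∃ w : E d → ℝ, MemLp w 2 (volume.restrict Ω) ∧ ∀ φ, IsTestFunction Ω φ →
    ∫ x in Ω, w x * φ x =
      -∫ x in Ω, g x * ((∑ k, comp u k x * gradient φ x k) + div u x * φ x)

/-- Conforming finite element spaces `X_h ⊂ X`, `Q_h ⊂ L²₀(Ω)` and `Σ_h ⊂ Σ` on the mesh `T`. -/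
structure FESpaces (Ω : Set (E d)) (T : Geometry.SimplicialComplex ℝ (E d)) (k m : ℕ) where
  /-- discrete velocities -/
  Xh : Submodule ℝ (VelocitySpace Ω)
  /-- discrete pressures -/
  Qh : Submodule ℝ (L2 Ω ℝ)
  /-- discrete stresses; a discontinuous field is normalized to vanish on the mesh skeleton, so
  that fields which agree almost everywhere are equal -/
  Sh : Submodule ℝ (TensorField d)
  /-- velocities are continuous piecewise polynomials that vanish on the boundary -/
  velocity : ∀ v ∈ Xh, ∀ i, ∃ p : E d → ℝ, Continuous p ∧ (∀ x ∉ Ω, p x = 0) ∧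
    IsPiecewisePoly T k p ∧ comp v i =ᵐ[volume.restrict Ω] p
  /-- pressures have mean zero -/
  pressure : ∀ q ∈ Qh, ∫ x in Ω, q x = 0
  /-- stresses are symmetric -/
  stress_symm : ∀ τ ∈ Sh, ∀ x, (τ x).transpose = τ x
  /-- stresses are (possibly discontinuous) piecewise polynomials -/
  stress_poly : ∀ τ ∈ Sh, ∀ i j, IsPiecewisePoly T m (fun x => τ x i j)
  /-- the normalization off the open elements -/
  stress_zero : ∀ τ ∈ Sh, ∀ x, (∀ K ∈ elements T, x ∉ interior K) → τ x = 0
  /-- `u·∇τ ∈ L²(Ω)` for the discrete velocities `u ∈ V_h` -/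
  stress_transport : ∀ τ ∈ Sh, ∀ u ∈ discDivFree Xh Qh, ∀ i j,
    TransportInL2 u (fun x => τ x i j)

/-- The convective derivative `(u·∇)σ` of a piecewise polynomial tensor field, computed element
by element (the skeleton is a null set). -/
def conv (u : VelocitySpace Ω) (σ : TensorField d) : TensorField d :=
  fun x => Matrix.of fun i j => ∑ k, comp u k x * gradient (fun y => σ y i j) x k

/-- The trilinear form `b(u,σ,τ) = ((u·∇)σ,τ) + ½ ((∇·u)σ,τ)`. -/
def b (u : VelocitySpace Ω) (σ τ : TensorField d) : ℝ :=
  ip Ω (conv u σ) τ + 1 / 2 * ip Ω (fun x => div u x • σ x) τ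

/-- The form `b(u,σ,τ) - (∇u σ,τ) - (σ ∇uᵀ,τ)`. -/
def upperConv (u : VelocitySpace Ω) (σ τ : TensorField d) : ℝ :=
  b u σ τ - ip Ω (fun x => grad u x * σ x) τ - ip Ω (fun x => σ x * (grad u x).transpose) τ

namespace FESpaces

variable {T : Geometry.SimplicialComplex ℝ (E d)} {k m : ℕ}

/-- The discretely divergence free velocities `V_h`. -/
def Vh (F : FESpaces Ω T k m) : Submodule ℝ (VelocitySpace Ω) := discDivFree F.Xh F.Qh

/-- The product space `V_h × Σ_h`. -/
abbrev VS (F : FESpaces Ω T k m) := F.Vh × F.Sh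

/-- The norm `‖(v,s)‖_* = (‖𝔻(v)‖² + ‖s‖²)^{1/2}`. -/
def starNorm (F : FESpaces Ω T k m) (y : F.VS) : ℝ :=
  Real.sqrt (l2norm Ω (symGrad y.1.1) ^ 2 + l2norm Ω y.2.1 ^ 2)

/-- `z = (ũ, σ̃)` solves the discrete Picard step for the datum `x = (u, σ)`. -/
def IsPicardStep (F : FESpaces Ω T k m) (lam α : ℝ) (f : VelocitySpace Ω →L[ℝ] ℝ)
    (x z : F.VS) : Prop :=
  (∀ τ : F.Sh, ip Ω z.2.1 τ.1 + lam * upperConv x.1.1 z.2.1 τ.1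
      - 2 * α * ip Ω (symGrad z.1.1) τ.1 = 0) ∧
  ∀ v : F.Vh, ip Ω z.2.1 (symGrad v.1)
      + 2 * (1 - α) * ip Ω (symGrad z.1.1) (symGrad v.1) = f v.1

/-- The Picard solution operator `G` (meaningful at `x` if the step has a unique solution). -/
def G (F : FESpaces Ω T k m) (lam α : ℝ) (f : VelocitySpace Ω →L[ℝ] ℝ) (x : F.VS) : F.VS :=
  Classical.epsilon fun z => F.IsPicardStep lam α f x z

/-- `z` solves the linearized system that defines `G'(x; y)`, where `x = (u,σ)`, `y = (t,s)`. -/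
def IsLinearizedStep (F : FESpaces Ω T k m) (lam α : ℝ) (f : VelocitySpace Ω →L[ℝ] ℝ)
    (x y z : F.VS) : Prop :=
  (∀ τ : F.Sh, ip Ω z.2.1 τ.1
      + lam * (upperConv x.1.1 z.2.1 τ.1 + upperConv y.1.1 (F.G lam α f x).2.1 τ.1)
      - 2 * α * ip Ω (symGrad z.1.1) τ.1 = 0) ∧
  ∀ v : F.Vh, ip Ω z.2.1 (symGrad v.1)
      + 2 * (1 - α) * ip Ω (symGrad z.1.1) (symGrad v.1) = 0

/-- The operator `G'(x; y)` (meaningful if the linearized system has a unique solution). -/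
def G' (F : FESpaces Ω T k m) (lam α : ℝ) (f : VelocitySpace Ω →L[ℝ] ℝ) (x y : F.VS) : F.VS :=
  Classical.epsilon fun z => F.IsLinearizedStep lam α f x y z

/-- `L` is the Fréchet derivative of `Φ` at `x` with respect to `‖·‖_*`. -/
def HasFrechetDeriv (F : FESpaces Ω T k m) (Φ L : F.VS → F.VS) (x : F.VS) : Prop :=
  IsLinearMap ℝ L ∧ (∃ B : ℝ, ∀ y, F.starNorm (L y) ≤ B * F.starNorm y) ∧
  ∀ ε : ℝ, 0 < ε → ∃ δ : ℝ, 0 < δ ∧ ∀ y, F.starNorm y < δ →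
    F.starNorm (Φ (x + y) - Φ x - L y) ≤ ε * F.starNorm y

end FESpaces

/-- `S = min {1 - 2λM - 2λ, 4α(1-α)}`, where `M` stands for `‖∇u‖_∞`. -/
def Sconst (lam α M : ℝ) : ℝ := min (1 - 2 * lam * M - 2 * lam) (4 * α * (1 - α))

/-- `C_0 = min {(1 - 2λM) / (2α), 1 - α}`, where `M` stands for `‖∇u‖_∞`. -/
def C0const (lam α M : ℝ) : ℝ := min ((1 - 2 * lam * M) / (2 * α)) (1 - α)

/-- `C_L = C C_K² ‖f‖₋₁ / (h² √(2 S λ⁻¹ C_0 (1-α)))`, with `Nf` for `‖f‖₋₁`. -/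
def CLconst (C CK Nf h lam α M : ℝ) : ℝ :=
  C * CK ^ 2 * Nf /
    (h ^ 2 * Real.sqrt (2 * Sconst lam α M * lam⁻¹ * C0const lam α M * (1 - α)))

/-- `Ĉ_L = C_L C_K C / (2 h² √(S λ⁻¹))`. -/
def CLhat (C CK Nf h lam α M : ℝ) : ℝ :=
  CLconst C CK Nf h lam α M * CK * C / (2 * h ^ 2 * Real.sqrt (Sconst lam α M * lam⁻¹))

end OldroydB

end

noncomputable section

namespace OldroydB

/-! The argument separates linear algebra from finite element analysis. On abstract finite
dimensional spaces a Picard step is a square linear system. Testing it with its own solution, the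
velocity equation weighted by 2α, cancels the coupling terms and leaves (1 - 2λ‖∇u‖_∞)‖σ̃‖² +
4α(1-α)‖𝔻(ũ)‖² as a lower bound for the left-hand side (`IsStep.energy`). Hence the kernel is
trivial and the system is uniquely solvable (`existsUnique_isStep`). A solution for the velocity u +
t also solves the system for u with the extra datum -λ c(t, σ̃, ·) (`IsStep.shift`), so differences
of solutions solve the same system with small data. For G(x+y) - G(x) - G'(x;y) this gives a
quadratic remainder (`frechet`). For G'(u+t) - G'(u) it gives two terms, each with two factors of
the continuity constant β of c and one a priori bound of the stress (`lipschitz_deriv`).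

Two facts about the concrete form c remain. The first is c(u,σ,σ) ≥ -2‖∇u‖_∞‖σ‖², which rests on
b(u,σ,σ) = 0 (`b_self`). As σ may jump across faces, integration by parts on the elements does not
suffice; what is known is that the distribution u·∇σ is square integrable. `transport_energy` tests
it with a mollification of σ and symmetrizes the resulting kernel, a commutator argument in the
manner of DiPerna and Lions. The discrete velocity, extended by zero, is Lipschitz on the whole
space (`exists_lipschitz_velField`), and this controls both the commutator and the boundary layer.

The second is |c(u,σ,τ)| ≤ A h⁻² ‖∇u‖ ‖σ‖ ‖τ‖ with A depending only on d, Ω, ρ and m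
(`exists_abs_upperConv_le`). An inverse estimate is applied to σ alone. The velocity is measured in
L² on each element by a localized Sobolev inequality (`H10_sobolev`), so its polynomial degree does
not enter. The factors h^{-d/2} and h^{-1} from σ and h^{(d-2)/2} from u multiply to h⁻². Korn's
inequality gives β = A C_K / h², and β² C_K ‖f‖₋₁ is the numerator of Ĉ_L up to numerical factors
(`lipschitz_constant_le`). -/

/-! ### The abstract Picard step: solvability, differentiability and the Lipschitz bound. -/

/-- The bilinear and trilinear forms of the discrete Oldroyd-B system on abstract finite
dimensional spaces `V` of velocities and `S` of stresses, with the bounds that its analysis uses. -/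
structure PicardForms (V S : Type*) [AddCommGroup V] [Module ℝ V] [AddCommGroup S]
    [Module ℝ S] where
  /-- the form `(σ, τ)` -/
  aS : S →ₗ[ℝ] S →ₗ[ℝ] ℝ
  /-- the form `(𝔻 v, 𝔻 w)` -/
  aV : V →ₗ[ℝ] V →ₗ[ℝ] ℝ
  /-- the form `(𝔻 v, τ)` -/
  aVS : V →ₗ[ℝ] S →ₗ[ℝ] ℝ
  /-- the convected derivative -/
  c : V →ₗ[ℝ] S →ₗ[ℝ] S →ₗ[ℝ] ℝ
  /-- the size of the velocity gradient -/
  bd : V → ℝ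
  /-- the continuity constant of `c` -/
  β : ℝ
  /-- the continuity constant of `bd` -/
  γ : ℝ
  aS_pos : ∀ s, s ≠ 0 → 0 < aS s s
  aV_pos : ∀ v, v ≠ 0 → 0 < aV v v
  β_nonneg : 0 ≤ β
  γ_nonneg : 0 ≤ γ
  c_le : ∀ t ζ τ, |c t ζ τ| ≤ β * √(aV t t) * √(aS ζ ζ) * √(aS τ τ)
  c_self : ∀ u σ, -(2 * bd u * aS σ σ) ≤ c u σ σ
  -- This only makes the condition on `bd` stable under small perturbations, for differentiability.
  -- The constant γ does not enter the Lipschitz estimate, so it may depend on the mesh.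
  bd_add : ∀ u t, bd (u + t) ≤ bd u + γ * √(aV t t)

namespace PicardForms

variable {V S : Type*} [AddCommGroup V] [Module ℝ V] [AddCommGroup S] [Module ℝ S]
  (P : PicardForms V S)

/-- `z` solves the linear system with transport velocity `u` and right-hand side `(ℓ, f)`. -/
def IsStep (lam α : ℝ) (u : V) (ℓ : S →ₗ[ℝ] ℝ) (f : V →ₗ[ℝ] ℝ) (z : V × S) : Prop :=
  (∀ τ, P.aS z.2 τ + lam * P.c u z.2 τ - 2 * α * P.aVS z.1 τ = ℓ τ) ∧
  ∀ v, P.aVS v z.2 + 2 * (1 - α) * P.aV z.1 v = f v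

/-- The norm `‖(v, s)‖_*`. -/
def star (z : V × S) : ℝ := √(P.aV z.1 z.1 + P.aS z.2 z.2)

variable {P} {lam α : ℝ} {u : V}

lemma aS_nonneg (s : S) : 0 ≤ P.aS s s := by
  by_cases h : s = 0
  · simp [h]
  · exact (P.aS_pos s h).le

lemma aV_nonneg (s : V) : 0 ≤ P.aV s s := by
  by_cases h : s = 0
  · simp [h]
  · exact (P.aV_pos s h).le

lemma sq_star (z : V × S) : P.star z ^ 2 = P.aV z.1 z.1 + P.aS z.2 z.2 :=
  Real.sq_sqrt (add_nonneg (aV_nonneg _) (aS_nonneg _))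

lemma star_nonneg (z : V × S) : 0 ≤ P.star z := Real.sqrt_nonneg _

lemma sqrt_aV_le_star (z : V × S) : √(P.aV z.1 z.1) ≤ P.star z :=
  Real.sqrt_le_sqrt (by linarith [aS_nonneg (P := P) z.2])

lemma sqrt_aS_le_star (z : V × S) : √(P.aS z.2 z.2) ≤ P.star z :=
  Real.sqrt_le_sqrt (by linarith [aV_nonneg (P := P) z.1])

/-- Test the constitutive equation with the stress and the velocity equation with 2α times the
velocity: the two coupling terms cancel. The form c is then bounded below by `c_self`. -/
lemma IsStep.energy {ℓ : S →ₗ[ℝ] ℝ} {f : V →ₗ[ℝ] ℝ} {z : V × S} (hl : 0 ≤ lam)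
    (h : P.IsStep lam α u ℓ f z) :
    (1 - 2 * lam * P.bd u) * P.aS z.2 z.2 + 4 * α * (1 - α) * P.aV z.1 z.1
      ≤ ℓ z.2 + 2 * α * f z.1 := by
  have h1 := h.1 z.2
  have h2 := h.2 z.1
  have h3 := mul_le_mul_of_nonneg_left (P.c_self u z.2) hl
  rw [← h1, ← h2]
  nlinarith

lemma IsStep.sub {ℓ ℓ' : S →ₗ[ℝ] ℝ} {f f' : V →ₗ[ℝ] ℝ} {z z' : V × S}
    (h : P.IsStep lam α u ℓ f z) (h' : P.IsStep lam α u ℓ' f' z') :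
    P.IsStep lam α u (ℓ - ℓ') (f - f') (z - z') := by
  refine ⟨fun τ => ?_, fun v => ?_⟩
  · have := h.1 τ
    have := h'.1 τ
    simp only [Prod.fst_sub, Prod.snd_sub, map_sub, LinearMap.sub_apply]
    linarith
  · have := h.2 v
    have := h'.2 v
    simp only [Prod.fst_sub, Prod.snd_sub, map_sub, LinearMap.sub_apply]
    linarith

lemma IsStep.add {ℓ ℓ' : S →ₗ[ℝ] ℝ} {f f' : V →ₗ[ℝ] ℝ} {z z' : V × S}
    (h : P.IsStep lam α u ℓ f z) (h' : P.IsStep lam α u ℓ' f' z') :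
    P.IsStep lam α u (ℓ + ℓ') (f + f') (z + z') := by
  refine ⟨fun τ => ?_, fun v => ?_⟩
  · have := h.1 τ
    have := h'.1 τ
    simp only [Prod.fst_add, Prod.snd_add, map_add, LinearMap.add_apply]
    linarith
  · have := h.2 v
    have := h'.2 v
    simp only [Prod.fst_add, Prod.snd_add, map_add, LinearMap.add_apply]
    linarith

lemma IsStep.smul {ℓ : S →ₗ[ℝ] ℝ} {f : V →ₗ[ℝ] ℝ} {z : V × S}
    (h : P.IsStep lam α u ℓ f z) (a : ℝ) : P.IsStep lam α u (a • ℓ) (a • f) (a • z) := by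
  refine ⟨fun τ => ?_, fun v => ?_⟩
  · simp only [Prod.smul_fst, Prod.smul_snd, map_smul, LinearMap.smul_apply, smul_eq_mul, ← h.1 τ]
    ring
  · simp only [Prod.smul_fst, Prod.smul_snd, map_smul, LinearMap.smul_apply, smul_eq_mul, ← h.2 v]
    ring

/-- A solution for the velocity `u + t` solves a perturbed system for the velocity `u`. -/
lemma IsStep.shift {ℓ : S →ₗ[ℝ] ℝ} {f : V →ₗ[ℝ] ℝ} {z : V × S} {t : V}
    (h : P.IsStep lam α (u + t) ℓ f z) :
    P.IsStep lam α u (ℓ - lam • P.c t z.2) f z := by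
  refine ⟨fun τ => ?_, h.2⟩
  have := h.1 τ
  simp only [map_add, LinearMap.add_apply, LinearMap.sub_apply, LinearMap.smul_apply,
    smul_eq_mul] at this ⊢
  linarith

lemma four_mul_pos (h0 : 0 < α) (h1 : α < 1) : 0 < 4 * α * (1 - α) := by
  have : 0 < 1 - α := by linarith
  positivity

lemma IsStep.eq_zero {z : V × S} (hl : 0 ≤ lam) (h0 : 0 < α) (h1 : α < 1)
    (hu : 2 * lam * P.bd u < 1) (h : P.IsStep lam α u 0 0 z) : z = 0 := by
  have e := h.energy hl
  simp only [LinearMap.zero_apply, mul_zero, add_zero] at e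
  have hA := four_mul_pos h0 h1
  have hB : 0 < 1 - 2 * lam * P.bd u := by linarith
  have p1 := mul_nonneg hB.le (aS_nonneg (P := P) z.2)
  have p2 := mul_nonneg hA.le (aV_nonneg (P := P) z.1)
  apply Prod.ext
  · by_contra hz
    have := mul_pos hA (P.aV_pos _ hz)
    linarith
  · by_contra hz
    have := mul_pos hB (P.aS_pos _ hz)
    linarith

lemma IsStep.unique {ℓ : S →ₗ[ℝ] ℝ} {f : V →ₗ[ℝ] ℝ} {z z' : V × S} (hl : 0 ≤ lam)
    (h0 : 0 < α) (h1 : α < 1) (hu : 2 * lam * P.bd u < 1)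
    (h : P.IsStep lam α u ℓ f z) (h' : P.IsStep lam α u ℓ f z') : z = z' := by
  have := h.sub h'
  rw [sub_self, sub_self] at this
  exact sub_eq_zero.1 (this.eq_zero hl h0 h1 hu)

/-- The system is a linear map from V × S to the product of the duals, spaces of equal finite
dimension, so injectivity, which is the energy estimate, gives surjectivity. -/
theorem existsUnique_isStep [FiniteDimensional ℝ V] [FiniteDimensional ℝ S] (hl : 0 ≤ lam)
    (h0 : 0 < α) (h1 : α < 1) (hu : 2 * lam * P.bd u < 1) (ℓ : S →ₗ[ℝ] ℝ) (f : V →ₗ[ℝ] ℝ) :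
    ∃! z, P.IsStep lam α u ℓ f z := by
  let A : V × S →ₗ[ℝ] (V →ₗ[ℝ] ℝ) × (S →ₗ[ℝ] ℝ) :=
    LinearMap.prod
      (P.aVS.flip ∘ₗ LinearMap.snd ℝ V S + (2 * (1 - α)) • (P.aV ∘ₗ LinearMap.fst ℝ V S))
      ((P.aS + lam • P.c u) ∘ₗ LinearMap.snd ℝ V S - (2 * α) • (P.aVS ∘ₗ LinearMap.fst ℝ V S))
  have hA : ∀ z ℓ f, A z = (f, ℓ) ↔ P.IsStep lam α u ℓ f z := by
    intro z ℓ f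
    rw [Prod.ext_iff, and_comm]
    exact and_congr LinearMap.ext_iff LinearMap.ext_iff
  have inj : Function.Injective A := by
    rw [← LinearMap.ker_eq_bot, LinearMap.ker_eq_bot']
    intro z hz
    exact ((hA z 0 0).1 hz).eq_zero hl h0 h1 hu
  have hdim : Module.finrank ℝ (V × S) = Module.finrank ℝ ((V →ₗ[ℝ] ℝ) × (S →ₗ[ℝ] ℝ)) := by
    rw [Module.finrank_prod, Module.finrank_prod]
    congr 1
    · exact (Subspace.dual_finrank_eq (K := ℝ) (V := V)).symm
    · exact (Subspace.dual_finrank_eq (K := ℝ) (V := S)).symm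
  obtain ⟨z, hz⟩ := (LinearMap.injective_iff_surjective_of_finrank_eq_finrank hdim).1 inj (f, ℓ)
  have hz' := (hA z ℓ f).1 hz
  exact ⟨z, hz', fun y hy => hy.unique hl h0 h1 hu hz'⟩

/-- Stability with respect to the right-hand side of the constitutive equation. -/
lemma IsStep.star_le {ℓ : S →ₗ[ℝ] ℝ} {z : V × S} {κ g : ℝ} (hl : 0 ≤ lam) (hκ : 0 < κ)
    (hκ1 : κ ≤ 1 - 2 * lam * P.bd u) (hκ2 : κ ≤ 4 * α * (1 - α)) (hg : 0 ≤ g)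
    (hℓ : ∀ τ, |ℓ τ| ≤ g * √(P.aS τ τ)) (h : P.IsStep lam α u ℓ 0 z) :
    P.star z ≤ g / κ := by
  have e := h.energy hl
  simp only [LinearMap.zero_apply, mul_zero, add_zero] at e
  have k1 := mul_le_mul_of_nonneg_right hκ1 (aS_nonneg (P := P) z.2)
  have k2 := mul_le_mul_of_nonneg_right hκ2 (aV_nonneg (P := P) z.1)
  have k3 := (le_abs_self _).trans (hℓ z.2)
  have k4 := mul_le_mul_of_nonneg_left (sqrt_aS_le_star (P := P) z) hg
  have k5 := sq_star (P := P) z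
  have k6 := star_nonneg (P := P) z
  rw [le_div_iff₀ hκ]
  rcases k6.eq_or_lt with k7 | k7
  · rw [← k7]; simpa using hg
  · refine le_of_mul_le_mul_right ?_ k7
    nlinarith

/-- The variant of `IsStep.star_le` in which part of the coercivity absorbs the data. -/
lemma IsStep.star_le_sqrt {ℓ : S →ₗ[ℝ] ℝ} {z : V × S} {κ g : ℝ} (hl : 0 < lam) (hκ : 0 < κ)
    (hκ1 : κ ≤ 1 - 2 * lam * P.bd u - 2 * lam) (hκ2 : κ ≤ 4 * α * (1 - α)) (hg : 0 ≤ g)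
    (hℓ : ∀ τ, |ℓ τ| ≤ lam * g * √(P.aS τ τ)) (h : P.IsStep lam α u ℓ 0 z) :
    P.star z ≤ g / (2 * √2 * √(κ * lam⁻¹)) := by
  have e := h.energy hl.le
  simp only [LinearMap.zero_apply, mul_zero, add_zero] at e
  have k1 := mul_le_mul_of_nonneg_right hκ1 (aS_nonneg (P := P) z.2)
  have k2 := mul_le_mul_of_nonneg_right hκ2 (aV_nonneg (P := P) z.1)
  have k3 := (le_abs_self _).trans (hℓ z.2)
  have k5 := sq_star (P := P) z
  have k6 := star_nonneg (P := P) z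
  have hs : √(P.aS z.2 z.2) ^ 2 = P.aS z.2 z.2 := Real.sq_sqrt (aS_nonneg _)
  -- The reserve 2λ‖σ‖² in the coercivity absorbs the datum: with s = ‖σ‖, g s - 2 s² ≤ g² / 8. This
  -- is the source of the factor 2√2.
  have k8 : κ * P.star z ^ 2 ≤ lam * (g ^ 2 / 8) := by
    have : 0 ≤ lam * (4 * √(P.aS z.2 z.2) - g) ^ 2 := by positivity
    nlinarith
  have hD : 0 < 2 * √2 * √(κ * lam⁻¹) := by positivity
  rw [le_div_iff₀ hD]
  refine abs_le_of_sq_le_sq' ?_ hg |>.2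
  rw [mul_pow, mul_pow, mul_pow, Real.sq_sqrt (by norm_num), Real.sq_sqrt (by positivity)]
  have : P.star z ^ 2 * (2 ^ 2 * 2 * (κ * lam⁻¹)) = 8 * lam⁻¹ * (κ * P.star z ^ 2) := by ring
  rw [this]
  calc 8 * lam⁻¹ * (κ * P.star z ^ 2) ≤ 8 * lam⁻¹ * (lam * (g ^ 2 / 8)) := by gcongr
    _ = g ^ 2 := by field_simp

/-- The a priori bound of a Picard step. -/
lemma IsStep.sqrt_aS_le {f : V →ₗ[ℝ] ℝ} {z : V × S} {κ N : ℝ} (hl : 0 ≤ lam) (h0 : 0 < α)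
    (h1 : α < 1) (hκ : 0 < κ) (hκ1 : κ ≤ (1 - 2 * lam * P.bd u) / (2 * α)) (hN : 0 ≤ N)
    (hf : ∀ v, |f v| ≤ N * √(P.aV v v)) (h : P.IsStep lam α u 0 f z) :
    √(P.aS z.2 z.2) ≤ N / (2 * √(κ * (1 - α))) := by
  have e := h.energy hl
  simp only [LinearMap.zero_apply, zero_add] at e
  have k1 := mul_le_mul_of_nonneg_right hκ1 (aS_nonneg (P := P) z.2)
  have k3 := (le_abs_self _).trans (hf z.1)
  have h1' : 0 < 1 - α := by linarith
  have hv : √(P.aV z.1 z.1) ^ 2 = P.aV z.1 z.1 := Real.sq_sqrt (aV_nonneg _)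
  have hD : 0 < 2 * √(κ * (1 - α)) := by positivity
  rw [le_div_iff₀ hD]
  refine abs_le_of_sq_le_sq' ?_ hN |>.2
  rw [mul_pow, mul_pow, Real.sq_sqrt (aS_nonneg _), Real.sq_sqrt (by positivity)]
  -- The energy inequality divided by 2α, so that the load enters with coefficient one; the first
  -- coefficient is then the one that occurs in C_0.
  have e' : (1 - 2 * lam * P.bd u) / (2 * α) * P.aS z.2 z.2 + 2 * (1 - α) * P.aV z.1 z.1
      ≤ f z.1 := by
    refine le_of_mul_le_mul_left ?_ (show 0 < 2 * α by positivity)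
    refine le_trans (le_of_eq ?_) e
    field_simp
    ring
  have e2 : κ * P.aS z.2 z.2 + 2 * (1 - α) * √(P.aV z.1 z.1) ^ 2 ≤ N * √(P.aV z.1 z.1) := by
    rw [hv]; linarith
  have e3 := mul_le_mul_of_nonneg_left e2 (show 0 ≤ 4 * (1 - α) by positivity)
  -- Young's inequality: the velocity term on the left absorbs N‖𝔻(ũ)‖ up to a multiple of N² / (1 -
  -- α).
  nlinarith [sq_nonneg (N - 2 * (1 - α) * √(P.aV z.1 z.1)),
    mul_nonneg (sq_nonneg (1 - α)) (sq_nonneg √(P.aV z.1 z.1))]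

lemma abs_smul_c_le (hl : 0 ≤ lam) (t : V) (ζ τ : S) :
    |(-(lam • P.c t ζ)) τ| ≤ lam * (P.β * √(P.aV t t) * √(P.aS ζ ζ)) * √(P.aS τ τ) := by
  rw [LinearMap.neg_apply, LinearMap.smul_apply, abs_neg, smul_eq_mul, abs_mul, abs_of_nonneg hl,
    mul_assoc]
  exact mul_le_mul_of_nonneg_left (P.c_le t ζ τ) hl

/-- The Picard operator is Fréchet differentiable. -/
theorem frechet {f : V →ₗ[ℝ] ℝ} (hl : 0 < lam) (h0 : 0 < α) (h1 : α < 1)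
    {G : V × S → V × S}
    (hG : ∀ x : V × S, 2 * lam * P.bd x.1 < 1 → P.IsStep lam α x.1 0 f (G x))
    {x : V × S} (hx : 2 * lam * P.bd x.1 < 1) {L : V × S → V × S}
    (hL : ∀ y, P.IsStep lam α x.1 (-(lam • P.c y.1 (G x).2)) 0 (L y)) :
    IsLinearMap ℝ L ∧ (∃ B : ℝ, ∀ y, P.star (L y) ≤ B * P.star y) ∧
    ∀ ε : ℝ, 0 < ε → ∃ δ : ℝ, 0 < δ ∧ ∀ y, P.star y < δ →
      P.star (G (x + y) - G x - L y) ≤ ε * P.star y := by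
  set κ := min (1 - 2 * lam * P.bd x.1) (4 * α * (1 - α)) with hκ
  have hκ0 : 0 < κ := lt_min (by linarith) (four_mul_pos h0 h1)
  have hκ1 : κ ≤ 1 - 2 * lam * P.bd x.1 := min_le_left _ _
  have hκ2 : κ ≤ 4 * α * (1 - α) := min_le_right _ _
  set s₀ := √(P.aS (G x).2 (G x).2) with hs₀
  have hs₀' : 0 ≤ s₀ := Real.sqrt_nonneg _
  have hβ := P.β_nonneg
  have hγ := P.γ_nonneg
  refine ⟨⟨fun y y' => ?_, fun a y => ?_⟩, ⟨lam * P.β * s₀ / κ, fun y => ?_⟩, fun ε hε => ?_⟩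
  · refine (hL (y + y')).unique hl.le h0 h1 hx ?_
    have := (hL y).add (hL y')
    rw [add_zero] at this
    convert this using 1
    ext τ; simp; ring
  · refine (hL (a • y)).unique hl.le h0 h1 hx ?_
    have := (hL y).smul a
    rw [smul_zero] at this
    convert this using 1
    ext τ; simp; ring
  · have := (hL y).star_le hl.le hκ0 hκ1 hκ2
      (g := lam * (P.β * √(P.aV y.1 y.1) * s₀)) (by positivity) (fun τ => abs_smul_c_le hl.le _ _ τ)
    refine this.trans ?_
    rw [div_mul_eq_mul_div]
    refine div_le_div_of_nonneg_right ?_ hκ0.le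
    have := sqrt_aV_le_star (P := P) y
    calc lam * (P.β * √(P.aV y.1 y.1) * s₀) = lam * P.β * s₀ * √(P.aV y.1 y.1) := by ring
      _ ≤ lam * P.β * s₀ * P.star y := by gcongr
  set q := lam * P.β / κ with hq
  have hq0 : 0 ≤ q := by positivity
  -- The first radius keeps x + y in the domain of solvability, the second allows the increment of G
  -- to be absorbed (q n ≤ 1/2), and the third makes the quadratic remainder at most ε n. The added
  -- ones keep the denominators positive.
  refine ⟨min ((1 - 2 * lam * P.bd x.1) / (2 * lam * P.γ + 1))
    (min (1 / (2 * q + 1)) (ε / (2 * q ^ 2 * s₀ + 1))), ?_, fun y hy => ?_⟩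
  · have : 0 < 1 - 2 * lam * P.bd x.1 := by linarith
    positivity
  rw [lt_min_iff, lt_min_iff] at hy
  obtain ⟨hy1, hy2, hy3⟩ := hy
  set n := P.star y with hn
  have hn0 : 0 ≤ n := star_nonneg y
  have htn : √(P.aV y.1 y.1) ≤ n := sqrt_aV_le_star y
  have hxy : 2 * lam * P.bd (x + y).1 < 1 := by
    rw [lt_div_iff₀ (by positivity)] at hy1
    have h2 := P.bd_add x.1 y.1
    have h3 : P.γ * √(P.aV y.1 y.1) ≤ P.γ * n := by gcongr
    have h4 : P.bd (x + y).1 ≤ P.bd x.1 + P.γ * n := h2.trans (by linarith)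
    have h5 := mul_le_mul_of_nonneg_left h4 (show 0 ≤ 2 * lam by positivity)
    nlinarith
  have s1 := hG x hx
  -- The increment δ of G solves the system at x with datum -λ c(y, G(x+y), ·), which contains δ
  -- itself through G(x+y) = G(x) + δ.
  have s2 : P.IsStep lam α x.1 _ f (G (x + y)) := (hG (x + y) hxy).shift
  set δ := G (x + y) - G x with hδ
  have s3 := s2.sub s1
  rw [← hδ, sub_self, sub_zero] at s3
  have hδ2 : (G (x + y)).2 = (G x).2 + δ.2 := by simp [hδ]
  set r := √(P.aS δ.2 δ.2) with hr
  have hr0 : 0 ≤ r := Real.sqrt_nonneg _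
  have hrs : r ≤ P.star δ := sqrt_aS_le_star δ
  have hδn : P.star δ ≤ q * n * (s₀ + r) := by
    have := s3.star_le (g := lam * P.β * n * (s₀ + r)) hl.le hκ0 hκ1 hκ2 (by positivity)
      fun τ => by
        have e : (0 - lam • P.c y.1 (G (x + y)).2) τ =
            (-(lam • P.c y.1 (G x).2)) τ + (-(lam • P.c y.1 δ.2)) τ := by
          rw [hδ2]; simp; ring
        rw [e]
        refine (abs_add_le _ _).trans ((add_le_add (abs_smul_c_le hl.le _ _ _)
          (abs_smul_c_le hl.le _ _ _)).trans ?_)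
        rw [← hs₀, ← hr]
        calc _ = lam * P.β * √(P.aV y.1 y.1) * (s₀ + r) * √(P.aS τ τ) := by ring
          _ ≤ _ := by gcongr
    refine this.trans (le_of_eq ?_)
    rw [hq]; ring
  have hqn : q * n ≤ 1 / 2 := by
    rw [lt_div_iff₀ (by positivity)] at hy2
    nlinarith
  -- The increment is of first order in y: r ≤ q n (s₀ + r), and q n r ≤ r / 2 is moved to the left.
  have hr2 : r ≤ 2 * q * n * s₀ := by
    have : q * n * r ≤ 1 / 2 * r := by gcongr
    nlinarith
  -- In the remainder only -λ c(y, δ, ·) is left as datum, a product of two quantities of first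
  -- order.
  have s4 := s3.sub (hL y)
  have e4 : 0 - lam • P.c y.1 (G (x + y)).2 - -(lam • P.c y.1 (G x).2) =
      -(lam • P.c y.1 δ.2) := by
    rw [hδ2]; ext τ; simp
  rw [e4, sub_zero] at s4
  have := s4.star_le (g := lam * (P.β * √(P.aV y.1 y.1) * r)) hl.le hκ0 hκ1 hκ2
    (by positivity) (fun τ => abs_smul_c_le hl.le _ _ τ)
  refine this.trans ?_
  calc lam * (P.β * √(P.aV y.1 y.1) * r) / κ = q * √(P.aV y.1 y.1) * r := by rw [hq]; ring
    _ ≤ q * n * (2 * q * n * s₀) := by gcongr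
    _ = (n * (2 * q ^ 2 * s₀)) * n := by ring
    _ ≤ ε * n := by
      gcongr
      rw [lt_div_iff₀ (by positivity)] at hy3
      nlinarith

/-- The derivative of the Picard operator is Lipschitz continuous. -/
theorem lipschitz_deriv {f : V →ₗ[ℝ] ℝ} {N M : ℝ} (hl : 0 < lam) (h0 : 0 < α) (h1 : α < 1)
    (hN : 0 ≤ N) (hf : ∀ v, |f v| ≤ N * √(P.aV v v)) (hM : 0 < 1 - 2 * lam * M - 2 * lam)
    {u t φ : V} (hu : P.bd u ≤ M) (hut : P.bd (u + t) ≤ M) {g₁ g₂ z₁ z₂ : V × S}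
    (hg₁ : P.IsStep lam α u 0 f g₁) (hg₂ : P.IsStep lam α (u + t) 0 f g₂)
    (hz₁ : P.IsStep lam α u (-(lam • P.c φ g₁.2)) 0 z₁)
    (hz₂ : P.IsStep lam α (u + t) (-(lam • P.c φ g₂.2)) 0 z₂) :
    P.star (z₂ - z₁) ≤ P.β ^ 2 * N /
      (8 * (Sconst lam α M * lam⁻¹) * √(C0const lam α M * (1 - α))) *
        √(P.aV φ φ) * √(P.aV t t) := by
  have hβ := P.β_nonneg
  set κ := Sconst lam α M with hκ
  have hκ0 : 0 < κ := lt_min hM (four_mul_pos h0 h1)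
  have hκ1 : ∀ v, P.bd v ≤ M → κ ≤ 1 - 2 * lam * P.bd v - 2 * lam := fun v hv =>
    (min_le_left _ _).trans (by nlinarith)
  have hκ2 : κ ≤ 4 * α * (1 - α) := min_le_right _ _
  set κ' := C0const lam α M with hκ'
  have h1' : 0 < 1 - α := by linarith
  have hκ'0 : 0 < κ' := lt_min (div_pos (by linarith) (by linarith)) h1'
  have hκ'1 : κ' ≤ (1 - 2 * lam * P.bd (u + t)) / (2 * α) :=
    (min_le_left _ _).trans (div_le_div_of_nonneg_right (by nlinarith) (by positivity))
  set D := 2 * √2 * √(κ * lam⁻¹) with hD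
  have hD0 : 0 < D := by positivity
  set Q := N / (2 * √(κ' * (1 - α))) with hQ
  have hQ0 : 0 ≤ Q := by positivity
  have e1 : √(P.aS g₂.2 g₂.2) ≤ Q := hg₂.sqrt_aS_le hl.le h0 h1 hκ'0 hκ'1 hN hf
  have e2 : P.star z₂ ≤ P.β * √(P.aV φ φ) * Q / D := by
    refine hz₂.star_le_sqrt hl hκ0 (hκ1 _ hut) hκ2 (by positivity) fun τ => ?_
    refine (abs_smul_c_le hl.le _ _ _).trans ?_
    gcongr
  -- The load is common to both steps and drops out; the change of velocity becomes the datum -λ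
  -- c(t, g₂, ·), to which the a priori bound of g₂ applies.
  have e3 : P.star (g₂ - g₁) ≤ P.β * √(P.aV t t) * Q / D := by
    have s := hg₂.shift.sub hg₁
    rw [sub_self] at s
    refine s.star_le_sqrt hl hκ0 (hκ1 _ hu) hκ2 (by positivity) fun τ => ?_
    rw [zero_sub, sub_zero]
    refine (abs_smul_c_le hl.le _ _ _).trans ?_
    gcongr
  have e2' := (sqrt_aS_le_star (P := P) z₂).trans e2
  have e3' := (sqrt_aS_le_star (P := P) (g₂ - g₁)).trans e3
  -- The datum of the difference is -λ c(t, z₂, ·) - λ c(φ, g₂ - g₁, ·): one part from the transport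
  -- velocity of the linearized system, the other from its right-hand side.
  have e4 : P.star (z₂ - z₁) ≤
      (P.β * √(P.aV t t) * (P.β * √(P.aV φ φ) * Q / D) +
        P.β * √(P.aV φ φ) * (P.β * √(P.aV t t) * Q / D)) / D := by
    have s := hz₂.shift.sub hz₁
    rw [sub_self] at s
    refine s.star_le_sqrt hl hκ0 (hκ1 _ hu) hκ2 (by positivity) fun τ => ?_
    have e : (-(lam • P.c φ g₂.2) - lam • P.c t z₂.2 - -(lam • P.c φ g₁.2)) τ =
        (-(lam • P.c t z₂.2)) τ + (-(lam • P.c φ (g₂ - g₁).2)) τ := by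
      simp; ring
    rw [e, mul_add, add_mul]
    refine (abs_add_le _ _).trans (add_le_add ((abs_smul_c_le hl.le _ _ _).trans ?_)
      ((abs_smul_c_le hl.le _ _ _).trans ?_))
    · gcongr
    · gcongr
  refine e4.trans (le_of_eq ?_)
  have hDD : D * D = 8 * (κ * lam⁻¹) := by
    rw [hD]
    have a1 := Real.mul_self_sqrt (show (0 : ℝ) ≤ 2 by norm_num)
    have a2 := Real.mul_self_sqrt (show 0 ≤ κ * lam⁻¹ by positivity)
    calc _ = 4 * (√2 * √2) * (√(κ * lam⁻¹) * √(κ * lam⁻¹)) := by ring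
      _ = _ := by rw [a1, a2]; ring
  calc _ = 2 * P.β ^ 2 * √(P.aV t t) * √(P.aV φ φ) * Q / (D * D) := by ring
    _ = _ := by
      rw [hDD, hQ]
      ring

end PicardForms

/-! ### Weak gradients, a localized Sobolev inequality and the Poincaré inequality on H¹₀(Ω). -/

section Sobolev

variable {d : ℕ} {Ω : Set (E d)}

lemma inner_gradient {φ : E d → ℝ} (x e : E d) :
    inner ℝ (gradient φ x) e = fderiv ℝ φ x e := by
  rw [gradient, InnerProductSpace.toDual_symm_apply]

lemma norm_gradient {φ : E d → ℝ} (x : E d) : ‖gradient φ x‖ = ‖fderiv ℝ φ x‖ := by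
  rw [gradient, LinearIsometryEquiv.norm_map]

lemma gradient_apply (φ : E d → ℝ) (x : E d) (k : Fin d) :
    gradient φ x k = fderiv ℝ φ x (EuclideanSpace.single k 1) := by
  rw [← inner_gradient, EuclideanSpace.inner_single_right]
  simp

lemma IsTestFunction.eq_zero {φ : E d → ℝ} (h : IsTestFunction Ω φ) {x : E d} (hx : x ∉ Ω) :
    φ x = 0 := image_eq_zero_of_notMem_tsupport fun h' => hx (h.2.2 h')

lemma IsTestFunction.fderiv_eq_zero {φ : E d → ℝ} (h : IsTestFunction Ω φ) {x : E d}
    (hx : x ∉ Ω) : fderiv ℝ φ x = 0 :=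
  fderiv_of_notMem_tsupport (𝕜 := ℝ) fun h' => hx (h.2.2 h')

/-- Integration by parts for smooth functions, one of them compactly supported. -/
lemma integral_mul_fderiv_of_compact {φ ψ : E d → ℝ} (hφ : ContDiff ℝ ∞ φ) (hψ : ContDiff ℝ ∞ ψ)
    (hc : HasCompactSupport ψ) (e : E d) :
    ∫ x, φ x * fderiv ℝ ψ x e = -∫ x, fderiv ℝ φ x e * ψ x := by
  have c1 : Continuous (fun x => fderiv ℝ φ x e) :=
    (hφ.continuous_fderiv (by simp)).clm_apply continuous_const
  have c2 : Continuous (fun x => fderiv ℝ ψ x e) :=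
    (hψ.continuous_fderiv (by simp)).clm_apply continuous_const
  have s2 : HasCompactSupport (fun x => fderiv ℝ ψ x e) :=
    (hc.fderiv ℝ).comp_left (g := fun L : E d →L[ℝ] ℝ => L e) rfl
  refine integral_mul_fderiv_eq_neg_fderiv_mul_of_integrable ?_ ?_ ?_ ?_ ?_
  · exact (c1.mul hψ.continuous).integrable_of_hasCompactSupport hc.mul_left
  · exact (hφ.continuous.mul c2).integrable_of_hasCompactSupport s2.mul_left
  · exact (hφ.continuous.mul hψ.continuous).integrable_of_hasCompactSupport hc.mul_left
  · exact fun x _ => (hφ.differentiable (by simp)).differentiableAt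
  · exact fun x _ => (hψ.differentiable (by simp)).differentiableAt

/-- The second component of an element of `H¹₀(Ω)` is the weak gradient of the extension by zero
of the first one. -/
theorem H10_weak_gradient {p : L2 Ω ℝ × L2 Ω (E d)} (hp : p ∈ H10 Ω) {ψ : E d → ℝ}
    (hψ : ContDiff ℝ ∞ ψ) (hc : HasCompactSupport ψ) (e : E d) :
    ∫ x in Ω, p.1 x * fderiv ℝ ψ x e = -∫ x in Ω, inner ℝ (p.2 x) e * ψ x := by
  have c2 : Continuous (fun x => fderiv ℝ ψ x e) :=
    (hψ.continuous_fderiv (by simp)).clm_apply continuous_const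
  have s2 : HasCompactSupport (fun x => fderiv ℝ ψ x e) :=
    (hc.fderiv ℝ).comp_left (g := fun L : E d →L[ℝ] ℝ => L e) rfl
  have m1 : MemLp (fun x => fderiv ℝ ψ x e) 2 (volume.restrict Ω) :=
    c2.memLp_of_hasCompactSupport s2
  have m2 : MemLp (fun x => ψ x • e) 2 (volume.restrict Ω) :=
    (hψ.continuous.smul continuous_const).memLp_of_hasCompactSupport hc.smul_right
  -- The defect of the identity is a continuous functional of the pair, so its kernel is closed and
  -- only the generators need checking. These vanish outside Ω, so ψ need not: the vanishing trace
  -- is encoded here.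
  let Λ : L2 Ω ℝ × L2 Ω (E d) →L[ℝ] ℝ :=
    (innerSL ℝ m1.toLp).comp (ContinuousLinearMap.fst ℝ _ _) +
    (innerSL ℝ m2.toLp).comp (ContinuousLinearMap.snd ℝ _ _)
  have hΛ : ∀ q, Λ q = (∫ x in Ω, q.1 x * fderiv ℝ ψ x e) +
      ∫ x in Ω, inner ℝ (q.2 x) e * ψ x := by
    intro q
    simp only [Λ, add_apply, ContinuousLinearMap.comp_apply,
      ContinuousLinearMap.coe_fst', ContinuousLinearMap.coe_snd', innerSL_apply_apply, L2.inner_def]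
    congr 1
    · refine integral_congr_ae ?_
      filter_upwards [m1.coeFn_toLp] with x hx
      rw [hx]
      simp
    · refine integral_congr_ae ?_
      filter_upwards [m2.coeFn_toLp] with x hx
      rw [hx, real_inner_smul_left, real_inner_comm, mul_comm]
  have hle : H10 Ω ≤ Λ.ker := by
    refine Submodule.topologicalClosure_minimal _ (Submodule.span_le.2 ?_) Λ.isClosed_ker
    rintro q ⟨φ, hφ, h1, h2⟩
    change Λ q = 0
    rw [hΛ]
    have e1 : ∫ x in Ω, q.1 x * fderiv ℝ ψ x e = ∫ x, φ x * fderiv ℝ ψ x e := by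
      rw [← setIntegral_eq_integral_of_forall_compl_eq_zero (s := Ω) (f := fun x => φ x * fderiv ℝ ψ x e)]
      · refine integral_congr_ae ?_
        filter_upwards [h1] with x hx
        rw [hx]
      · intro x hx
        rw [hφ.eq_zero hx, zero_mul]
    have e2 : ∫ x in Ω, inner ℝ (q.2 x) e * ψ x = ∫ x, fderiv ℝ φ x e * ψ x := by
      rw [← setIntegral_eq_integral_of_forall_compl_eq_zero (s := Ω) (f := fun x => fderiv ℝ φ x e * ψ x)]
      · refine integral_congr_ae ?_
        filter_upwards [h2] with x hx
        rw [hx, inner_gradient]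
      · intro x hx
        rw [hφ.fderiv_eq_zero hx]
        simp
    rw [e1, e2, integral_mul_fderiv_of_compact hφ.1 hψ hc]
    ring
  have : Λ p = 0 := hle hp
  rw [hΛ] at this
  linarith

/-- The Gagliardo–Nirenberg–Sobolev inequality from W^{1,p} to L^d stands between two Hölder
inequalities: from L^d to L² on K, which yields the power of the volume of K, and from L² to L^p on
Ω. -/
lemma eLpNorm_test_le (hd : d = 2 ∨ d = 3) (hΩb : Bornology.IsBounded Ω) :
    ∃ C : ℝ, 0 < C ∧ ∀ K : Set (E d), ∀ φ, IsTestFunction Ω φ →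
      eLpNorm φ 2 (volume.restrict K) ≤
        ENNReal.ofReal C * volume K ^ ((1 : ℝ) / 2 - 1 / d) *
          eLpNorm (gradient φ) 2 (volume.restrict Ω) := by
  have hd2 : (2 : ℝ) ≤ d := by rcases hd with rfl | rfl <;> norm_num
  have hd3 : (d : ℝ) ≤ 3 := by rcases hd with rfl | rfl <;> norm_num
  -- The Sobolev conjugate of p = d/2 is d, since 1/p - 1/d = 1/d. Moreover 1 ≤ p ≤ 2 for d = 2 and
  -- d = 3, so both dimensions are treated alike.
  set p : NNReal := (d : NNReal) / 2 with hp
  have hpr : (p : ℝ) = d / 2 := by simp [hp]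
  have hp1 : 1 ≤ p := by
    rw [← NNReal.coe_le_coe, hpr]; norm_num; linarith
  have hp2 : p < Module.finrank ℝ (E d) := by
    rw [finrank_euclideanSpace_fin, ← NNReal.coe_lt_coe, hpr]
    push_cast
    linarith
  set c₀ := eLpNormLESNormFDerivOfLeConst ℝ (volume : Measure (E d)) Ω p (d : NNReal)
  have hvol : volume Ω ≠ ⊤ := hΩb.measure_lt_top.ne
  set c₁ := volume Ω ^ (1 / (p : ENNReal).toReal - 1 / (2 : ENNReal).toReal)
  have hc₁ : c₁ ≠ ⊤ := by
    refine ENNReal.rpow_ne_top_of_nonneg ?_ hvol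
    rw [ENNReal.coe_toReal, hpr, sub_nonneg, ENNReal.toReal_ofNat]
    refine one_div_le_one_div_of_le (by linarith) (by linarith)
  refine ⟨(c₀ * c₁).toReal + 1, by positivity, fun K φ hφ => ?_⟩
  have hC : c₀ * c₁ ≤ ENNReal.ofReal ((c₀ * c₁).toReal + 1) := by
    rw [ENNReal.ofReal_add ENNReal.toReal_nonneg zero_le_one,
      ENNReal.ofReal_toReal (ENNReal.mul_ne_top ENNReal.coe_ne_top hc₁)]
    exact le_self_add
  have hcφ : Continuous φ := hφ.1.continuous
  have h1 : eLpNorm φ 2 (volume.restrict K) ≤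
      eLpNorm φ d (volume.restrict K) * volume K ^ ((1 : ℝ) / 2 - 1 / d) := by
    have := eLpNorm_le_eLpNorm_mul_rpow_measure_univ (μ := volume.restrict K) (f := φ)
      (p := 2) (q := (d : ENNReal)) (by exact_mod_cast hd2) hcφ.aestronglyMeasurable
    simpa using this
  have h2 : eLpNorm φ d (volume.restrict K) ≤ c₀ * eLpNorm (fderiv ℝ φ) p volume := by
    refine (eLpNorm_mono_measure _ Measure.restrict_le_self).trans ?_
    have := eLpNorm_le_eLpNorm_fderiv_of_le (F := ℝ) (volume : Measure (E d)) (u := φ) (s := Ω)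
      (hφ.1.of_le (by simp)) ((subset_tsupport φ).trans hφ.2.2) (p := p) (q := (d : NNReal)) hp1 hp2
      ?_ hΩb
    · simpa using this
    · rw [finrank_euclideanSpace_fin, NNReal.coe_inv, hpr]
      push_cast
      rw [inv_div]
      apply le_of_eq
      field_simp
      norm_num
  have h3 : eLpNorm (fderiv ℝ φ) p volume ≤ eLpNorm (gradient φ) 2 (volume.restrict Ω) * c₁ := by
    have hs : Function.support (fderiv ℝ φ) ⊆ Ω := (support_fderiv_subset ℝ).trans hφ.2.2
    rw [← eLpNorm_restrict_eq_of_support_subset (f := fderiv ℝ φ) hs]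
    have := eLpNorm_le_eLpNorm_mul_rpow_measure_univ (μ := volume.restrict Ω) (f := fderiv ℝ φ)
      (p := p) (q := 2) ?_ (hφ.1.continuous_fderiv (by simp)).aestronglyMeasurable
    · rw [Measure.restrict_apply_univ] at this
      refine this.trans (mul_le_mul_left (le_of_eq ?_) _)
      refine eLpNorm_congr_norm_ae (Eventually.of_forall fun x => ?_)
      rw [norm_gradient]
    · have : p ≤ 2 := by
        rw [← NNReal.coe_le_coe, hpr]; push_cast; linarith
      exact_mod_cast this
  calc _ ≤ (c₀ * (eLpNorm (gradient φ) 2 (volume.restrict Ω) * c₁)) *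
        volume K ^ ((1 : ℝ) / 2 - 1 / d) := h1.trans (by gcongr; exact h2.trans (by gcongr))
    _ = (c₀ * c₁) * volume K ^ ((1 : ℝ) / 2 - 1 / d) *
        eLpNorm (gradient φ) 2 (volume.restrict Ω) := by ring
    _ ≤ _ := by gcongr

/-- The generators already form a subspace, so a non-linear condition such as a norm inequality may
be checked on single test functions. -/
lemma exists_isTestFunction_of_mem_span {p : L2 Ω ℝ × L2 Ω (E d)}
    (hp : p ∈ Submodule.span ℝ {p : L2 Ω ℝ × L2 Ω (E d) | ∃ φ : E d → ℝ, IsTestFunction Ω φ ∧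
      p.1 =ᵐ[volume.restrict Ω] φ ∧ p.2 =ᵐ[volume.restrict Ω] gradient φ}) :
    ∃ φ : E d → ℝ, IsTestFunction Ω φ ∧
      p.1 =ᵐ[volume.restrict Ω] φ ∧ p.2 =ᵐ[volume.restrict Ω] gradient φ := by
  induction hp using Submodule.span_induction with
  | mem x h => exact h
  | zero =>
    refine ⟨0, ⟨contDiff_const, HasCompactSupport.zero, by simp⟩, Lp.coeFn_zero _ _ _, ?_⟩
    refine (Lp.coeFn_zero _ _ _).trans (Eventually.of_forall fun x => ?_)
    simp [gradient]
  | add x y _ _ hx hy =>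
    obtain ⟨φ, h, h1, h2⟩ := hx
    obtain ⟨ψ, k, k1, k2⟩ := hy
    refine ⟨φ + ψ, ⟨h.1.add k.1, h.2.1.add k.2.1,
      (tsupport_add _ _).trans (union_subset h.2.2 k.2.2)⟩,
      (Lp.coeFn_add _ _).trans (h1.add k1), (Lp.coeFn_add _ _).trans ?_⟩
    filter_upwards [h2, k2] with a ha ka
    rw [Pi.add_apply, ha, ka, gradient, gradient, gradient,
      fderiv_add (h.1.differentiable (by simp)).differentiableAt
        (k.1.differentiable (by simp)).differentiableAt, map_add]
  | smul c x _ hx =>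
    obtain ⟨φ, h, h1, h2⟩ := hx
    refine ⟨c • φ, ⟨h.1.const_smul c, h.2.1.smul_left (f := fun _ => c),
      (tsupport_smul_subset_right (fun _ => c) φ).trans h.2.2⟩,
      (Lp.coeFn_smul _ _).trans (h1.const_smul c), (Lp.coeFn_smul _ _).trans ?_⟩
    filter_upwards [h2] with a ha
    rw [Pi.smul_apply, ha, gradient, gradient,
      fderiv_const_smul (h.1.differentiable (by simp)).differentiableAt]
    simp

/-- The Sobolev inequality on `H¹₀(Ω)`, localized to a set of finite measure. -/
theorem H10_sobolev (hd : d = 2 ∨ d = 3) (hΩb : Bornology.IsBounded Ω) :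
    ∃ C : ℝ, 0 < C ∧ ∀ K : Set (E d), MeasurableSet K → volume K ≠ ⊤ → ∀ p ∈ H10 Ω,
      ‖LpToLpRestrictCLM (E d) ℝ ℝ (volume.restrict Ω) 2 K p.1‖ ≤
        C * (volume K).toReal ^ ((1 : ℝ) / 2 - 1 / d) * ‖p.2‖ := by
  obtain ⟨C, hC, h⟩ := eLpNorm_test_le (Ω := Ω) hd hΩb
  have hd2 : (2 : ℝ) ≤ d := by rcases hd with rfl | rfl <;> norm_num
  have hexp : 0 ≤ (1 : ℝ) / 2 - 1 / d :=
    sub_nonneg.2 (one_div_le_one_div_of_le (by norm_num) hd2)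
  refine ⟨C, hC, fun K hK hKt p hp => ?_⟩
  set Z : Set (L2 Ω ℝ × L2 Ω (E d)) :=
    {p | ‖LpToLpRestrictCLM (E d) ℝ ℝ (volume.restrict Ω) 2 K p.1‖ ≤
        C * (volume K).toReal ^ ((1 : ℝ) / 2 - 1 / d) * ‖p.2‖} with hZ
  have hclosed : IsClosed Z := by
    refine isClosed_le ?_ ?_
    · exact ((LpToLpRestrictCLM (E d) ℝ ℝ (volume.restrict Ω) 2 K).continuous.comp
        continuous_fst).norm
    · exact continuous_const.mul continuous_snd.norm
  refine closure_minimal (t := Z) ?_ hclosed hp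
  intro q hq
  obtain ⟨φ, hφ, h1, h2⟩ := exists_isTestFunction_of_mem_span hq
  have e1 : ‖LpToLpRestrictCLM (E d) ℝ ℝ (volume.restrict Ω) 2 K q.1‖ =
      (eLpNorm φ 2 ((volume.restrict Ω).restrict K)).toReal := by
    rw [Lp.norm_def]
    congr 1
    refine eLpNorm_congr_ae ((LpToLpRestrictCLM_coeFn ℝ K q.1).trans ?_)
    exact ae_restrict_of_ae h1
  have e2 : ‖q.2‖ = (eLpNorm (gradient φ) 2 (volume.restrict Ω)).toReal := by
    rw [Lp.norm_def]
    congr 1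
    exact eLpNorm_congr_ae h2
  rw [hZ, mem_ofPred_eq, e1, e2, ENNReal.toReal_rpow, ← ENNReal.toReal_ofReal hC.le, ← ENNReal.toReal_mul,
    ← ENNReal.toReal_mul]
  refine ENNReal.toReal_mono ?_ ?_
  · refine ENNReal.mul_ne_top (ENNReal.mul_ne_top ENNReal.ofReal_ne_top
      (ENNReal.rpow_ne_top_of_nonneg hexp hKt)) ?_
    rw [← eLpNorm_congr_ae h2]
    exact Lp.eLpNorm_ne_top _
  · refine le_trans (eLpNorm_mono_measure _ ?_) (h K φ hφ)
    exact Measure.restrict_mono subset_rfl Measure.restrict_le_self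

lemma norm_toLpRestrict_sq (K : Set (E d)) (v : L2 Ω ℝ) :
    ‖LpToLpRestrictCLM (E d) ℝ ℝ (volume.restrict Ω) 2 K v‖ ^ 2 =
      ∫ x in K, v x ^ 2 ∂(volume.restrict Ω) := by
  rw [← real_inner_self_eq_norm_sq, L2.inner_def]
  refine integral_congr_ae ?_
  filter_upwards [LpToLpRestrictCLM_coeFn ℝ K v] with x hx
  rw [hx]
  simp [sq]

/-- The Poincaré inequality. -/
theorem H10_poincare (hd : d = 2 ∨ d = 3) (hΩo : IsOpen Ω) (hΩb : Bornology.IsBounded Ω) :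
    ∃ C : ℝ, 0 < C ∧ ∀ p ∈ H10 Ω, ‖p.1‖ ≤ C * ‖p.2‖ := by
  obtain ⟨C, hC, h⟩ := H10_sobolev (Ω := Ω) hd hΩb
  refine ⟨C * (volume Ω).toReal ^ ((1 : ℝ) / 2 - 1 / d) + 1, by positivity, fun p hp => ?_⟩
  have h1 := h Ω hΩo.measurableSet hΩb.measure_lt_top.ne p hp
  have h2 : ‖LpToLpRestrictCLM (E d) ℝ ℝ (volume.restrict Ω) 2 Ω p.1‖ = ‖p.1‖ := by
    rw [← sq_eq_sq₀ (norm_nonneg _) (norm_nonneg _), norm_toLpRestrict_sq,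
      Measure.restrict_restrict hΩo.measurableSet, inter_self, ← real_inner_self_eq_norm_sq,
      L2.inner_def]
    simp [sq]
  rw [h2] at h1
  nlinarith [norm_nonneg p.2]

lemma ip_grad_self (v : VelocitySpace Ω) :
    ip Ω (grad v) (grad v) = ∑ i, ‖(v i).1.2‖ ^ 2 := by
  have : ∀ i, ‖(v i).1.2‖ ^ 2 = ∫ x in Ω, ∑ j, grad v x i j * grad v x i j := by
    intro i
    rw [← real_inner_self_eq_norm_sq, L2.inner_def]
    congr 1
  rw [Finset.sum_congr rfl fun i _ => this i, ip, integral_finsetSum]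
  intro i _
  have := (Lp.memLp (v i).1.2).integrable_norm_pow (p := 2) (by norm_num)
  refine this.congr (Eventually.of_forall fun x => ?_)
  simp only [EuclideanSpace.norm_sq_eq, grad]
  simp [sq]

lemma l2norm_nonneg (A : TensorField d) : 0 ≤ l2norm Ω A := Real.sqrt_nonneg _

lemma norm_le_l2norm_grad (v : VelocitySpace Ω) (i : Fin d) :
    ‖(v i).1.2‖ ≤ l2norm Ω (grad v) := by
  rw [l2norm, ip_grad_self]
  refine Real.le_sqrt_of_sq_le ?_
  exact Finset.single_le_sum (f := fun i => ‖(v i).1.2‖ ^ 2) (fun i _ => sq_nonneg _)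
    (Finset.mem_univ i)

/-- The infimum that defines the dual norm is attained: the set of admissible constants is closed,
bounded below, and nonempty by the Poincaré inequality. -/
theorem abs_apply_le_dualNorm (hd : d = 2 ∨ d = 3) (hΩo : IsOpen Ω)
    (hΩb : Bornology.IsBounded Ω) (f : VelocitySpace Ω →L[ℝ] ℝ) :
    0 ≤ dualNorm f ∧ ∀ v, |f v| ≤ dualNorm f * l2norm Ω (grad v) := by
  obtain ⟨C, hC, h⟩ := H10_poincare (Ω := Ω) hd hΩo hΩb
  set Z := {M : ℝ | 0 ≤ M ∧ ∀ v, |f v| ≤ M * l2norm Ω (grad v)} with hZ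
  have hne : Z.Nonempty := by
    -- The norm on the velocity space is a maximum of ‖v_i‖ and ‖∇v_i‖, and C + 1 bounds both
    -- relative to ‖∇v‖.
    refine ⟨‖f‖ * (C + 1), by positivity, fun v => ?_⟩
    rw [← Real.norm_eq_abs, mul_assoc]
    refine (f.le_opNorm v).trans ?_
    gcongr
    refine (pi_norm_le_iff_of_nonneg (mul_nonneg (by positivity) (l2norm_nonneg _))).2 fun i => ?_
    have h1 := h _ (v i).2
    have h2 := norm_le_l2norm_grad v i
    have h3 := norm_nonneg (v i).1.2
    change max ‖(v i).1.1‖ ‖(v i).1.2‖ ≤ _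
    rw [max_le_iff]
    constructor <;> nlinarith
  have hbdd : BddBelow Z := ⟨0, fun M hM => hM.1⟩
  have hcl : IsClosed Z := by
    have : Z = Ici 0 ∩ ⋂ v, {M : ℝ | |f v| ≤ M * l2norm Ω (grad v)} := by
      ext M; simp [hZ]
    rw [this]
    refine isClosed_Ici.inter (isClosed_iInter fun v => isClosed_le continuous_const ?_)
    exact continuous_id.mul continuous_const
  exact hcl.csInf_mem hne hbdd

end Sobolev

/-! ### Geometry of simplicial meshes. -/

section Mesh

variable {d : ℕ} {Ω : Set (E d)} {T : Geometry.SimplicialComplex ℝ (E d)} {K K' : Set (E d)}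

lemma IsMesh.finite_elements (hT : IsMesh Ω T) : (elements T).Finite := by
  refine (hT.1.image fun s : Finset (E d) => convexHull ℝ (s : Set (E d))).subset ?_
  rintro K ⟨s, hs, -, rfl⟩
  exact ⟨s, hs, rfl⟩

lemma isCompact_of_mem_elements (hK : K ∈ elements T) : IsCompact K := by
  obtain ⟨s, -, -, rfl⟩ := hK
  exact s.finite_toSet.isCompact_convexHull ℝ

lemma convex_of_mem_elements (hK : K ∈ elements T) : Convex ℝ K := by
  obtain ⟨s, -, -, rfl⟩ := hK
  exact convex_convexHull ℝ _

lemma nonempty_interior_of_mem_elements (hK : K ∈ elements T) : (interior K).Nonempty := by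
  obtain ⟨s, hs, hc, rfl⟩ := hK
  rw [interior_convexHull_nonempty_iff_affineSpan_eq_top]
  have h := (T.indep hs).affineSpan_eq_top_iff_card_eq_finrank_add_one (P := E d)
  rw [Subtype.range_coe] at h
  rw [h]
  simpa using hc

lemma closure_interior_of_mem_elements (hK : K ∈ elements T) : closure (interior K) = K := by
  rw [(convex_of_mem_elements hK).closure_interior_eq_closure_of_nonempty_interior
    (nonempty_interior_of_mem_elements hK), (isCompact_of_mem_elements hK).isClosed.closure_eq]

/-- By conformity the elements meet in the convex hull of their common vertices. Distinct elements
share at most d of them, too few to span ℝ^d affinely, so the intersection has empty interior. -/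
lemma disjoint_interior_elements (hK : K ∈ elements T) (hK' : K' ∈ elements T) (hne : K ≠ K') :
    Disjoint (interior K) (interior K') := by
  obtain ⟨s, hs, hc, rfl⟩ := hK
  obtain ⟨t, ht, hc', rfl⟩ := hK'
  have hst : s ≠ t := fun h => hne (by rw [h])
  rw [Set.disjoint_iff_inter_eq_empty, ← interior_inter, ← Set.not_nonempty_iff_eq_empty]
  intro hn
  classical
  have h1 : (interior (convexHull ℝ ((s ∩ t : Finset (E d)) : Set (E d)))).Nonempty := by
    refine hn.mono (interior_mono ?_)
    rw [Finset.coe_inter]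
    exact T.inter_subset_convexHull hs ht
  rw [interior_convexHull_nonempty_iff_affineSpan_eq_top] at h1
  have hlt : (s ∩ t).card < d + 1 := by
    rw [← hc]
    refine Finset.card_lt_card (Finset.ssubset_iff_subset_ne.2 ⟨Finset.inter_subset_left, ?_⟩)
    intro h
    have : s ⊆ t := Finset.inter_eq_left.1 h
    exact hst (Finset.eq_of_subset_of_card_le this (by rw [hc, hc']))
  have hsub : (s ∩ t : Finset (E d)).Nonempty := by
    rw [Finset.nonempty_iff_ne_empty]
    intro h
    rw [h, Finset.coe_empty, AffineSubspace.span_empty] at h1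
    exact AffineSubspace.bot_ne_top ℝ (E d) (E d) h1
  have hind : AffineIndependent ℝ ((↑) : (s ∩ t : Finset (E d)) → E d) :=
    (T.indep hs).mono (t := (s : Set (E d))) (s := ((s ∩ t : Finset (E d)) : Set (E d)))
      (by simp)
  have h := hind.affineSpan_eq_top_iff_card_eq_finrank_add_one (P := E d)
  have hr : Set.range ((↑) : (s ∩ t : Finset (E d)) → E d) = ((s ∩ t : Finset (E d)) : Set (E d)) := by
    ext x; simp
  rw [hr] at h
  rw [h] at h1
  simp only [Fintype.card_coe, finrank_euclideanSpace_fin] at h1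
  omega

/-- The union of the open elements. -/
def openUnion (T : Geometry.SimplicialComplex ℝ (E d)) : Set (E d) :=
  ⋃ K ∈ elements T, interior K

lemma mem_openUnion {x : E d} : x ∈ openUnion T ↔ ∃ K ∈ elements T, x ∈ interior K := by
  simp [openUnion]

lemma isOpen_openUnion : IsOpen (openUnion T) :=
  isOpen_biUnion fun _ _ => isOpen_interior

lemma interior_subset_openUnion (hK : K ∈ elements T) : interior K ⊆ openUnion T :=
  subset_biUnion_of_mem (u := fun K => interior K) hK

lemma IsMesh.openUnion_subset (hT : IsMesh Ω T) : openUnion T ⊆ Ω := by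
  rw [hT.2]
  exact iUnion₂_subset fun K hK => interior_mono (subset_sUnion_of_mem hK)

/-- What is missing lies on the frontiers of finitely many convex sets, and these are null sets. -/
lemma IsMesh.openUnion_ae_eq (hT : IsMesh Ω T) : openUnion T =ᵐ[volume] Ω := by
  refine hT.openUnion_subset.eventuallyLE.antisymm ?_
  rw [ae_le_set]
  have hsub : Ω \ openUnion T ⊆ ⋃ K ∈ elements T, frontier K := by
    rintro x ⟨hx, hx'⟩
    rw [hT.2] at hx
    obtain ⟨K, hK, hxK⟩ := interior_subset hx
    refine mem_biUnion hK ⟨subset_closure hxK, fun h => hx' (interior_subset_openUnion hK h)⟩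
  refine measure_mono_null hsub ((measure_biUnion_null_iff hT.finite_elements.countable).2 ?_)
  exact fun K hK => (convex_of_mem_elements hK).addHaar_frontier volume

lemma IsMesh.restrict_eq (hT : IsMesh Ω T) :
    volume.restrict Ω = volume.restrict (openUnion T) :=
  (Measure.restrict_congr_set hT.openUnion_ae_eq).symm

lemma IsMesh.ae_of_elements (hT : IsMesh Ω T) {p : E d → Prop}
    (h : ∀ K ∈ elements T, ∀ᵐ x, x ∈ interior K → p x) : ∀ᵐ x ∂(volume.restrict Ω), p x := by
  rw [hT.restrict_eq, ae_restrict_iff' isOpen_openUnion.measurableSet]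
  filter_upwards [(ae_ball_iff hT.finite_elements.countable).2 h] with x hx hxU
  obtain ⟨K, hK, hxK⟩ := mem_openUnion.1 hxU
  exact hx K hK hxK

lemma IsMesh.ae_mem (hT : IsMesh Ω T) : ∀ᵐ x ∂(volume.restrict Ω), x ∈ openUnion T := by
  rw [hT.restrict_eq]
  exact ae_restrict_mem isOpen_openUnion.measurableSet

lemma IsMesh.setIntegral_eq_sum (hT : IsMesh Ω T) {f : E d → ℝ}
    (hf : IntegrableOn f Ω) :
    ∫ x in Ω, f x = ∑ K ∈ hT.finite_elements.toFinset, ∫ x in interior K, f x := by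
  have : openUnion T = ⋃ K ∈ hT.finite_elements.toFinset, interior K := by simp [openUnion]
  rw [hT.restrict_eq, this]
  refine integral_biUnion_finset _ (fun K _ => isOpen_interior.measurableSet) ?_ ?_
  · intro K hK K' hK' hne
    exact disjoint_interior_elements (by simpa using hK) (by simpa using hK') hne
  · intro K hK
    refine hf.mono_set ((interior_subset_openUnion ?_).trans hT.openUnion_subset)
    simpa using hK

lemma IsMesh.diam_le (hT : IsMesh Ω T) (hK : K ∈ elements T) : Metric.diam K ≤ meshSize T :=
  le_csSup (hT.finite_elements.image _).bddAbove (mem_image_of_mem _ hK)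

lemma IsMesh.meshSize_pos (hT : IsMesh Ω T) (hd : 0 < d) (hK : K ∈ elements T) :
    0 < meshSize T := by
  refine lt_of_lt_of_le ?_ (hT.diam_le hK)
  refine Metric.diam_pos ?_ (isCompact_of_mem_elements hK).isBounded
  by_contra h
  rw [Set.not_nontrivial_iff] at h
  obtain ⟨x, hx⟩ := nonempty_interior_of_mem_elements hK
  have : Nontrivial (E d) := by
    have : Nonempty (Fin d) := ⟨⟨0, hd⟩⟩
    infer_instance
  have h2 := (Set.Subsingleton.anti h (interior_subset (s := K))).eq_singleton_of_mem hx
  exact not_isOpen_singleton x (h2 ▸ isOpen_interior)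

lemma IsMesh.meshSize_le (hT : IsMesh Ω T) (hΩb : Bornology.IsBounded Ω) :
    meshSize T ≤ Metric.diam Ω := by
  refine Real.sSup_le ?_ Metric.diam_nonneg
  rintro _ ⟨K, hK, rfl⟩
  rw [← closure_interior_of_mem_elements hK, Metric.diam_closure]
  exact Metric.diam_mono ((interior_subset_openUnion hK).trans hT.openUnion_subset) hΩb

lemma IsMesh.subset_closedBall (hT : IsMesh Ω T) (hK : K ∈ elements T) {c : E d} (hc : c ∈ K) :
    K ⊆ Metric.closedBall c (meshSize T) := fun _ hx =>
  (Metric.dist_le_diam_of_mem (isCompact_of_mem_elements hK).isBounded hx hc).trans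
    (hT.diam_le hK)

end Mesh

/-! ### Inverse estimates for polynomials on balls. -/

section InverseEstimate

variable {d : ℕ}

/-- The function on `ℝ^d` given by a polynomial. -/
def polyFun (p : MvPolynomial (Fin d) ℝ) (x : E d) : ℝ := MvPolynomial.eval (fun i => x i) p

lemma polyFun_add (p q : MvPolynomial (Fin d) ℝ) : polyFun (p + q) = polyFun p + polyFun q := by
  ext x; simp [polyFun]

lemma polyFun_smul (a : ℝ) (p : MvPolynomial (Fin d) ℝ) : polyFun (a • p) = a • polyFun p := by
  ext x; simp [polyFun, MvPolynomial.smul_eval]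

lemma analyticOnNhd_polyFun (p : MvPolynomial (Fin d) ℝ) : AnalyticOnNhd ℝ (polyFun p) univ := by
  have h := AnalyticOnNhd.aeval_mvPolynomial (𝕜 := ℝ) (s := (univ : Set (E d)))
    (f := fun x i => x i) (fun i => ((EuclideanSpace.proj (𝕜 := ℝ) i :
      E d →L[ℝ] ℝ).analyticOnNhd univ)) p
  simp only [MvPolynomial.aeval_eq_eval] at h
  exact h

lemma contDiff_polyFun (p : MvPolynomial (Fin d) ℝ) : ContDiff ℝ ∞ (polyFun p) :=
  (analyticOnNhd_polyFun p).contDiff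

lemma continuous_polyFun (p : MvPolynomial (Fin d) ℝ) : Continuous (polyFun p) :=
  (contDiff_polyFun p).continuous

lemma differentiable_polyFun (p : MvPolynomial (Fin d) ℝ) : Differentiable ℝ (polyFun p) :=
  (contDiff_polyFun p).differentiable (by simp)

lemma continuous_fderiv_polyFun (p : MvPolynomial (Fin d) ℝ) :
    Continuous (fderiv ℝ (polyFun p)) :=
  (contDiff_polyFun p).continuous_fderiv (by simp)

lemma polyFun_eq_zero {p : MvPolynomial (Fin d) ℝ} {U : Set (E d)} (hU : IsOpen U)
    (hne : U.Nonempty) (h : EqOn (polyFun p) 0 U) : p = 0 := by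
  obtain ⟨z, hz⟩ := hne
  have h1 : polyFun p = 0 := (analyticOnNhd_polyFun p).eq_of_eventuallyEq
    (analyticOnNhd_const (v := (0 : ℝ))) (z₀ := z) (by
      filter_upwards [hU.mem_nhds hz] with x hx using h hx)
  refine MvPolynomial.funext fun x => ?_
  have := congrFun h1 (WithLp.toLp 2 x)
  simpa [polyFun] using this

/-- Restriction of polynomials of bounded degree to the unit ball, as functions. -/
def polyRestrict (m : ℕ) : MvPolynomial.restrictTotalDegree (Fin d) ℝ m →ₗ[ℝ]
    C(Metric.closedBall (0 : E d) 1, ℝ) where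
  toFun p := ⟨fun x => polyFun p.1 x, (continuous_polyFun p.1).comp continuous_subtype_val⟩
  map_add' p q := by ext x; simp [polyFun_add]
  map_smul' a p := by ext x; simp [polyFun_smul]

/-- Restriction of the derivatives of polynomials of bounded degree to the unit ball. -/
def polyFderivRestrict (m : ℕ) : MvPolynomial.restrictTotalDegree (Fin d) ℝ m →ₗ[ℝ]
    C(Metric.closedBall (0 : E d) 1, E d →L[ℝ] ℝ) where
  toFun p := ⟨fun x => fderiv ℝ (polyFun p.1) x,
    (continuous_fderiv_polyFun p.1).comp continuous_subtype_val⟩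
  map_add' p q := by
    ext1 x
    simp only [Submodule.coe_add, polyFun_add, ContinuousMap.coe_mk, ContinuousMap.add_apply]
    exact fderiv_add (differentiable_polyFun _ _) (differentiable_polyFun _ _)
  map_smul' a p := by
    ext1 x
    simp only [Submodule.coe_smul, polyFun_smul, ContinuousMap.coe_mk, ContinuousMap.smul_apply,
      RingHom.id_apply]
    exact fderiv_const_smul (differentiable_polyFun _ _) _

lemma memLp_polyFun (p : MvPolynomial (Fin d) ℝ) (c : E d) (r : ℝ) :
    MemLp (polyFun p) 2 (volume.restrict (Metric.ball c r)) := by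
  rw [memLp_two_iff_integrable_sq (continuous_polyFun p).aestronglyMeasurable]
  exact (((continuous_polyFun p).pow 2).continuousOn.integrableOn_compact
    (isCompact_closedBall c r)).mono_set Metric.ball_subset_closedBall

/-- Restriction of polynomials of bounded degree to a ball, as elements of `L²`. -/
def polyToL2 (m : ℕ) (r : ℝ) : MvPolynomial.restrictTotalDegree (Fin d) ℝ m →ₗ[ℝ]
    Lp ℝ 2 (volume.restrict (Metric.ball (0 : E d) r)) where
  toFun p := (memLp_polyFun p.1 0 r).toLp
  map_add' p q := by
    rw [← MemLp.toLp_add]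
    exact MemLp.toLp_congr _ _ (by rw [Submodule.coe_add, polyFun_add])
  map_smul' a p := by
    rw [RingHom.id_apply, ← MemLp.toLp_const_smul]
    exact MemLp.toLp_congr _ _ (by rw [Submodule.coe_smul, polyFun_smul])

lemma polyToL2_injective (m : ℕ) {r : ℝ} (hr : 0 < r) :
    Function.Injective (polyToL2 (d := d) m r) := by
  rw [← LinearMap.ker_eq_bot, LinearMap.ker_eq_bot']
  intro p hp
  have h1 : polyFun p.1 =ᵐ[volume.restrict (Metric.ball (0 : E d) r)] 0 :=
    (memLp_polyFun p.1 0 r).coeFn_toLp.symm.trans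
      (by rw [show (memLp_polyFun p.1 0 r).toLp = 0 from hp]; exact Lp.coeFn_zero _ _ _)
  have h2 := Measure.eqOn_open_of_ae_eq h1 Metric.isOpen_ball
    (continuous_polyFun p.1).continuousOn continuousOn_const
  exact Subtype.ext (polyFun_eq_zero Metric.isOpen_ball ⟨0, Metric.mem_ball_self hr⟩ h2)

/-- Linear maps on a finite-dimensional space are bounded by any norm. -/
lemma exists_norm_le_of_injective {W F G : Type*} [AddCommGroup W] [Module ℝ W]
    [FiniteDimensional ℝ W] [NormedAddCommGroup F] [NormedSpace ℝ F] [NormedAddCommGroup G]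
    [NormedSpace ℝ G] (J : W →ₗ[ℝ] F) (hJ : Function.Injective J) (A : W →ₗ[ℝ] G) :
    ∃ C : ℝ, 0 ≤ C ∧ ∀ w, ‖A w‖ ≤ C * ‖J w‖ := by
  let e := LinearEquiv.ofInjective J hJ
  let B := LinearMap.toContinuousLinearMap (A ∘ₗ e.symm.toLinearMap)
  refine ⟨‖B‖, by positivity, fun w => ?_⟩
  have := B.le_opNorm (e w)
  simpa [B, e] using this

lemma norm_polyToL2_sq (m : ℕ) (r : ℝ) (p : MvPolynomial.restrictTotalDegree (Fin d) ℝ m) :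
    ‖polyToL2 m r p‖ ^ 2 = ∫ x in Metric.ball (0 : E d) r, polyFun p.1 x ^ 2 := by
  rw [← real_inner_self_eq_norm_sq, L2.inner_def]
  refine integral_congr_ae ?_
  filter_upwards [(memLp_polyFun p.1 0 r).coeFn_toLp] with x hx
  have hx' : polyToL2 m r p x = polyFun p.1 x := hx
  rw [hx']
  simp [sq]

/-- On the finite dimensional space of polynomials of degree at most m, the L² norm over a small
ball is a norm, by unique continuation. It therefore dominates the maximum over the unit ball of
values and derivatives. -/
lemma exists_reference_inverse_estimate (m : ℕ) {r : ℝ} (hr : 0 < r) :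
    ∃ C : ℝ, 0 ≤ C ∧ ∀ p : MvPolynomial (Fin d) ℝ, p.totalDegree ≤ m →
      ∀ y ∈ Metric.closedBall (0 : E d) 1,
        polyFun p y ^ 2 ≤ C * ∫ x in Metric.ball (0 : E d) r, polyFun p x ^ 2 ∧
        ‖fderiv ℝ (polyFun p) y‖ ^ 2 ≤ C * ∫ x in Metric.ball (0 : E d) r, polyFun p x ^ 2 := by
  obtain ⟨C₁, hC₁, h₁⟩ := exists_norm_le_of_injective (polyToL2 (d := d) m r)
    (polyToL2_injective m hr) (polyRestrict m)
  obtain ⟨C₂, hC₂, h₂⟩ := exists_norm_le_of_injective (polyToL2 (d := d) m r)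
    (polyToL2_injective m hr)
    (G := C(Metric.closedBall (0 : E d) 1, E d →L[ℝ] ℝ)) (polyFderivRestrict m)
  refine ⟨C₁ ^ 2 + C₂ ^ 2, by positivity, fun p hp y hy => ?_⟩
  let w : MvPolynomial.restrictTotalDegree (Fin d) ℝ m :=
    ⟨p, (MvPolynomial.mem_restrictTotalDegree _ _ _).2 hp⟩
  have e := norm_polyToL2_sq m r w
  have a₁ : |polyFun p y| ≤ C₁ * ‖polyToL2 m r w‖ :=
    ((polyRestrict m w).norm_coe_le_norm ⟨y, hy⟩).trans (h₁ w)
  have a₂ : ‖fderiv ℝ (polyFun p) y‖ ≤ C₂ * ‖polyToL2 m r w‖ :=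
    ((polyFderivRestrict m w).norm_coe_le_norm ⟨y, hy⟩).trans (h₂ w)
  have b₁ := pow_le_pow_left₀ (abs_nonneg _) a₁ 2
  have b₂ := pow_le_pow_left₀ (norm_nonneg _) a₂ 2
  rw [mul_pow, e] at b₁ b₂
  rw [sq_abs] at b₁
  have hI : 0 ≤ ∫ x in Metric.ball (0 : E d) r, polyFun p x ^ 2 :=
    integral_nonneg fun x => sq_nonneg _
  constructor
  · refine b₁.trans ?_
    gcongr
    nlinarith
  · refine b₂.trans ?_
    gcongr
    nlinarith

/-- Composition of a polynomial with a homothety. -/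
lemma exists_polyFun_comp (p : MvPolynomial (Fin d) ℝ) (c : E d) (h : ℝ) :
    ∃ q : MvPolynomial (Fin d) ℝ, q.totalDegree ≤ p.totalDegree ∧
      ∀ y, polyFun q y = polyFun p (c + h • y) := by
  let g : Fin d → MvPolynomial (Fin d) ℝ := fun i =>
    MvPolynomial.C (c i) + MvPolynomial.C h * MvPolynomial.X i
  have hg : ∀ i, (g i).totalDegree ≤ 1 := by
    intro i
    refine (MvPolynomial.totalDegree_add _ _).trans (max_le (by simp) ?_)
    refine (MvPolynomial.totalDegree_mul _ _).trans ?_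
    simp
  refine ⟨MvPolynomial.bind₁ g p, ?_, fun y => ?_⟩
  · rw [MvPolynomial.bind₁, MvPolynomial.aeval_def, MvPolynomial.eval₂_eq]
    refine (MvPolynomial.totalDegree_finsetSum _ _).trans (Finset.sup_le fun s hs => ?_)
    refine (MvPolynomial.totalDegree_mul _ _).trans ?_
    rw [MvPolynomial.algebraMap_eq, MvPolynomial.totalDegree_C, zero_add]
    refine (MvPolynomial.totalDegree_finsetProd _ _).trans ?_
    refine le_trans (Finset.sum_le_sum fun i _ => ?_) (MvPolynomial.le_totalDegree hs)
    refine (MvPolynomial.totalDegree_pow _ _).trans ?_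
    calc s i * (g i).totalDegree ≤ s i * 1 := Nat.mul_le_mul_left _ (hg i)
      _ = s i := mul_one _
  · have := MvPolynomial.aeval_bind₁ (fun i => y i) g p
    simp only [MvPolynomial.aeval_eq_eval] at this
    rw [polyFun, polyFun]
    refine Eq.trans this ?_
    congr 2
    ext i
    simp [g]

lemma setIntegral_ball_comp_homothety (f : E d → ℝ) (c : E d) {h : ℝ} (hh : 0 < h) (r : ℝ) :
    ∫ y in Metric.ball (0 : E d) r, f (c + h • y) =
      (h ^ d)⁻¹ * ∫ x in Metric.ball c (h * r), f x := by
  have h1 := Measure.setIntegral_comp_smul_of_pos (volume : Measure (E d)) (fun z => f (c + z))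
    (Metric.ball (0 : E d) r) hh
  rw [h1, finrank_euclideanSpace_fin, smul_eq_mul, smul_ball hh.ne', smul_zero, Real.norm_eq_abs,
    abs_of_pos hh]
  congr 1
  have h2 := (measurePreserving_add_left (volume : Measure (E d)) c).setIntegral_preimage_emb
    (measurableEmbedding_addLeft c) f (Metric.ball c (h * r))
  have h3 : (fun z : E d => c + z) ⁻¹' Metric.ball c (h * r) = Metric.ball 0 (h * r) := by
    ext z; simp
  rw [← h2, h3]

/-- The inverse estimate for polynomials of bounded degree on comparable balls. -/
theorem exists_inverse_estimate (d m : ℕ) {ρ : ℝ} (hρ : 0 < ρ) :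
    ∃ C : ℝ, 0 ≤ C ∧ ∀ (h : ℝ), 0 < h → ∀ (c : E d) (p : MvPolynomial (Fin d) ℝ),
      p.totalDegree ≤ m → ∀ x ∈ Metric.closedBall c h,
        h ^ d * polyFun p x ^ 2 ≤ C * ∫ y in Metric.ball c (ρ * h), polyFun p y ^ 2 ∧
        h ^ (d + 2) * ‖fderiv ℝ (polyFun p) x‖ ^ 2 ≤
          C * ∫ y in Metric.ball c (ρ * h), polyFun p y ^ 2 := by
  obtain ⟨C, hC, H⟩ := exists_reference_inverse_estimate (d := d) m hρ
  refine ⟨C, hC, fun h hh c p hp x hx => ?_⟩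
  -- The homothety of centre c and ratio h carries the balls of radii ρ and 1 to those of radii ρ h
  -- and h without raising the degree. The integral scales by h^d and a derivative by h.
  obtain ⟨q, hq, hqp⟩ := exists_polyFun_comp p c h
  set y : E d := h⁻¹ • (x - c) with hy
  have hxy : c + h • y = x := by rw [hy, smul_inv_smul₀ hh.ne']; abel
  have hy1 : y ∈ Metric.closedBall (0 : E d) 1 := by
    rw [mem_closedBall_zero_iff, hy, norm_smul, norm_inv, Real.norm_eq_abs, abs_of_pos hh,
      inv_mul_le_iff₀ hh, mul_one, ← dist_eq_norm]
    exact hx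
  obtain ⟨a₁, a₂⟩ := H q (hq.trans hp) y hy1
  have hder : fderiv ℝ (polyFun q) y = h • fderiv ℝ (polyFun p) x := by
    have e : polyFun q = polyFun p ∘ fun y => c + h • y := funext hqp
    have h1 : HasFDerivAt (fun y : E d => c + h • y) (h • ContinuousLinearMap.id ℝ (E d)) y :=
      ((hasFDerivAt_id y).const_smul h).const_add c
    have h2 : HasFDerivAt (polyFun p) (fderiv ℝ (polyFun p) x) (c + h • y) := by
      rw [hxy]; exact (differentiable_polyFun p x).hasFDerivAt
    rw [e, (h2.comp y h1).fderiv]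
    ext v; simp
  have hI : ∫ y in Metric.ball (0 : E d) ρ, polyFun q y ^ 2 =
      (h ^ d)⁻¹ * ∫ x in Metric.ball c (ρ * h), polyFun p x ^ 2 := by
    rw [mul_comm ρ, ← setIntegral_ball_comp_homothety (fun x => polyFun p x ^ 2) c hh]
    simp_rw [hqp]
  rw [hI] at a₁ a₂
  rw [hqp, hxy] at a₁
  rw [hder, norm_smul, Real.norm_eq_abs, abs_of_pos hh] at a₂
  have hd' : 0 < h ^ d := by positivity
  constructor
  · have := mul_le_mul_of_nonneg_left a₁ hd'.le
    refine this.trans (le_of_eq ?_)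
    field_simp
  · have := mul_le_mul_of_nonneg_left a₂ hd'.le
    refine le_trans (le_of_eq ?_) (this.trans (le_of_eq ?_))
    · ring
    · field_simp

end InverseEstimate

/-! ### Mollification, and Lipschitz continuity from a bounded weak gradient. -/

section Mollifier

variable {d : ℕ}

/-- The bump function that generates the standard mollifier. -/
def stdBump (d : ℕ) : ContDiffBump (0 : E d) where
  rIn := 1 / 2
  rOut := 1
  rIn_pos := by norm_num
  rIn_lt_rOut := by norm_num

/-- The standard mollifier: smooth, even, supported in the unit ball and of integral one. -/
def mollifier (d : ℕ) : E d → ℝ := (stdBump d).normed volume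

lemma contDiff_mollifier : ContDiff ℝ ∞ (mollifier d) := (stdBump d).contDiff_normed

lemma continuous_mollifier : Continuous (mollifier d) := contDiff_mollifier.continuous

lemma differentiable_mollifier : Differentiable ℝ (mollifier d) :=
  contDiff_mollifier.differentiable (by simp)

lemma continuous_fderiv_mollifier : Continuous (fderiv ℝ (mollifier d)) :=
  contDiff_mollifier.continuous_fderiv (by simp)

lemma hasCompactSupport_mollifier : HasCompactSupport (mollifier d) :=
  (stdBump d).hasCompactSupport_normed

lemma mollifier_nonneg (x : E d) : 0 ≤ mollifier d x := (stdBump d).nonneg_normed x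

lemma mollifier_neg (x : E d) : mollifier d (-x) = mollifier d x := (stdBump d).normed_neg x

lemma integral_mollifier : ∫ x, mollifier d x = 1 := (stdBump d).integral_normed

lemma integrable_mollifier : Integrable (mollifier d) := (stdBump d).integrable_normed

lemma tsupport_mollifier : tsupport (mollifier d) = Metric.closedBall 0 1 :=
  (stdBump d).tsupport_normed_eq

lemma mollifier_eq_zero {x : E d} (hx : x ∉ Metric.closedBall 0 1) : mollifier d x = 0 :=
  image_eq_zero_of_notMem_tsupport (by rwa [tsupport_mollifier])

lemma fderiv_mollifier_eq_zero {x : E d} (hx : x ∉ Metric.closedBall 0 1) :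
    fderiv ℝ (mollifier d) x = 0 :=
  fderiv_of_notMem_tsupport (𝕜 := ℝ) (by rwa [tsupport_mollifier])

/-- The derivative of an even function is odd. This sign is what makes the regularized transport
kernel antisymmetric. -/
lemma fderiv_mollifier_neg (x : E d) :
    fderiv ℝ (mollifier d) (-x) = -fderiv ℝ (mollifier d) x := by
  have h := (differentiable_mollifier (-x)).hasFDerivAt.comp x (hasFDerivAt_id x).neg
  have e : mollifier d ∘ Neg.neg = mollifier d := funext fun y => mollifier_neg y
  rw [e] at h
  rw [h.fderiv]
  ext v; simp

lemma exists_norm_fderiv_mollifier_le (d : ℕ) :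
    ∃ C : ℝ, 0 ≤ C ∧ ∀ x, ‖fderiv ℝ (mollifier d) x‖ ≤ C := by
  obtain ⟨C, hC⟩ := (hasCompactSupport_mollifier (d := d)).fderiv ℝ
    |>.exists_bound_of_continuous continuous_fderiv_mollifier
  exact ⟨C, (norm_nonneg _).trans (hC 0), hC⟩

/-- Mollification at scale `ε`. -/
def moll (G : E d → ℝ) (ε : ℝ) (x : E d) : ℝ := ∫ z, G (x - ε • z) * mollifier d z

lemma integral_comp_sub_smul (F : E d → ℝ) (ψ : E d → ℝ) {ε : ℝ} (hε : 0 < ε) (x : E d) :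
    ∫ z, F (x - ε • z) * ψ z = (ε ^ d)⁻¹ * ∫ t, F t * ψ (ε⁻¹ • (x - t)) := by
  have h1 := Measure.integral_comp_smul_of_nonneg (volume : Measure (E d))
    (fun y => F (x - y) * ψ (ε⁻¹ • y)) ε (hR := hε.le)
  have h2 := integral_sub_left_eq_self (fun t => F t * ψ (ε⁻¹ • (x - t)))
    (volume : Measure (E d)) x
  simp only [sub_sub_cancel] at h2
  rw [← h2, ← smul_eq_mul (a := (ε ^ d)⁻¹)]
  rw [finrank_euclideanSpace_fin] at h1
  rw [← h1]
  simp only [inv_smul_smul₀ hε.ne']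

/-- The mollifier at scale `ε`, unnormalized. -/
lemma hasFDerivAt_scaled (ε : ℝ) (y : E d) :
    HasFDerivAt (fun y => mollifier d (ε⁻¹ • y)) (ε⁻¹ • fderiv ℝ (mollifier d) (ε⁻¹ • y)) y := by
  have h1 : HasFDerivAt (fun y : E d => ε⁻¹ • y) (ε⁻¹ • ContinuousLinearMap.id ℝ (E d)) y :=
    (hasFDerivAt_id y).const_smul ε⁻¹
  have h2 := (differentiable_mollifier (ε⁻¹ • y)).hasFDerivAt.comp y h1
  have e : ε⁻¹ • fderiv ℝ (mollifier d) (ε⁻¹ • y) =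
      (fderiv ℝ (mollifier d) (ε⁻¹ • y)).comp (ε⁻¹ • ContinuousLinearMap.id ℝ (E d)) := by
    ext v; simp
  rw [e]
  exact h2

lemma contDiff_scaled (ε : ℝ) : ContDiff ℝ ∞ (fun y => mollifier d (ε⁻¹ • y)) :=
  contDiff_mollifier.comp (contDiff_const_smul _)

lemma hasCompactSupport_scaled {ε : ℝ} (hε : 0 < ε) :
    HasCompactSupport (fun y => mollifier d (ε⁻¹ • y)) :=
  hasCompactSupport_mollifier.comp_smul (inv_ne_zero hε.ne')

lemma moll_eq_convolution (G : E d → ℝ) {ε : ℝ} (hε : 0 < ε) :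
    moll G ε = (ε ^ d)⁻¹ • convolution G (fun y => mollifier d (ε⁻¹ • y))
      (ContinuousLinearMap.lsmul ℝ ℝ) volume := by
  ext x
  rw [moll, integral_comp_sub_smul _ _ hε, Pi.smul_apply, convolution_def, smul_eq_mul]
  simp

lemma contDiff_moll {G : E d → ℝ} (hG : LocallyIntegrable G) {ε : ℝ} (hε : 0 < ε) :
    ContDiff ℝ ∞ (moll G ε) := by
  rw [moll_eq_convolution G hε]
  have h : ContDiff ℝ ∞ (convolution G (fun y => mollifier d (ε⁻¹ • y))
      (ContinuousLinearMap.lsmul ℝ ℝ) volume) :=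
    (hasCompactSupport_scaled hε).contDiff_convolution_right _ hG (contDiff_scaled ε)
  exact h.const_smul ((ε ^ d)⁻¹ : ℝ)

lemma fderiv_moll {G : E d → ℝ} (hG : LocallyIntegrable G) {ε : ℝ} (hε : 0 < ε) (x v : E d) :
    fderiv ℝ (moll G ε) x v =
      (ε ^ d)⁻¹ * ∫ t, G t * (ε⁻¹ * fderiv ℝ (mollifier d) (ε⁻¹ • (x - t)) v) := by
  have hc := hasCompactSupport_scaled (d := d) hε
  have hs := contDiff_scaled (d := d) ε
  have h : HasFDerivAt _ _ x := (hc.hasFDerivAt_convolution_right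
    (ContinuousLinearMap.lsmul ℝ ℝ) hG (hs.of_le (by simp)) x).const_smul ((ε ^ d)⁻¹ : ℝ)
  rw [moll_eq_convolution G hε, h.fderiv, smul_apply,
    convolution_precompR_apply _ hG (hc.fderiv ℝ) (hs.continuous_fderiv (by simp)),
    convolution_def, smul_eq_mul]
  congr 2
  ext t
  rw [(hasFDerivAt_scaled ε (x - t)).fderiv]
  simp

lemma fderiv_moll' {G : E d → ℝ} (hG : LocallyIntegrable G) {ε : ℝ} (hε : 0 < ε) (x v : E d) :
    fderiv ℝ (moll G ε) x v =
      ∫ z, G (x - ε • z) * (ε⁻¹ * fderiv ℝ (mollifier d) z v) := by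
  rw [fderiv_moll hG hε, integral_comp_sub_smul G _ hε]

lemma abs_moll_le {G : E d → ℝ} {B : ℝ} (hB : ∀ x, |G x| ≤ B) (ε : ℝ) (x : E d) :
    |moll G ε x| ≤ B := by
  have h := norm_integral_le_of_norm_le (f := fun z => G (x - ε • z) * mollifier d z)
    (g := fun z => B * mollifier d z) (integrable_mollifier.const_mul B)
    (Eventually.of_forall fun z => by
      rw [Real.norm_eq_abs, abs_mul, abs_of_nonneg (mollifier_nonneg z)]
      exact mul_le_mul_of_nonneg_right (hB _) (mollifier_nonneg z))
  rw [integral_const_mul, integral_mollifier, mul_one] at h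
  exact h

/-- Function and scale both vary with n, because in the application a cut-off near the boundary
recedes together with the mollification scale. -/
lemma tendsto_moll {G : ℕ → E d → ℝ} {B : ℝ} (hB : ∀ n x, |G n x| ≤ B)
    (hm : ∀ n, Measurable (G n)) {ε : ℕ → ℝ} {x : E d} {c : ℝ}
    (h : ∀ z, Tendsto (fun n => G n (x - ε n • z)) atTop (𝓝 c)) :
    Tendsto (fun n => moll (G n) (ε n) x) atTop (𝓝 c) := by
  have h1 : c = ∫ z, c * mollifier d z := by
    rw [integral_const_mul, integral_mollifier, mul_one]
  rw [h1]
  refine tendsto_integral_of_dominated_convergence (fun z => B * mollifier d z) (fun n => ?_)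
    (integrable_mollifier.const_mul B) (fun n => Eventually.of_forall fun z => ?_)
    (Eventually.of_forall fun z => (h z).mul_const _)
  · exact (((hm n).comp (by fun_prop)).mul continuous_mollifier.measurable).aestronglyMeasurable
  · rw [Real.norm_eq_abs, abs_mul, abs_of_nonneg (mollifier_nonneg z)]
    exact mul_le_mul_of_nonneg_right (hB _ _) (mollifier_nonneg z)

/-- A continuous function with bounded weak gradient is Lipschitz continuous. -/
theorem abs_sub_le_of_weak_gradient {Ω : Set (E d)} {p : E d → ℝ}
    (hp : Continuous p) {B : ℝ} (hB : ∀ x, |p x| ≤ B)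
    (hp0 : ∀ x ∉ Ω, p x = 0) {g : E d → E d} {L : ℝ} (hL0 : 0 ≤ L)
    (hL : ∀ᵐ x ∂(volume.restrict Ω), ‖g x‖ ≤ L)
    (h : ∀ ψ : E d → ℝ, ContDiff ℝ ∞ ψ → HasCompactSupport ψ → ∀ e,
      ∫ x in Ω, p x * fderiv ℝ ψ x e = -∫ x in Ω, inner ℝ (g x) e * ψ x) (x y : E d) :
    |p x - p y| ≤ L * ‖x - y‖ := by
  have hloc : LocallyIntegrable p := hp.locallyIntegrable
  have hder : ∀ ε : ℝ, 0 < ε → ∀ x, ‖fderiv ℝ (moll p ε) x‖ ≤ L := by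
    intro ε hε x
    refine ContinuousLinearMap.opNorm_le_bound _ hL0 fun v => ?_
    rw [fderiv_moll hloc hε]
    set ψ : E d → ℝ := fun t => mollifier d (ε⁻¹ • (x - t)) with hψ
    have hψs : ContDiff ℝ ∞ ψ := (contDiff_scaled ε).comp (contDiff_const.sub contDiff_id)
    have hψc : HasCompactSupport ψ :=
      (hasCompactSupport_scaled hε).comp_homeomorph (Homeomorph.subLeft x)
    have hψd : ∀ t, fderiv ℝ ψ t v = -(ε⁻¹ * fderiv ℝ (mollifier d) (ε⁻¹ • (x - t)) v) := by
      intro t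
      have h1 : HasFDerivAt (fun t : E d => x - t) (-ContinuousLinearMap.id ℝ (E d)) t :=
        (hasFDerivAt_id t).const_sub x
      have h2 := (hasFDerivAt_scaled ε (x - t)).comp t h1
      have h3 : ψ = (fun y => mollifier d (ε⁻¹ • y)) ∘ fun t => x - t := rfl
      rw [h3, h2.fderiv]
      simp
    have hψi : ∫ t, ψ t = ε ^ d := by
      have := integral_comp_sub_smul (fun _ => 1) (mollifier d) hε x
      simp only [one_mul, integral_mollifier] at this
      rw [eq_comm, inv_mul_eq_iff_eq_mul₀ (by positivity), mul_one] at this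
      exact this
    -- The derivative of the mollification is thus the mollification of the weak gradient g, cut off
    -- to Ω, and inherits the bound L. The kernel need not be supported in Ω, which is why the weak
    -- identity is required for all compactly supported ψ.
    have e1 : ∫ t, p t * (ε⁻¹ * fderiv ℝ (mollifier d) (ε⁻¹ • (x - t)) v) =
        ∫ t in Ω, inner ℝ (g t) v * ψ t := by
      have := h ψ hψs hψc v
      rw [← setIntegral_eq_integral_of_forall_compl_eq_zero (s := Ω)
        (fun t ht => by rw [hp0 t ht, zero_mul]), ← neg_inj, ← this, ← integral_neg]
      refine integral_congr_ae (Eventually.of_forall fun t => ?_)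
      simp only
      rw [hψd]; ring
    have hψ0 : ∀ t, 0 ≤ ψ t := fun t => mollifier_nonneg _
    have hψint : Integrable ψ := hψs.continuous.integrable_of_hasCompactSupport hψc
    have e2 : |∫ t in Ω, inner ℝ (g t) v * ψ t| ≤ ∫ t in Ω, L * ‖v‖ * ψ t := by
      rw [← Real.norm_eq_abs]
      refine norm_integral_le_of_norm_le (hψint.integrableOn.const_mul _) ?_
      filter_upwards [hL] with t ht
      rw [norm_mul, Real.norm_of_nonneg (hψ0 t)]
      refine mul_le_mul_of_nonneg_right ((norm_inner_le_norm _ _).trans ?_) (hψ0 t)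
      gcongr
    have e3 : ∫ t in Ω, L * ‖v‖ * ψ t ≤ L * ‖v‖ * ε ^ d := by
      rw [integral_const_mul, ← hψi]
      exact mul_le_mul_of_nonneg_left
        (setIntegral_le_integral hψint (Eventually.of_forall hψ0)) (by positivity)
    rw [e1, Real.norm_eq_abs, abs_mul, abs_of_pos (by positivity), inv_mul_le_iff₀ (by positivity)]
    linarith
  have hlip : ∀ ε : ℝ, 0 < ε → |moll p ε x - moll p ε y| ≤ L * ‖x - y‖ := fun ε hε =>
    Convex.norm_image_sub_le_of_norm_fderiv_le (s := univ) (𝕜 := ℝ)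
      (fun z _ => ((contDiff_moll hloc hε).differentiable (by simp)).differentiableAt)
      (fun z _ => hder ε hε z) convex_univ (mem_univ y) (mem_univ x)
  have hε : Tendsto (fun n : ℕ => 1 / ((n : ℝ) + 1)) atTop (𝓝 0) :=
    tendsto_one_div_add_atTop_nhds_zero_nat
  have hlim : ∀ x, Tendsto (fun n : ℕ => moll p (1 / ((n : ℝ) + 1)) x) atTop (𝓝 (p x)) := by
    intro x
    refine tendsto_moll (G := fun _ => p) (fun _ => hB) (fun _ => hp.measurable) fun z => ?_
    have : Tendsto (fun n : ℕ => x - (1 / ((n : ℝ) + 1)) • z) atTop (𝓝 (x - (0 : ℝ) • z)) :=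
      tendsto_const_nhds.sub (hε.smul_const z)
    rw [zero_smul, sub_zero] at this
    exact (hp.tendsto x).comp this
  exact le_of_tendsto ((hlim x).sub (hlim y)).abs
    (Eventually.of_forall fun n => hlip _ (by positivity))

end Mollifier

/-! ### The energy identity for a transport term that is only a distribution a priori. -/

section Renormalization

variable {d : ℕ}

lemma sum_coord_smul_single (v : E d) : ∑ k, v k • EuclideanSpace.single k (1 : ℝ) = v := by
  ext i
  simp [Finset.sum_apply, Pi.single_apply]

lemma clm_apply_eq_sum (l : E d →L[ℝ] ℝ) (v : E d) :
    l v = ∑ k, v k * l (EuclideanSpace.single k 1) := by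
  conv_lhs => rw [← sum_coord_smul_single v]
  simp

/-- Integration by parts in each coordinate, with ∫ η = 1, leaves the diagonal entries of A. With A
the derivative of the velocity, this is how the divergence arises in the limit. -/
lemma integral_fderiv_mollifier_apply (A : E d →L[ℝ] E d) :
    ∫ z, fderiv ℝ (mollifier d) z (A z) = -∑ k, A (EuclideanSpace.single k 1) k := by
  have hk : ∀ k, ∫ z, A z k * fderiv ℝ (mollifier d) z (EuclideanSpace.single k 1) =
      -A (EuclideanSpace.single k 1) k := by
    intro k
    let l : E d →L[ℝ] ℝ := (EuclideanSpace.proj k : E d →L[ℝ] ℝ).comp A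
    have := integral_mul_fderiv_of_compact (φ := l) l.contDiff contDiff_mollifier
      hasCompactSupport_mollifier (EuclideanSpace.single k 1)
    simp only [ContinuousLinearMap.fderiv] at this
    rw [integral_const_mul, integral_mollifier, mul_one] at this
    exact this
  rw [← Finset.sum_neg_distrib, ← Finset.sum_congr rfl fun k _ => hk k, ← integral_finsetSum]
  · exact integral_congr_ae (Eventually.of_forall fun z => clm_apply_eq_sum _ _)
  · intro k _
    refine Continuous.integrable_of_hasCompactSupport ?_ ?_
    · have : Continuous fun z : E d => A z k := by fun_prop
      exact this.mul (continuous_fderiv_mollifier.clm_apply continuous_const)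
    · refine HasCompactSupport.mul_left ?_
      exact (hasCompactSupport_mollifier.fderiv ℝ).comp_left
        (g := fun l : E d →L[ℝ] ℝ => l (EuclideanSpace.single k 1)) rfl

lemma integrable_prod_of_bound {Ω : Set (E d)} (hΩo : MeasurableSet Ω)
    (hΩb : Bornology.IsBounded Ω) {C : ℝ} :
    Integrable ((Ω ×ˢ Metric.closedBall (0 : E d) 1).indicator fun _ => C)
      ((volume : Measure (E d)).prod volume) := by
  rw [integrable_indicator_iff (hΩo.prod Metric.isClosed_closedBall.measurableSet)]
  refine integrableOn_const ?_
  rw [Measure.prod_prod]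
  exact ENNReal.mul_ne_top hΩb.measure_lt_top.ne (Metric.isBounded_closedBall.measure_lt_top).ne

lemma le_indicator_prod {Ω : Set (E d)} {F : E d × E d → ℝ} {C : ℝ} (hF : ∀ q, |F q| ≤ C)
    (h1 : ∀ q, q.1 ∉ Ω → F q = 0) (h2 : ∀ q, q.2 ∉ Metric.closedBall 0 1 → F q = 0)
    (q : E d × E d) :
    ‖F q‖ ≤ (Ω ×ˢ Metric.closedBall (0 : E d) 1).indicator (fun _ => C) q := by
  by_cases hq : q ∈ Ω ×ˢ Metric.closedBall (0 : E d) 1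
  · rw [indicator_of_mem hq]; exact hF q
  · rw [indicator_of_notMem hq]
    rw [mem_prod, not_and_or] at hq
    rcases hq with hq | hq
    · rw [h1 q hq, norm_zero]
    · rw [h2 q hq, norm_zero]

/-- Antisymmetry of the kernel of the regularized transport form. -/
lemma integral_transport_symm {g : E d → ℝ} {p : E d → E d} (ε : ℝ)
    (h1 : Integrable (fun q : E d × E d =>
      g q.1 * g (q.1 - ε • q.2) * fderiv ℝ (mollifier d) q.2 (p q.1)) (volume.prod volume))
    (h2 : Integrable (fun q : E d × E d =>
      g q.1 * g (q.1 - ε • q.2) * fderiv ℝ (mollifier d) q.2 (p (q.1 - ε • q.2)))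
      (volume.prod volume)) :
    ∫ q : E d × E d, g q.1 * g (q.1 - ε • q.2) *
        fderiv ℝ (mollifier d) q.2 (p (q.1 - ε • q.2)) ∂(volume.prod volume) =
      -∫ q : E d × E d, g q.1 * g (q.1 - ε • q.2) * fderiv ℝ (mollifier d) q.2 (p q.1)
        ∂(volume.prod volume) := by
  rw [integral_prod_symm _ h1, integral_prod_symm _ h2]
  -- Shifting x by ε z exchanges the two values of g and replaces z by -z; the oddness of ∇η then
  -- gives the sign.
  have e : ∀ z : E d, ∫ x, g x * g (x - ε • z) * fderiv ℝ (mollifier d) z (p (x - ε • z)) =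
      -∫ x, g x * g (x - ε • (-z)) * fderiv ℝ (mollifier d) (-z) (p x) := by
    intro z
    rw [← integral_add_right_eq_self _ (ε • z), ← integral_neg]
    refine integral_congr_ae (Eventually.of_forall fun x => ?_)
    simp only [add_sub_cancel_right, fderiv_mollifier_neg, smul_neg, sub_neg_eq_add,
      neg_apply]
    ring
  simp only [e]
  rw [integral_neg, integral_neg_eq_self
    (fun z : E d => ∫ x, g x * g (x - ε • z) * fderiv ℝ (mollifier d) z (p x))]

/-- The points at distance at least `r` from the complement. -/
def innerSet (Ω : Set (E d)) (r : ℝ) : Set (E d) := {x | r ≤ Metric.infDist x Ωᶜ}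

lemma isClosed_innerSet (Ω : Set (E d)) (r : ℝ) : IsClosed (innerSet Ω r) :=
  isClosed_le continuous_const (Metric.continuous_infDist_pt _)

lemma innerSet_subset {Ω : Set (E d)} {r : ℝ} (hr : 0 < r) : innerSet Ω r ⊆ Ω := by
  intro x hx
  by_contra h
  have h1 : Metric.infDist x Ωᶜ = 0 := Metric.infDist_zero_of_mem h
  have h2 : r ≤ Metric.infDist x Ωᶜ := hx
  linarith

/-- Cutting off at distance 2 ε from the complement and mollifying at scale ε leaves a support at
distance at least ε from it. -/
lemma isTestFunction_moll {Ω : Set (E d)} (hΩb : Bornology.IsBounded Ω) {g : E d → ℝ} {ε : ℝ}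
    (hg : LocallyIntegrable ((innerSet Ω (2 * ε)).indicator g)) (hε : 0 < ε) :
    IsTestFunction Ω (moll ((innerSet Ω (2 * ε)).indicator g) ε) := by
  have hs : tsupport (moll ((innerSet Ω (2 * ε)).indicator g) ε) ⊆ innerSet Ω ε := by
    refine closure_minimal (fun x hx => ?_) (isClosed_innerSet Ω ε)
    by_contra hxi
    refine hx ?_
    rw [moll]
    refine integral_eq_zero_of_ae (Eventually.of_forall fun z => ?_)
    simp only [Pi.zero_apply]
    by_cases hz : z ∈ Metric.closedBall (0 : E d) 1
    · have : x - ε • z ∉ innerSet Ω (2 * ε) := by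
        intro h
        refine hxi ?_
        have h1 : 2 * ε ≤ Metric.infDist (x - ε • z) Ωᶜ := h
        have h2 := Metric.infDist_le_infDist_add_dist (s := Ωᶜ) (x := x - ε • z) (y := x)
        have h3 : dist (x - ε • z) x ≤ ε := by
          rw [dist_eq_norm, sub_sub_cancel_left, norm_neg, norm_smul, Real.norm_of_nonneg hε.le]
          rw [mem_closedBall_zero_iff] at hz
          nlinarith
        change ε ≤ Metric.infDist x Ωᶜ
        linarith
      rw [indicator_of_notMem this, zero_mul]
    · rw [mollifier_eq_zero hz, mul_zero]
  have hsub := hs.trans (innerSet_subset hε)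
  exact ⟨contDiff_moll hg hε,
    HasCompactSupport.of_support_subset_isCompact
      (Metric.isCompact_of_isClosed_isBounded (isClosed_tsupport _) (hΩb.subset hsub))
      (subset_tsupport _), hsub⟩

/-- If `u·∇g ∈ L¹(Ω)` in the sense of distributions for a Lipschitz field `u` that vanishes
outside `Ω`, then `(u·∇g, g) + ½ ((∇·u) g, g) = 0`. -/
theorem transport_energy {Ω U : Set (E d)} (hΩo : IsOpen Ω) (hΩb : Bornology.IsBounded Ω)
    (hne : Ωᶜ.Nonempty) (hUΩ : U ⊆ Ω)
    (hUae : ∀ᵐ x ∂(volume.restrict Ω), x ∈ U) {p : E d → E d} {L : ℝ} (hL0 : 0 ≤ L)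
    (hp : ∀ x y, ‖p x - p y‖ ≤ L * ‖x - y‖) (hp0 : ∀ x ∉ Ω, p x = 0)
    (hpd : ∀ x ∈ U, DifferentiableAt ℝ p x) {g : E d → ℝ} {B : ℝ} (hg : Measurable g)
    (hgB : ∀ x, |g x| ≤ B) (hgc : ∀ x ∈ U, ContinuousAt g x) (hg0 : ∀ x ∉ U, g x = 0)
    {w D : E d → ℝ} (hw : IntegrableOn w Ω) (hD : IntegrableOn D Ω)
    (hDtr : ∀ᵐ x ∂(volume.restrict Ω), D x = ∑ k, fderiv ℝ p x (EuclideanSpace.single k 1) k)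
    (h : ∀ φ, IsTestFunction Ω φ →
      ∫ x in Ω, w x * φ x = -∫ x in Ω, g x * (fderiv ℝ φ x (p x) + D x * φ x)) :
    ∫ x in Ω, w x * g x + 1 / 2 * (D x * g x ^ 2) = 0 := by
  have hB0 : 0 ≤ B := (abs_nonneg _).trans (hgB 0)
  have hpc : Continuous p := by
    refine (LipschitzWith.of_dist_le_mul (K := L.toNNReal) fun x y => ?_).continuous
    rw [dist_eq_norm, dist_eq_norm, Real.coe_toNNReal _ hL0]
    exact hp x y
  obtain ⟨y₀, hy₀⟩ := hne
  obtain ⟨r, hr⟩ := (hΩb.subset_closedBall y₀)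
  obtain ⟨Pm, hPm0, hPm⟩ : ∃ Pm : ℝ, 0 ≤ Pm ∧ ∀ x, ‖p x‖ ≤ Pm := by
    refine ⟨L * |r|, by positivity, fun x => ?_⟩
    by_cases hx : x ∈ Ω
    · have h1 := hp x y₀
      rw [hp0 y₀ hy₀, sub_zero] at h1
      refine h1.trans ?_
      gcongr
      have := hr hx
      rw [Metric.mem_closedBall, dist_eq_norm] at this
      exact this.trans (le_abs_self r)
    · rw [hp0 x hx, norm_zero]; positivity
  obtain ⟨Cη, hCη0, hCη⟩ := exists_norm_fderiv_mollifier_le d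
  have hgΩ : ∀ x ∉ Ω, g x = 0 := fun x hx => hg0 x fun hxU => hx (hUΩ hxU)
  -- the scales and the cut-offs
  set ε : ℕ → ℝ := fun n => 1 / ((n : ℝ) + 1) with hεdef
  have hε0 : ∀ n, 0 < ε n := fun n => by positivity
  have hεlim : Tendsto ε atTop (𝓝 0) := tendsto_one_div_add_atTop_nhds_zero_nat
  set A : ℕ → Set (E d) := fun n => innerSet Ω (2 * ε n) with hA
  have hAm : ∀ n, MeasurableSet (A n) := fun n => (isClosed_innerSet _ _).measurableSet
  set G : ℕ → E d → ℝ := fun n => (A n).indicator g with hG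
  have hGm : ∀ n, Measurable (G n) := fun n => hg.indicator (hAm n)
  have hGB : ∀ n x, |G n x| ≤ B := fun n x => by
    by_cases hx : x ∈ A n
    · simp only [hG, indicator_of_mem hx]; exact hgB x
    · simp only [hG, indicator_of_notMem hx, abs_zero]; exact hB0
  have hGloc : ∀ n, LocallyIntegrable (G n) := fun n => by
    refine (locallyIntegrable_const B).mono (hGm n).aestronglyMeasurable
      (Eventually.of_forall fun x => ?_)
    rw [Real.norm_eq_abs, Real.norm_of_nonneg hB0]
    exact hGB n x
  have hshift : ∀ x z : E d, Tendsto (fun n => x - ε n • z) atTop (𝓝 x) := fun x z => by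
    have := (tendsto_const_nhds (x := x)).sub (hεlim.smul_const z)
    rwa [zero_smul, sub_zero] at this
  have hevA : ∀ x ∈ U, ∀ z, ∀ᶠ n in atTop, x - ε n • z ∈ A n := by
    intro x hx z
    have hpos : 0 < Metric.infDist x Ωᶜ :=
      (hΩo.isClosed_compl.notMem_iff_infDist_pos ⟨y₀, hy₀⟩).1 fun h' => h' (hUΩ hx)
    have h1 : Tendsto (fun n => Metric.infDist (x - ε n • z) Ωᶜ - 2 * ε n) atTop
        (𝓝 (Metric.infDist x Ωᶜ - 2 * 0)) :=
      (((Metric.continuous_infDist_pt Ωᶜ).tendsto x).comp (hshift x z)).sub (hεlim.const_mul 2)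
    rw [mul_zero, sub_zero] at h1
    filter_upwards [h1.eventually (lt_mem_nhds hpos)] with n hn
    change 2 * ε n ≤ Metric.infDist (x - ε n • z) Ωᶜ
    linarith
  set φ : ℕ → E d → ℝ := fun n => moll (G n) (ε n) with hφ
  have hφtest : ∀ n, IsTestFunction Ω (φ n) := fun n => isTestFunction_moll hΩb (hGloc n) (hε0 n)
  have hφB : ∀ n x, |φ n x| ≤ B := fun n x => abs_moll_le (hGB n) _ x
  have hφc : ∀ n, Continuous (φ n) := fun n => (hφtest n).1.continuous
  have hφlim : ∀ x ∈ U, Tendsto (fun n => φ n x) atTop (𝓝 (g x)) := by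
    intro x hx
    refine tendsto_moll hGB hGm fun z => ?_
    refine ((hgc x hx).tendsto.comp (hshift x z)).congr' ?_
    filter_upwards [hevA x hx z] with n hn
    simp only [hG, Function.comp_apply, indicator_of_mem hn]
  -- the limits of the two lower order integrals
  have lim₁ : Tendsto (fun n => ∫ x in Ω, w x * φ n x) atTop (𝓝 (∫ x in Ω, w x * g x)) := by
    refine tendsto_integral_of_dominated_convergence (fun x => |w x| * B)
      (fun n => hw.aestronglyMeasurable.mul (hφc n).aestronglyMeasurable)
      (hw.abs.mul_const B) (fun n => Eventually.of_forall fun x => ?_) ?_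
    · rw [norm_mul, Real.norm_eq_abs, Real.norm_eq_abs]
      exact mul_le_mul_of_nonneg_left (hφB n x) (abs_nonneg _)
    · filter_upwards [hUae] with x hx
      exact (hφlim x hx).const_mul _
  have hgD : IntegrableOn (fun x => g x * D x) Ω :=
    hD.bdd_mul (c := B) hg.aestronglyMeasurable (Eventually.of_forall hgB)
  have lim₂ : Tendsto (fun n => ∫ x in Ω, g x * D x * φ n x) atTop
      (𝓝 (∫ x in Ω, g x * D x * g x)) := by
    refine tendsto_integral_of_dominated_convergence (fun x => |g x * D x| * B)
      (fun n => hgD.aestronglyMeasurable.mul (hφc n).aestronglyMeasurable)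
      (hgD.abs.mul_const B) (fun n => Eventually.of_forall fun x => ?_) ?_
    · rw [norm_mul, Real.norm_eq_abs, Real.norm_eq_abs]
      exact mul_le_mul_of_nonneg_left (hφB n x) (abs_nonneg _)
    · filter_upwards [hUae] with x hx
      exact (hφlim x hx).const_mul _
  -- the transport integral in symmetrized form
  set R : ℕ → E d × E d → ℝ := fun n q =>
    g q.1 * g (q.1 - ε n • q.2) * fderiv ℝ (mollifier d) q.2 (p q.1) with hR
  set R' : ℕ → E d × E d → ℝ := fun n q =>
    g q.1 * g (q.1 - ε n • q.2) * fderiv ℝ (mollifier d) q.2 (p (q.1 - ε n • q.2)) with hR'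
  set Q : ℕ → E d × E d → ℝ := fun n q =>
    g q.1 * G n (q.1 - ε n • q.2) * fderiv ℝ (mollifier d) q.2 (p q.1) with hQ
  have hm1 : ∀ n, Measurable fun q : E d × E d => g (q.1 - ε n • q.2) :=
    fun n => hg.comp (by fun_prop)
  have hm2 : ∀ n, Measurable fun q : E d × E d => G n (q.1 - ε n • q.2) :=
    fun n => (hGm n).comp (by fun_prop)
  have hm3 : Measurable fun q : E d × E d => g q.1 := hg.comp measurable_fst
  have hc1 : Continuous fun q : E d × E d => fderiv ℝ (mollifier d) q.2 (p q.1) :=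
    (continuous_fderiv_mollifier.comp continuous_snd).clm_apply (hpc.comp continuous_fst)
  have hc2 : ∀ n, Continuous fun q : E d × E d =>
      fderiv ℝ (mollifier d) q.2 (p (q.1 - ε n • q.2)) := fun n =>
    (continuous_fderiv_mollifier.comp continuous_snd).clm_apply (hpc.comp (by fun_prop))
  have hbd : ∀ (a b : ℝ) (z v : E d), |a| ≤ B → |b| ≤ B → ‖v‖ ≤ Pm →
      |a * b * fderiv ℝ (mollifier d) z v| ≤ B * B * (Cη * Pm) := by
    intro a b z v ha hb hv
    rw [abs_mul, abs_mul]
    have := ((fderiv ℝ (mollifier d) z).le_opNorm v).trans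
      (mul_le_mul (hCη z) hv (norm_nonneg _) hCη0)
    exact mul_le_mul (mul_le_mul ha hb (abs_nonneg _) hB0) this (abs_nonneg _) (by positivity)
  have hRi : ∀ n, Integrable (R n) (volume.prod volume) := fun n =>
    (integrable_prod_of_bound hΩo.measurableSet hΩb).mono'
      ((hm3.mul (hm1 n)).mul hc1.measurable).aestronglyMeasurable
      (Eventually.of_forall (le_indicator_prod
        (fun q => hbd _ _ _ _ (hgB _) (hgB _) (hPm _))
        (fun q hq => by simp only [hR, hgΩ _ hq, zero_mul])
        (fun q hq => by simp only [hR, fderiv_mollifier_eq_zero hq, zero_apply, mul_zero])))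
  have hR'i : ∀ n, Integrable (R' n) (volume.prod volume) := fun n =>
    (integrable_prod_of_bound hΩo.measurableSet hΩb).mono'
      ((hm3.mul (hm1 n)).mul (hc2 n).measurable).aestronglyMeasurable
      (Eventually.of_forall (le_indicator_prod
        (fun q => hbd _ _ _ _ (hgB _) (hgB _) (hPm _))
        (fun q hq => by simp only [hR', hgΩ _ hq, zero_mul])
        (fun q hq => by simp only [hR', fderiv_mollifier_eq_zero hq, zero_apply, mul_zero])))
  have hQi : ∀ n, Integrable (Q n) (volume.prod volume) := fun n =>
    (integrable_prod_of_bound hΩo.measurableSet hΩb).mono'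
      ((hm3.mul (hm2 n)).mul hc1.measurable).aestronglyMeasurable
      (Eventually.of_forall (le_indicator_prod
        (fun q => hbd _ _ _ _ (hgB _) (hGB n _) (hPm _))
        (fun q hq => by simp only [hQ, hgΩ _ hq, zero_mul])
        (fun q hq => by simp only [hQ, fderiv_mollifier_eq_zero hq, zero_apply, mul_zero])))
  -- Since R and R' have opposite integrals, F has the same integral as Q / ε, which is the
  -- transport term. Unlike Q / ε it stays bounded: R - R' contains the increment of p over a
  -- distance ε, and R - Q lives in a boundary layer where p is of order ε.
  set F : ℕ → E d × E d → ℝ := fun n q =>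
    (ε n)⁻¹ * (1 / 2 * (R n q - R' n q) - (R n q - Q n q)) with hF
  have hT : ∀ n, ∫ x in Ω, g x * fderiv ℝ (φ n) x (p x) = ∫ q, F n q ∂(volume.prod volume) := by
    intro n
    have e1 : ∫ q, F n q ∂(volume.prod volume) = (ε n)⁻¹ * ∫ q, Q n q ∂(volume.prod volume) := by
      have i1 : Integrable (fun q => R n q - R' n q) (volume.prod volume) := (hRi n).sub (hR'i n)
      have i2 : Integrable (fun q => R n q - Q n q) (volume.prod volume) := (hRi n).sub (hQi n)
      rw [integral_const_mul, integral_sub (i1.const_mul _) i2, integral_const_mul, integral_sub (hRi n) (hR'i n),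
        integral_sub (hRi n) (hQi n)]
      have := integral_transport_symm (ε n) (hRi n) (hR'i n)
      change ∫ q, R' n q ∂(volume.prod volume) = -∫ q, R n q ∂(volume.prod volume) at this
      rw [this]
      ring
    rw [e1, integral_prod _ (hQi n), setIntegral_eq_integral_of_forall_compl_eq_zero
      (fun x hx => by rw [hgΩ x hx, zero_mul]), ← integral_const_mul]
    refine integral_congr_ae (Eventually.of_forall fun x => ?_)
    simp only [hφ, hQ]
    rw [fderiv_moll' (hGloc n) (hε0 n), ← integral_const_mul, ← integral_const_mul]
    refine integral_congr_ae (Eventually.of_forall fun z => ?_)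
    simp only
    ring
  -- the limit of the symmetrized transport integral
  have hFbound : ∀ n q, |F n q| ≤ 4 * (B * B * (Cη * L)) := by
    intro n q
    by_cases hz : q.2 ∈ Metric.closedBall (0 : E d) 1
    swap
    · have : F n q = 0 := by
        simp only [hF, hR, hR', hQ, fderiv_mollifier_eq_zero hz, zero_apply, mul_zero, sub_zero]
      rw [this, abs_zero]; positivity
    rw [mem_closedBall_zero_iff] at hz
    have hεz : ‖ε n • q.2‖ ≤ ε n := by
      rw [norm_smul, Real.norm_of_nonneg (hε0 n).le]
      exact mul_le_of_le_one_right (hε0 n).le hz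
    have hη : ∀ v, |fderiv ℝ (mollifier d) q.2 v| ≤ Cη * ‖v‖ := fun v =>
      ((fderiv ℝ (mollifier d) q.2).le_opNorm v).trans
        (mul_le_mul_of_nonneg_right (hCη _) (norm_nonneg _))
    have b1 : |R n q - R' n q| ≤ B * B * (Cη * L) * ε n := by
      have e : R n q - R' n q = g q.1 * g (q.1 - ε n • q.2) *
          fderiv ℝ (mollifier d) q.2 (p q.1 - p (q.1 - ε n • q.2)) := by
        simp only [hR, hR', map_sub]; ring
      rw [e, abs_mul, abs_mul]
      have h1 := hp q.1 (q.1 - ε n • q.2)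
      rw [sub_sub_cancel] at h1
      have h2 : |fderiv ℝ (mollifier d) q.2 (p q.1 - p (q.1 - ε n • q.2))| ≤ Cη * (L * ε n) :=
        (hη _).trans (by gcongr; exact h1.trans (by gcongr))
      calc _ ≤ B * B * (Cη * (L * ε n)) := by
            gcongr
            · exact hgB _
            · exact hgB _
        _ = _ := by ring
    -- A shifted point that is cut off lies within 2 ε of a zero y of p outside Ω, and x lies within
    -- ε of the shifted point, so |p(x)| ≤ 3 L ε.
    have b2 : |R n q - Q n q| ≤ B * B * (Cη * L) * (3 * ε n) := by
      by_cases hx : q.1 - ε n • q.2 ∈ A n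
      · have : R n q - Q n q = 0 := by
          simp only [hR, hQ, hG, indicator_of_mem hx, sub_self]
        rw [this, abs_zero]
        have := hε0 n
        positivity
      · have e : R n q - Q n q = g q.1 * g (q.1 - ε n • q.2) *
            fderiv ℝ (mollifier d) q.2 (p q.1) := by
          simp only [hR, hQ, hG, indicator_of_notMem hx]; ring
        have hx' : Metric.infDist (q.1 - ε n • q.2) Ωᶜ < 2 * ε n := not_le.1 hx
        obtain ⟨y, hy, hxy⟩ := (Metric.infDist_lt_iff ⟨y₀, hy₀⟩).1 hx'
        have h1 := hp q.1 y
        rw [hp0 y hy, sub_zero] at h1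
        have h3 : ‖q.1 - y‖ ≤ 3 * ε n := by
          have e' : q.1 - y = (q.1 - ε n • q.2 - y) + ε n • q.2 := by abel
          rw [dist_eq_norm] at hxy
          rw [e']
          refine (norm_add_le _ _).trans ?_
          linarith
        have h2 : |fderiv ℝ (mollifier d) q.2 (p q.1)| ≤ Cη * (L * (3 * ε n)) :=
          (hη _).trans (by gcongr; exact h1.trans (by gcongr))
        rw [e, abs_mul, abs_mul]
        calc _ ≤ B * B * (Cη * (L * (3 * ε n))) := by
              gcongr
              · exact hgB _
              · exact hgB _
          _ = _ := by ring
    simp only [hF]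
    rw [abs_mul, abs_of_pos (inv_pos.2 (hε0 n)), inv_mul_le_iff₀ (hε0 n)]
    have b3 := abs_sub (1 / 2 * (R n q - R' n q)) (R n q - Q n q)
    rw [abs_mul, abs_of_pos (show (0 : ℝ) < 1 / 2 by norm_num)] at b3
    have : 0 ≤ B * B * (Cη * L) * ε n := (abs_nonneg _).trans b1
    linarith
  set F' : E d × E d → ℝ := fun q =>
    1 / 2 * g q.1 ^ 2 * fderiv ℝ (mollifier d) q.2 (fderiv ℝ p q.1 q.2) with hF'
  -- Off U the factor g(x) is zero. At a point of U the cut-off is eventually inactive, so Q = R,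
  -- and what is left is a difference quotient of p in the direction z.
  have hFlim : ∀ q, Tendsto (fun n => F n q) atTop (𝓝 (F' q)) := by
    rintro ⟨x, z⟩
    by_cases hx : x ∈ U
    swap
    · simp only [hF, hF', hR, hR', hQ, hg0 x hx]
      simp
    have hfd := (hpd x hx).hasFDerivAt
    have hinv : Tendsto (fun n => ‖(ε n)⁻¹‖) atTop atTop := by
      have : Tendsto (fun n => (ε n)⁻¹) atTop atTop :=
        tendsto_inv_nhdsGT_zero.comp (tendsto_nhdsWithin_iff.2
          ⟨hεlim, Eventually.of_forall fun n => hε0 n⟩)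
      exact tendsto_norm_atTop_atTop.comp this
    have h1 := hfd.lim (-z) hinv
    have h2 : Tendsto (fun n => (ε n)⁻¹ • (p x - p (x - ε n • z))) atTop (𝓝 (fderiv ℝ p x z)) := by
      have := h1.neg
      rw [map_neg, neg_neg] at this
      refine this.congr fun n => ?_
      rw [inv_inv, smul_neg, ← sub_eq_add_neg, ← smul_neg, neg_sub]
    have h3 : Tendsto (fun n => 1 / 2 * (g x * g (x - ε n • z)) * fderiv ℝ (mollifier d) z
        ((ε n)⁻¹ • (p x - p (x - ε n • z)))) atTop
        (𝓝 (1 / 2 * (g x * g x) * fderiv ℝ (mollifier d) z (fderiv ℝ p x z))) :=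
      ((((hgc x hx).tendsto.comp (hshift x z)).const_mul _).const_mul _).mul
        (((fderiv ℝ (mollifier d) z).continuous.tendsto _).comp h2)
    have e : F' (x, z) = 1 / 2 * (g x * g x) * fderiv ℝ (mollifier d) z (fderiv ℝ p x z) := by
      simp only [hF']; ring
    rw [e]
    refine h3.congr' ?_
    filter_upwards [hevA x hx z] with n hn
    simp only [hF, hR, hR', hQ, hG, indicator_of_mem hn, map_smul, map_sub, smul_eq_mul]
    ring
  have hFm : ∀ n, AEStronglyMeasurable (F n) (volume.prod volume) := fun n =>
    ((((hRi n).sub (hR'i n)).const_mul _).sub ((hRi n).sub (hQi n))).const_mul _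
      |>.aestronglyMeasurable
  have hFdom : ∀ n, ∀ q, ‖F n q‖ ≤ (Ω ×ˢ Metric.closedBall (0 : E d) 1).indicator
      (fun _ => 4 * (B * B * (Cη * L))) q := fun n =>
    le_indicator_prod (hFbound n)
      (fun q hq => by simp only [hF, hR, hR', hQ, hgΩ _ hq]; ring)
      (fun q hq => by
        simp only [hF, hR, hR', hQ, fderiv_mollifier_eq_zero hq, zero_apply, mul_zero, sub_zero])
  have hdomi := integrable_prod_of_bound (C := 4 * (B * B * (Cη * L))) hΩo.measurableSet hΩb
  have lim₃ : Tendsto (fun n => ∫ q, F n q ∂(volume.prod volume)) atTop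
      (𝓝 (∫ q, F' q ∂(volume.prod volume))) :=
    tendsto_integral_of_dominated_convergence _ hFm hdomi
      (fun n => Eventually.of_forall (hFdom n)) (Eventually.of_forall hFlim)
  have hF'i : Integrable F' (volume.prod volume) :=
    ⟨aestronglyMeasurable_of_tendsto_ae atTop hFm (Eventually.of_forall hFlim),
      hasFiniteIntegral_of_dominated_convergence hdomi.hasFiniteIntegral
        (fun n => Eventually.of_forall (hFdom n)) (Eventually.of_forall hFlim)⟩
  -- Integration in z turns the limit kernel into minus half the divergence times g². Added to the
  -- full divergence term of the weak equation, it leaves the coefficient 1/2 of the claim.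
  have hF'v : ∫ q, F' q ∂(volume.prod volume) = -(1 / 2 * ∫ x in Ω, g x * D x * g x) := by
    rw [integral_prod _ hF'i, ← integral_const_mul, ← integral_neg]
    have : ∀ x, ∫ z, F' (x, z) =
        1 / 2 * g x ^ 2 * -∑ k, fderiv ℝ p x (EuclideanSpace.single k 1) k := by
      intro x
      rw [← integral_fderiv_mollifier_apply, ← integral_const_mul]
    simp only [this]
    rw [← setIntegral_eq_integral_of_forall_compl_eq_zero (s := Ω)
      (fun x hx => by rw [hgΩ x hx]; ring)]
    refine integral_congr_ae ?_
    filter_upwards [hDtr] with x hx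
    rw [hx]; ring
  -- conclusion
  have hgφ : ∀ n, ∫ x in Ω, w x * φ n x =
      -(∫ q, F n q ∂(volume.prod volume) + ∫ x in Ω, g x * D x * φ n x) := by
    intro n
    rw [h _ (hφtest n), ← hT n, ← integral_add]
    · congr 2
      ext x; ring
    · have hcd : Continuous fun x => fderiv ℝ (φ n) x (p x) :=
        ((hφtest n).1.continuous_fderiv (by simp)).clm_apply hpc
      have hcs : HasCompactSupport fun x => fderiv ℝ (φ n) x (p x) := by
        refine ((hφtest n).2.1.fderiv ℝ).mono fun x hx => ?_
        intro h0
        exact hx (by simp only [h0, zero_apply])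
      exact ((hcd.integrable_of_hasCompactSupport hcs).bdd_mul (c := B) hg.aestronglyMeasurable
        (Eventually.of_forall hgB)).integrableOn
    · exact hgD.mul_bdd (c := B) (hφc n).aestronglyMeasurable (Eventually.of_forall (hφB n))
  have lim₄ := (lim₃.add lim₂).neg
  have huniq := tendsto_nhds_unique lim₁ (lim₄.congr fun n => (hgφ n).symm)
  rw [hF'v] at huniq
  rw [integral_add, integral_const_mul, huniq]
  · have : ∫ x in Ω, D x * g x ^ 2 = ∫ x in Ω, g x * D x * g x := by
      congr 1; ext x; ring
    rw [this]; ring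
  · exact hw.mul_bdd (c := B) hg.aestronglyMeasurable (Eventually.of_forall hgB)
  · have := (hgD.mul_bdd (c := B) hg.aestronglyMeasurable
      (Eventually.of_forall hgB)).const_mul (1 / 2)
    refine this.congr (Eventually.of_forall fun x => ?_)
    simp only; ring

end Renormalization

/-! ### Regularity and bounds of piecewise polynomials. -/

section PiecewisePolynomials

variable {d : ℕ} {Ω : Set (E d)} {T : Geometry.SimplicialComplex ℝ (E d)} {K : Set (E d)}
  {m : ℕ} {g : E d → ℝ} {x : E d}

lemma IsPiecewisePoly.eventuallyEq (hg : IsPiecewisePoly T m g) (hK : K ∈ elements T) :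
    ∃ p : MvPolynomial (Fin d) ℝ, p.totalDegree ≤ m ∧
      (∀ x ∈ interior K, g x = polyFun p x) ∧ ∀ x ∈ interior K, g =ᶠ[𝓝 x] polyFun p := by
  obtain ⟨p, hp, h⟩ := hg K hK
  exact ⟨p, hp, h, fun x hx => eventually_of_mem (isOpen_interior.mem_nhds hx) h⟩

lemma IsPiecewisePoly.contDiffAt (hg : IsPiecewisePoly T m g) (hx : x ∈ openUnion T) :
    ContDiffAt ℝ ∞ g x := by
  obtain ⟨K, hK, hxK⟩ := mem_openUnion.1 hx
  obtain ⟨p, -, -, h⟩ := hg.eventuallyEq hK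
  exact (contDiff_polyFun p).contDiffAt.congr_of_eventuallyEq (h x hxK)

lemma IsPiecewisePoly.continuousAt (hg : IsPiecewisePoly T m g) (hx : x ∈ openUnion T) :
    ContinuousAt g x := (hg.contDiffAt hx).continuousAt

lemma IsPiecewisePoly.differentiableAt (hg : IsPiecewisePoly T m g) (hx : x ∈ openUnion T) :
    DifferentiableAt ℝ g x := (hg.contDiffAt hx).differentiableAt (by simp)

lemma IsPiecewisePoly.continuousOn_gradient (hg : IsPiecewisePoly T m g) (k : Fin d) :
    ContinuousOn (fun x => gradient g x k) (openUnion T) := by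
  intro x hx
  obtain ⟨K, hK, hxK⟩ := mem_openUnion.1 hx
  obtain ⟨p, -, -, h⟩ := hg.eventuallyEq hK
  have h1 : (fun x => gradient g x k) =ᶠ[𝓝 x]
      fun x => fderiv ℝ (polyFun p) x (EuclideanSpace.single k 1) := by
    filter_upwards [(h x hxK).fderiv (𝕜 := ℝ)] with y hy
    rw [gradient_apply, hy]
  have h2 : Continuous fun x => fderiv ℝ (polyFun p) x (EuclideanSpace.single k 1) :=
    (continuous_fderiv_polyFun p).clm_apply continuous_const
  exact (h2.continuousAt.congr h1.symm).continuousWithinAt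

lemma IsPiecewisePoly.exists_bound (hT : IsMesh Ω T) (hg : IsPiecewisePoly T m g) :
    ∃ B : ℝ, 0 ≤ B ∧ ∀ x ∈ openUnion T, |g x| ≤ B ∧ ‖fderiv ℝ g x‖ ≤ B := by
  have hK : ∀ K ∈ elements T, ∃ B : ℝ, 0 ≤ B ∧ ∀ x ∈ interior K, |g x| ≤ B ∧
      ‖fderiv ℝ g x‖ ≤ B := by
    intro K hK
    obtain ⟨p, -, h, h'⟩ := hg.eventuallyEq hK
    obtain ⟨B₁, hB₁⟩ := (isCompact_of_mem_elements hK).exists_bound_of_continuousOn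
      (continuous_polyFun p).continuousOn
    obtain ⟨B₂, hB₂⟩ := (isCompact_of_mem_elements hK).exists_bound_of_continuousOn
      (continuous_fderiv_polyFun p).continuousOn
    refine ⟨max 0 (max B₁ B₂), le_max_left _ _, fun x hx => ?_⟩
    rw [h x hx, (h' x hx).fderiv_eq]
    exact ⟨(hB₁ x (interior_subset hx)).trans ((le_max_left _ _).trans (le_max_right _ _)),
      (hB₂ x (interior_subset hx)).trans ((le_max_right _ _).trans (le_max_right _ _))⟩
  choose! B hB0 hB using hK
  refine ⟨∑ K ∈ hT.finite_elements.toFinset, B K,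
    Finset.sum_nonneg fun K hK => hB0 K (by simpa using hK), fun x hx => ?_⟩
  obtain ⟨K, hK, hxK⟩ := mem_openUnion.1 hx
  have : B K ≤ ∑ K ∈ hT.finite_elements.toFinset, B K :=
    Finset.single_le_sum (f := B) (fun K hK => hB0 K (by simpa using hK)) (by simpa using hK)
  exact ⟨(hB K hK x hxK).1.trans this, (hB K hK x hxK).2.trans this⟩

lemma abs_gradient_apply_le (g : E d → ℝ) (x : E d) (k : Fin d) :
    |gradient g x k| ≤ ‖fderiv ℝ g x‖ := by
  rw [gradient_apply]
  refine ((fderiv ℝ g x).le_opNorm _).trans ?_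
  simp

lemma IsPiecewisePoly.memLp_top (hT : IsMesh Ω T) (hg : IsPiecewisePoly T m g) :
    MemLp g ∞ (volume.restrict Ω) := by
  obtain ⟨B, -, hB⟩ := hg.exists_bound hT
  refine memLp_top_of_bound ?_ B ?_
  · rw [hT.restrict_eq]
    exact ContinuousOn.aestronglyMeasurable (fun x hx => (hg.continuousAt hx).continuousWithinAt)
      isOpen_openUnion.measurableSet
  · filter_upwards [hT.ae_mem] with x hx using (hB x hx).1

lemma IsPiecewisePoly.memLp_top_gradient (hT : IsMesh Ω T) (hg : IsPiecewisePoly T m g)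
    (k : Fin d) : MemLp (fun x => gradient g x k) ∞ (volume.restrict Ω) := by
  obtain ⟨B, -, hB⟩ := hg.exists_bound hT
  refine memLp_top_of_bound ?_ B ?_
  · rw [hT.restrict_eq]
    exact (hg.continuousOn_gradient k).aestronglyMeasurable isOpen_openUnion.measurableSet
  · filter_upwards [hT.ae_mem] with x hx using (abs_gradient_apply_le _ _ _).trans (hB x hx).2

lemma IsPiecewisePoly.measurable (hg : IsPiecewisePoly T m g)
    (h0 : ∀ x ∉ openUnion T, g x = 0) : Measurable g := by
  classical
  have h1 : ContinuousOn g (openUnion T) := fun x hx => (hg.continuousAt hx).continuousWithinAt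
  have h2 : g = (openUnion T).piecewise g 0 := by
    ext x
    by_cases hx : x ∈ openUnion T
    · rw [piecewise_eq_of_mem _ _ _ hx]
    · rw [piecewise_eq_of_notMem _ _ _ hx, h0 x hx, Pi.zero_apply]
  rw [h2]
  exact h1.measurable_piecewise continuousOn_const isOpen_openUnion.measurableSet

/-- The weak gradient agrees with the classical one where the function is smooth. -/
lemma weak_gradient_ae_eq {v : L2 Ω ℝ × L2 Ω (E d)} (hv : v ∈ H10 Ω) {W : Set (E d)}
    (hW : IsOpen W) (hWΩ : W ⊆ Ω) {P : E d → ℝ} (hP : ContDiff ℝ ∞ P)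
    (h : ∀ᵐ x ∂(volume.restrict Ω), x ∈ W → v.1 x = P x) :
    ∀ᵐ x ∂(volume.restrict Ω), x ∈ W → v.2 x = gradient P x := by
  -- Subtract classical integration by parts for P from the weak identity, with test functions
  -- supported in W, and apply the fundamental lemma of the calculus of variations.
  have key : ∀ k : Fin d, ∀ᵐ x, x ∈ W →
      inner ℝ (v.2 x) (EuclideanSpace.single k (1 : ℝ)) - gradient P x k = 0 := by
    intro k
    set e : E d := EuclideanSpace.single k 1
    have hcP : Continuous fun x => gradient P x k := by
      simp only [gradient_apply]
      exact (hP.continuous_fderiv (by simp)).clm_apply continuous_const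
    have hv2 : LocallyIntegrable (fun x => inner ℝ (v.2 x) e) (volume.restrict Ω) :=
      ((Lp.memLp v.2).inner_const e).locallyIntegrable (by norm_num)
    refine hW.ae_eq_zero_of_integral_contDiff_smul_eq_zero ?_ ?_
    · refine LocallyIntegrableOn.sub ?_ (hcP.locallyIntegrable.locallyIntegrableOn W)
      exact (locallyIntegrableOn_of_locallyIntegrable_restrict hv2).mono_set hWΩ
    · intro φ hφ hc hs
      have hφ0 : ∀ x ∉ W, φ x = 0 := fun x hx =>
        image_eq_zero_of_notMem_tsupport fun h' => hx (hs h')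
      have hdφ0 : ∀ x ∉ W, fderiv ℝ φ x = 0 := fun x hx =>
        fderiv_of_notMem_tsupport (𝕜 := ℝ) fun h' => hx (hs h')
      have e1 := H10_weak_gradient hv hφ hc e
      have e2 := integral_mul_fderiv_of_compact hP hφ hc e
      have e3 : ∫ x in Ω, v.1 x * fderiv ℝ φ x e = ∫ x, P x * fderiv ℝ φ x e := by
        rw [← setIntegral_eq_integral_of_forall_compl_eq_zero (s := Ω)
          (f := fun x => P x * fderiv ℝ φ x e)
          (fun x hx => by rw [hdφ0 x fun h' => hx (hWΩ h')]; simp)]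
        refine integral_congr_ae ?_
        filter_upwards [h] with x hx
        by_cases hxW : x ∈ W
        · simp only [hx hxW]
        · simp [hdφ0 x hxW]
      have i1 : IntegrableOn (fun x => inner ℝ (v.2 x) e * φ x) Ω :=
        ((Lp.memLp v.2).inner_const e).integrable_mul
          (hφ.continuous.memLp_of_hasCompactSupport hc : MemLp φ 2 (volume.restrict Ω))
      have i2 : Integrable (fun x => fderiv ℝ P x e * φ x) := by
        refine Continuous.integrable_of_hasCompactSupport ?_ hc.mul_left
        exact ((hP.continuous_fderiv (by simp)).clm_apply continuous_const).mul hφ.continuous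
      rw [← setIntegral_eq_integral_of_forall_compl_eq_zero (s := Ω)
        (fun x hx => by rw [hφ0 x fun h' => hx (hWΩ h'), zero_smul])]
      have e4 : ∫ x in Ω, fderiv ℝ P x e * φ x = ∫ x, fderiv ℝ P x e * φ x :=
        setIntegral_eq_integral_of_forall_compl_eq_zero
          (fun x hx => by rw [hφ0 x fun h' => hx (hWΩ h'), mul_zero])
      have e5 : ∫ x in Ω, φ x • (inner ℝ (v.2 x) e - gradient P x k) =
          (∫ x in Ω, inner ℝ (v.2 x) e * φ x) - ∫ x in Ω, fderiv ℝ P x e * φ x := by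
        rw [← integral_sub i1 i2.integrableOn]
        congr 1
        ext x
        rw [gradient_apply, smul_eq_mul]
        ring
      rw [e5, e4]
      linarith
  have := ae_restrict_of_ae (s := Ω) (ae_all_iff.2 key)
  filter_upwards [this] with x hx hxW
  ext k
  have h1 := hx k hxW
  rw [EuclideanSpace.inner_single_right] at h1
  simp only [conj_trivial, one_mul] at h1
  linarith

end PiecewisePolynomials

/-! ### Continuous representatives of discrete velocities, and finite dimensionality. -/

section Velocities

variable {d : ℕ} {Ω : Set (E d)} {T : Geometry.SimplicialComplex ℝ (E d)} {k m : ℕ}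

namespace FESpaces

variable (F : FESpaces Ω T k m)

/-- The continuous representative of a component of a discrete velocity. -/
def vel (v : F.Xh) (i : Fin d) : E d → ℝ := (F.velocity v.1 v.2 i).choose

variable {F}

lemma vel_continuous (v : F.Xh) (i : Fin d) : Continuous (F.vel v i) :=
  (F.velocity v.1 v.2 i).choose_spec.1

lemma vel_zero (v : F.Xh) (i : Fin d) {x : E d} (hx : x ∉ Ω) : F.vel v i x = 0 :=
  (F.velocity v.1 v.2 i).choose_spec.2.1 x hx

lemma vel_poly (v : F.Xh) (i : Fin d) : IsPiecewisePoly T k (F.vel v i) :=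
  (F.velocity v.1 v.2 i).choose_spec.2.2.1

lemma vel_ae (v : F.Xh) (i : Fin d) : comp v.1 i =ᵐ[volume.restrict Ω] F.vel v i :=
  (F.velocity v.1 v.2 i).choose_spec.2.2.2

/-- Continuous functions that agree almost everywhere on an open set agree on it. This uniqueness
makes the chosen representatives depend linearly on v. -/
lemma vel_unique (hΩo : IsOpen Ω) (v : F.Xh) (i : Fin d) {p : E d → ℝ} (hp : Continuous p)
    (hp0 : ∀ x ∉ Ω, p x = 0) (h : comp v.1 i =ᵐ[volume.restrict Ω] p) : F.vel v i = p := by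
  have h1 := Measure.eqOn_open_of_ae_eq ((vel_ae v i).symm.trans h) hΩo
    (vel_continuous v i).continuousOn hp.continuousOn
  ext x
  by_cases hx : x ∈ Ω
  · exact h1 hx
  · rw [vel_zero v i hx, hp0 x hx]

lemma comp_add_ae (v w : VelocitySpace Ω) (i : Fin d) :
    comp (v + w) i =ᵐ[volume.restrict Ω] fun x => comp v i x + comp w i x :=
  Lp.coeFn_add (v i).1.1 (w i).1.1

lemma comp_smul_ae (c : ℝ) (v : VelocitySpace Ω) (i : Fin d) :
    comp (c • v) i =ᵐ[volume.restrict Ω] fun x => c * comp v i x :=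
  Lp.coeFn_smul c (v i).1.1

/-- The representatives depend linearly on the velocity. -/
def velLinear (hΩo : IsOpen Ω) : F.Xh →ₗ[ℝ] Fin d → E d → ℝ where
  toFun v i := F.vel v i
  map_add' v w := by
    ext1 i
    refine vel_unique hΩo _ i ((vel_continuous v i).add (vel_continuous w i)) (fun x hx => ?_) ?_
    · simp only [Pi.add_apply, vel_zero v i hx, vel_zero w i hx, add_zero]
    · refine (comp_add_ae v.1 w.1 i).trans ?_
      filter_upwards [vel_ae v i, vel_ae w i] with x h1 h2
      simp only [Pi.add_apply, h1, h2]
  map_smul' c v := by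
    ext1 i
    refine vel_unique hΩo _ i ((vel_continuous v i).const_smul c) (fun x hx => ?_) ?_
    · simp only [Pi.smul_apply, vel_zero v i hx, smul_zero]
    · refine (comp_smul_ae c v.1 i).trans ?_
      filter_upwards [vel_ae v i] with x h1
      simp only [Pi.smul_apply, h1, smul_eq_mul, RingHom.id_apply]

/-- The recorded gradient is tied to the function only through the closure in H¹; on each open
element, where the function is a polynomial, it is the classical one. -/
lemma grad_ae (hT : IsMesh Ω T) (v : F.Xh) :
    ∀ᵐ x ∂(volume.restrict Ω), ∀ i, (v.1 i).1.2 x = gradient (F.vel v i) x := by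
  rw [ae_all_iff]
  intro i
  have h : ∀ K ∈ elements T, ∀ᵐ x ∂(volume.restrict Ω), x ∈ interior K →
      (v.1 i).1.2 x = gradient (F.vel v i) x := by
    intro K hK
    obtain ⟨p, -, h1, h2⟩ := (vel_poly v i).eventuallyEq hK
    have := weak_gradient_ae_eq (v.1 i).2 (isOpen_interior (s := K))
      ((interior_subset_openUnion hK).trans hT.openUnion_subset) (contDiff_polyFun p) (by
        filter_upwards [vel_ae v i] with x hx hxK
        rw [← h1 x hxK, ← hx]
        rfl)
    filter_upwards [this] with x hx hxK
    rw [hx hxK, gradient, gradient, (h2 x hxK).fderiv_eq]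
  filter_upwards [(ae_ball_iff hT.finite_elements.countable).2 h, hT.ae_mem] with x hx hxU
  obtain ⟨K, hK, hxK⟩ := mem_openUnion.1 hxU
  exact hx K hK hxK

lemma memLp_top_comp (hT : IsMesh Ω T) (v : F.Xh) (i : Fin d) :
    MemLp (comp v.1 i) ∞ (volume.restrict Ω) :=
  ((vel_poly v i).memLp_top hT).ae_eq (vel_ae v i).symm

lemma memLp_top_grad (hT : IsMesh Ω T) (v : F.Xh) (i j : Fin d) :
    MemLp (fun x => grad v.1 x i j) ∞ (volume.restrict Ω) := by
  refine ((vel_poly v i).memLp_top_gradient hT j).ae_eq ?_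
  filter_upwards [grad_ae hT v] with x hx
  rw [← hx i]
  rfl

lemma div_ae (v : VelocitySpace Ω) :
    ∀ᵐ x ∂(volume.restrict Ω), div v x = ∑ i, grad v x i i := by
  have h1 : ∀ᵐ x ∂(volume.restrict Ω), ∀ i, (EuclideanSpace.proj (𝕜 := ℝ) i :
      E d →L[ℝ] ℝ).compLpL 2 (volume.restrict Ω) (v i).1.2 x = (v i).1.2 x i := by
    rw [ae_all_iff]
    exact fun i => ContinuousLinearMap.coeFn_compLpL _ _
  have h2 : (div v : E d → ℝ) =ᵐ[volume.restrict Ω] ∑ i, ((EuclideanSpace.proj (𝕜 := ℝ) i :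
      E d →L[ℝ] ℝ).compLpL 2 (volume.restrict Ω) (v i).1.2 : E d → ℝ) := by
    rw [div]
    exact Lp.coeFn_finsetSum _ _
  filter_upwards [h1, h2] with x hx hx2
  rw [hx2, Finset.sum_apply]
  exact Finset.sum_congr rfl fun i _ => hx i

lemma memLp_top_div (hT : IsMesh Ω T) (v : F.Xh) :
    MemLp (fun x => div v.1 x) ∞ (volume.restrict Ω) := by
  refine (memLp_finsetSum (μ := volume.restrict Ω) (p := ∞) Finset.univ
    fun i _ => memLp_top_grad hT v i i).ae_eq ?_
  filter_upwards [div_ae v.1] with x hx using hx.symm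

lemma norm_le_sum_abs (v : E d) : ‖v‖ ≤ ∑ i, |v i| := by
  conv_lhs => rw [← sum_coord_smul_single v]
  refine (norm_sum_le _ _).trans (Finset.sum_le_sum fun i _ => ?_)
  rw [norm_smul]
  simp

/-- The continuous representative of a discrete velocity as a vector field. -/
def velField (v : F.Xh) (x : E d) : E d := WithLp.toLp 2 fun i => F.vel v i x

/-- The extension by zero has a bounded weak gradient on all of ℝ^d, so no convexity or regularity
of Ω is needed for a global Lipschitz bound. -/
lemma exists_lipschitz_velField (hT : IsMesh Ω T) (hΩb : Bornology.IsBounded Ω) (v : F.Xh) :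
    ∃ L : ℝ, 0 ≤ L ∧ ∀ x y, ‖F.velField v x - F.velField v y‖ ≤ L * ‖x - y‖ := by
  have h : ∀ i, ∃ L : ℝ, 0 ≤ L ∧ ∀ x y, |F.vel v i x - F.vel v i y| ≤ L * ‖x - y‖ := by
    intro i
    obtain ⟨B, hB0, hB⟩ := (vel_poly v i).exists_bound hT
    obtain ⟨B', hB'⟩ := (hΩb.isCompact_closure).exists_bound_of_continuousOn
      (vel_continuous v i).continuousOn
    refine ⟨B, hB0, abs_sub_le_of_weak_gradient (Ω := Ω) (vel_continuous v i) (B := max B' 0)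
      (fun x => ?_) (fun x hx => vel_zero v i hx) (g := (v.1 i).1.2) hB0 ?_ ?_⟩
    · by_cases hx : x ∈ Ω
      · exact (hB' x (subset_closure hx)).trans (le_max_left _ _)
      · rw [vel_zero v i hx, abs_zero]; exact le_max_right _ _
    · filter_upwards [grad_ae hT v, hT.ae_mem] with x hx hxU
      rw [hx i, norm_gradient]
      exact (hB x hxU).2
    · intro ψ hψ hc e
      rw [← H10_weak_gradient (v.1 i).2 hψ hc e]
      refine integral_congr_ae ?_
      filter_upwards [vel_ae v i] with x hx
      rw [← hx]
      rfl
  choose L hL0 hL using h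
  refine ⟨∑ i, L i, Finset.sum_nonneg fun i _ => hL0 i, fun x y => ?_⟩
  refine (norm_le_sum_abs _).trans ?_
  rw [Finset.sum_mul]
  exact Finset.sum_le_sum fun i _ => hL i x y

/-- In H¹₀(Ω) the gradient component of a pair is determined by the function component, so
injectivity may be tested on the latter. -/
lemma eq_zero_of_comp_ae (hΩo : IsOpen Ω) (v : VelocitySpace Ω)
    (h : ∀ i, comp v i =ᵐ[volume.restrict Ω] 0) : v = 0 := by
  ext1 i
  have h1 : (v i).1.1 = 0 := Lp.ext ((h i).trans (Lp.coeFn_zero _ _ _).symm)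
  have h2 := weak_gradient_ae_eq (v i).2 hΩo subset_rfl (P := fun _ => 0) contDiff_const (by
    filter_upwards [h i] with x hx _ using hx)
  have h3 : (v i).1.2 = 0 := by
    refine Lp.ext (EventuallyEq.trans ?_ (Lp.coeFn_zero _ _ _).symm)
    filter_upwards [h2, ae_restrict_mem hΩo.measurableSet] with x hx hxΩ
    rw [hx hxΩ]
    simp [gradient]
  exact Subtype.ext (Prod.ext h1 h3)

end FESpaces

/-- A space of piecewise polynomials of bounded degree is finite dimensional. -/
lemma finiteDimensional_of_piecewisePoly {W ι : Type*} [AddCommGroup W] [Module ℝ W] [Finite ι]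
    (hfin : (elements T).Finite) {n : ℕ} (Φ : W →ₗ[ℝ] ι → E d → ℝ)
    (hΦ : ∀ w i, IsPiecewisePoly T n (Φ w i))
    (hinj : ∀ w, (∀ i, ∀ x ∈ openUnion T, Φ w i x = 0) → w = 0) : FiniteDimensional ℝ W := by
  classical
  have : Finite (elements T) := hfin.to_subtype
  let A : Set (E d) → (E d → ℝ) →ₗ[ℝ] (E d → ℝ) := fun K =>
    { toFun := fun f => (interior K).indicator f
      map_add' := fun f g => indicator_add _ f g
      map_smul' := fun c f => indicator_const_smul _ c f }
  let Q : MvPolynomial.restrictTotalDegree (Fin d) ℝ n →ₗ[ℝ] (E d → ℝ) :=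
    { toFun := fun p => polyFun p.1
      map_add' := fun p q => polyFun_add _ _
      map_smul' := fun c p => polyFun_smul _ _ }
  -- Restriction to the open elements embeds W in a finite product of images of polynomial spaces of
  -- bounded degree.
  let Ψ : W →ₗ[ℝ] ∀ q : elements T × ι, LinearMap.range ((A q.1.1).comp Q) :=
    LinearMap.pi fun q => LinearMap.codRestrict _ ((A q.1.1).comp ((LinearMap.proj q.2).comp Φ))
      (by
        intro w
        obtain ⟨p, hp, h⟩ := hΦ w q.2 q.1.1 q.1.2
        refine ⟨⟨p, (MvPolynomial.mem_restrictTotalDegree _ _ _).2 hp⟩, ?_⟩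
        ext x
        by_cases hx : x ∈ interior q.1.1
        · simp only [A, Q, LinearMap.comp_apply, LinearMap.coe_mk, AddHom.coe_mk,
            indicator_of_mem hx, LinearMap.proj_apply]
          exact (h x hx).symm
        · simp only [A, Q, LinearMap.comp_apply, LinearMap.coe_mk, AddHom.coe_mk,
            indicator_of_notMem hx])
  refine Module.Finite.of_injective Ψ ?_
  rw [← LinearMap.ker_eq_bot, LinearMap.ker_eq_bot']
  intro w hw
  refine hinj w fun i x hx => ?_
  obtain ⟨K, hK, hxK⟩ := mem_openUnion.1 hx
  have h1 := congrArg Subtype.val (congrFun hw (⟨K, hK⟩, i))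
  have h2 := congrFun h1 x
  simpa [Ψ, A, indicator_of_mem hxK] using h2

namespace FESpaces

variable {F : FESpaces Ω T k m}

lemma finiteDimensional_Xh (hΩo : IsOpen Ω) (hT : IsMesh Ω T) : FiniteDimensional ℝ F.Xh := by
  refine finiteDimensional_of_piecewisePoly hT.finite_elements (velLinear hΩo)
    (fun v i => vel_poly v i) fun v hv => ?_
  refine Subtype.ext (eq_zero_of_comp_ae hΩo v.1 fun i => (vel_ae v i).trans ?_)
  filter_upwards [hT.ae_mem] with x hx using hv i x hx

lemma finiteDimensional_Vh (hΩo : IsOpen Ω) (hT : IsMesh Ω T) : FiniteDimensional ℝ F.Vh := by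
  have := finiteDimensional_Xh (F := F) hΩo hT
  have hle : F.Vh ≤ F.Xh := fun v hv => hv.1
  exact Submodule.finiteDimensional_of_le hle

/-- The normalization on the skeleton turns vanishing on the open elements into equality of
functions; without it (·,·) would not be definite on Σ_h. -/
lemma stress_eq_zero {τ : F.Sh} (h : ∀ i j, ∀ x ∈ openUnion T, τ.1 x i j = 0) : τ = 0 := by
  refine Subtype.ext (funext fun x => ?_)
  by_cases hx : x ∈ openUnion T
  · ext i j; exact h i j x hx
  · exact F.stress_zero τ.1 τ.2 x fun K hK hxK => hx (interior_subset_openUnion hK hxK)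

lemma stress_zero_of_notMem (τ : F.Sh) {x : E d} (hx : x ∉ openUnion T) : τ.1 x = 0 :=
  F.stress_zero τ.1 τ.2 x fun _ hK hxK => hx (interior_subset_openUnion hK hxK)

lemma finiteDimensional_Sh (hT : IsMesh Ω T) : FiniteDimensional ℝ F.Sh := by
  refine finiteDimensional_of_piecewisePoly (ι := Fin d × Fin d) hT.finite_elements
    (Φ := { toFun := fun τ ij x => τ.1 x ij.1 ij.2
            map_add' := fun σ τ => rfl
            map_smul' := fun c σ => rfl })
    (fun τ ij => F.stress_poly τ.1 τ.2 ij.1 ij.2) fun τ hτ => ?_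
  exact stress_eq_zero fun i j x hx => hτ (i, j) x hx

end FESpaces

end Velocities

/-! ### Tensor fields with bounded entries and their pairings. -/

section Forms

variable {d : ℕ} {Ω : Set (E d)} {A A' B : TensorField d}

/-- Tensor fields with essentially bounded entries. -/
def BddField (Ω : Set (E d)) (A : TensorField d) : Prop :=
  ∀ i j, MemLp (fun x => A x i j) ∞ (volume.restrict Ω)

lemma memLp_top_mul {f g : E d → ℝ} (hf : MemLp f ∞ (volume.restrict Ω))
    (hg : MemLp g ∞ (volume.restrict Ω)) : MemLp (fun x => f x * g x) ∞ (volume.restrict Ω) :=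
  hg.mul (p := (⊤ : ℝ≥0∞)) (q := (⊤ : ℝ≥0∞)) (r := (⊤ : ℝ≥0∞)) hf

lemma integrable_of_memLp_top (hΩb : Bornology.IsBounded Ω) {f : E d → ℝ}
    (hf : MemLp f ∞ (volume.restrict Ω)) : IntegrableOn f Ω := by
  have : Fact (volume Ω < ⊤) := ⟨hΩb.measure_lt_top⟩
  exact hf.integrable le_top

lemma BddField.integrable_ip (hΩb : Bornology.IsBounded Ω) (hA : BddField Ω A)
    (hB : BddField Ω B) : IntegrableOn (fun x => ∑ i, ∑ j, A x i j * B x i j) Ω :=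
  integrable_finsetSum _ fun i _ => integrable_finsetSum _ fun j _ =>
    integrable_of_memLp_top hΩb (memLp_top_mul (hA i j) (hB i j))

lemma BddField.add (hA : BddField Ω A) (hB : BddField Ω B) :
    BddField Ω (fun x => A x + B x) := fun i j => (hA i j).add (hB i j)

lemma BddField.sub (hA : BddField Ω A) (hB : BddField Ω B) :
    BddField Ω (fun x => A x - B x) := fun i j => (hA i j).sub (hB i j)

lemma BddField.smul (hA : BddField Ω A) {f : E d → ℝ} (hf : MemLp f ∞ (volume.restrict Ω)) :
    BddField Ω (fun x => f x • A x) := fun i j => memLp_top_mul hf (hA i j)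

lemma BddField.transpose (hA : BddField Ω A) : BddField Ω (fun x => (A x).transpose) :=
  fun i j => hA j i

lemma BddField.mul (hA : BddField Ω A) (hB : BddField Ω B) :
    BddField Ω (fun x => A x * B x) := fun i j => by
  simp only [Matrix.mul_apply]
  exact memLp_finsetSum _ fun l _ => memLp_top_mul (hA i l) (hB l j)

lemma ip_comm (Ω : Set (E d)) (A B : TensorField d) : ip Ω A B = ip Ω B A := by
  simp only [ip, mul_comm]

lemma ip_congr_left (h : A =ᵐ[volume.restrict Ω] A') : ip Ω A B = ip Ω A' B :=
  integral_congr_ae (by filter_upwards [h] with x hx using by rw [hx])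

lemma ip_add_left (hΩb : Bornology.IsBounded Ω) (hA : BddField Ω A) (hA' : BddField Ω A')
    (hB : BddField Ω B) : ip Ω (fun x => A x + A' x) B = ip Ω A B + ip Ω A' B := by
  rw [ip, ip, ip, ← integral_add (hA.integrable_ip hΩb hB) (hA'.integrable_ip hΩb hB)]
  congr 1
  ext x
  simp only [Matrix.add_apply, add_mul, Finset.sum_add_distrib]

lemma ip_smul_left (c : ℝ) : ip Ω (fun x => c • A x) B = c * ip Ω A B := by
  rw [ip, ip, ← integral_const_mul]
  congr 1
  ext x
  simp only [Matrix.smul_apply, smul_eq_mul, mul_assoc, Finset.mul_sum]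

lemma ip_sub_left (hΩb : Bornology.IsBounded Ω) (hA : BddField Ω A) (hA' : BddField Ω A')
    (hB : BddField Ω B) : ip Ω (fun x => A x - A' x) B = ip Ω A B - ip Ω A' B := by
  rw [ip, ip, ip, ← integral_sub (hA.integrable_ip hΩb hB) (hA'.integrable_ip hΩb hB)]
  congr 1
  ext x
  simp only [Matrix.sub_apply, sub_mul, Finset.sum_sub_distrib]

lemma ip_self_nonneg (Ω : Set (E d)) (A : TensorField d) : 0 ≤ ip Ω A A :=
  integral_nonneg fun _ => Finset.sum_nonneg fun _ _ => Finset.sum_nonneg fun _ _ =>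
    mul_self_nonneg _

lemma l2norm_sq (Ω : Set (E d)) (A : TensorField d) : l2norm Ω A ^ 2 = ip Ω A A :=
  Real.sq_sqrt (ip_self_nonneg _ _)

lemma ae_eq_zero_of_ip_self (hΩb : Bornology.IsBounded Ω) (hA : BddField Ω A)
    (h : ip Ω A A = 0) : ∀ᵐ x ∂(volume.restrict Ω), ∀ i j, A x i j = 0 := by
  have h1 := (integral_eq_zero_iff_of_nonneg (fun x => Finset.sum_nonneg fun i _ =>
    Finset.sum_nonneg fun j _ => mul_self_nonneg (A x i j)) (hA.integrable_ip hΩb hA)).1 h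
  filter_upwards [h1] with x hx i j
  have h2 := (Finset.sum_eq_zero_iff_of_nonneg fun i _ =>
    Finset.sum_nonneg fun j _ => mul_self_nonneg (A x i j)).1 hx i (Finset.mem_univ i)
  have h3 := (Finset.sum_eq_zero_iff_of_nonneg fun j _ =>
    mul_self_nonneg (A x i j)).1 h2 j (Finset.mem_univ j)
  exact mul_self_eq_zero.1 h3

/-- The field `(u·∇)σ + ½ (∇·u) σ - ∇u σ - σ ∇uᵀ`. -/
def transportField (u : VelocitySpace Ω) (σ : TensorField d) : TensorField d := fun x =>
  conv u σ x + (1 / 2 : ℝ) • (div u x • σ x) - grad u x * σ x - σ x * (grad u x).transpose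

lemma grad_add_ae (v w : VelocitySpace Ω) :
    ∀ᵐ x ∂(volume.restrict Ω), grad (v + w) x = grad v x + grad w x := by
  have h : ∀ᵐ x ∂(volume.restrict Ω), ∀ i, ((v + w) i).1.2 x = (v i).1.2 x + (w i).1.2 x := by
    rw [ae_all_iff]
    exact fun i => Lp.coeFn_add (v i).1.2 (w i).1.2
  filter_upwards [h] with x hx
  ext i j
  simp only [grad, Matrix.of_apply, Matrix.add_apply, hx i, PiLp.add_apply]

lemma grad_smul_ae (c : ℝ) (v : VelocitySpace Ω) :
    ∀ᵐ x ∂(volume.restrict Ω), grad (c • v) x = c • grad v x := by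
  have h : ∀ᵐ x ∂(volume.restrict Ω), ∀ i, ((c • v) i).1.2 x = c • (v i).1.2 x := by
    rw [ae_all_iff]
    exact fun i => Lp.coeFn_smul c (v i).1.2
  filter_upwards [h] with x hx
  ext i j
  simp only [grad, Matrix.of_apply, Matrix.smul_apply, hx i, PiLp.smul_apply]

lemma symGrad_add_ae (v w : VelocitySpace Ω) :
    symGrad (v + w) =ᵐ[volume.restrict Ω] fun x => symGrad v x + symGrad w x := by
  filter_upwards [grad_add_ae v w] with x hx
  simp only [symGrad, hx, Matrix.transpose_add]
  module

lemma symGrad_smul_ae (c : ℝ) (v : VelocitySpace Ω) :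
    symGrad (c • v) =ᵐ[volume.restrict Ω] fun x => c • symGrad v x := by
  filter_upwards [grad_smul_ae c v] with x hx
  simp only [symGrad, hx, Matrix.transpose_smul]
  module

lemma transportField_add_left_ae (v w : VelocitySpace Ω) (σ : TensorField d) :
    transportField (v + w) σ =ᵐ[volume.restrict Ω]
      fun x => transportField v σ x + transportField w σ x := by
  have h : ∀ᵐ x ∂(volume.restrict Ω), ∀ i, comp (v + w) i x = comp v i x + comp w i x := by
    rw [ae_all_iff]; exact fun i => FESpaces.comp_add_ae v w i
  filter_upwards [grad_add_ae v w, h, FESpaces.div_ae v, FESpaces.div_ae w,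
    FESpaces.div_ae (v + w)] with x hg hc d1 d2 d3
  have hd : div (v + w) x = div v x + div w x := by
    rw [d1, d2, d3, ← Finset.sum_add_distrib]
    simp only [hg, Matrix.add_apply]
  have hconv : conv (v + w) σ x = conv v σ x + conv w σ x := by
    ext i j
    simp only [conv, Matrix.of_apply, Matrix.add_apply, hc, add_mul, Finset.sum_add_distrib]
  simp only [transportField, hd, hconv, hg, Matrix.transpose_add, add_mul, mul_add]
  module

lemma transportField_smul_left_ae (c : ℝ) (v : VelocitySpace Ω) (σ : TensorField d) :
    transportField (c • v) σ =ᵐ[volume.restrict Ω] fun x => c • transportField v σ x := by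
  have h : ∀ᵐ x ∂(volume.restrict Ω), ∀ i, comp (c • v) i x = c * comp v i x := by
    rw [ae_all_iff]; exact fun i => FESpaces.comp_smul_ae c v i
  filter_upwards [grad_smul_ae c v, h, FESpaces.div_ae v, FESpaces.div_ae (c • v)]
    with x hg hc d1 d3
  have hd : div (c • v) x = c * div v x := by
    rw [d1, d3, Finset.mul_sum]
    simp only [hg, Matrix.smul_apply, smul_eq_mul]
  have hconv : conv (c • v) σ x = c • conv v σ x := by
    ext i j
    simp only [conv, Matrix.of_apply, Matrix.smul_apply, hc, smul_eq_mul, Finset.mul_sum,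
      mul_assoc]
  simp only [transportField, hd, hconv, hg, Matrix.transpose_smul, Matrix.smul_mul,
    Matrix.mul_smul, mul_smul]
  module

end Forms

/-! ### The forms as multilinear maps on the discrete spaces, and their definiteness. -/

namespace FESpaces

variable {d : ℕ} {Ω : Set (E d)} {T : Geometry.SimplicialComplex ℝ (E d)} {k m : ℕ}
  {F : FESpaces Ω T k m}

lemma bddField_grad (hT : IsMesh Ω T) (v : F.Xh) : BddField Ω (grad v.1) := memLp_top_grad hT v

lemma bddField_symGrad (hT : IsMesh Ω T) (v : F.Xh) : BddField Ω (symGrad v.1) :=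
  ((bddField_grad hT v).add (bddField_grad hT v).transpose).smul (f := fun _ => 1 / 2)
    (memLp_top_const _)

lemma bddField_stress (hT : IsMesh Ω T) (τ : F.Sh) : BddField Ω τ.1 := fun i j =>
  (F.stress_poly τ.1 τ.2 i j).memLp_top hT

lemma bddField_conv (hT : IsMesh Ω T) (v : F.Xh) (τ : F.Sh) : BddField Ω (conv v.1 τ.1) :=
  fun i j => by
  simp only [conv, Matrix.of_apply]
  exact memLp_finsetSum _ fun l _ => memLp_top_mul (memLp_top_comp hT v l)
    ((F.stress_poly τ.1 τ.2 i j).memLp_top_gradient hT l)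

lemma bddField_div_smul (hT : IsMesh Ω T) (v : F.Xh) (τ : F.Sh) :
    BddField Ω (fun x => div v.1 x • τ.1 x) := (bddField_stress hT τ).smul (memLp_top_div hT v)

lemma bddField_transportField (hT : IsMesh Ω T) (v : F.Xh) (τ : F.Sh) :
    BddField Ω (transportField v.1 τ.1) :=
  ((((bddField_conv hT v τ).add ((bddField_div_smul hT v τ).smul (f := fun _ => 1 / 2)
    (memLp_top_const _))).sub ((bddField_grad hT v).mul (bddField_stress hT τ))).sub
    ((bddField_stress hT τ).mul (bddField_grad hT v).transpose))

/-- All fields are bounded on a bounded set, so the integrals may be merged. Linearity and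
continuity of c are then read off pointwise from one field. -/
lemma upperConv_eq (hΩb : Bornology.IsBounded Ω) (hT : IsMesh Ω T) (v : F.Xh) (σ τ : F.Sh) :
    upperConv v.1 σ.1 τ.1 = ip Ω (transportField v.1 σ.1) τ.1 := by
  have h1 := bddField_conv hT v σ
  have h2 := (bddField_div_smul hT v σ).smul (f := fun _ => 1 / 2) (memLp_top_const _)
  have h3 := (bddField_grad hT v).mul (bddField_stress hT σ)
  have h4 := (bddField_stress hT σ).mul (bddField_grad hT v).transpose
  have hτ := bddField_stress hT τ
  have e : ip Ω (transportField v.1 σ.1) τ.1 = _ := ip_sub_left hΩb ((h1.add h2).sub h3) h4 hτ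
  rw [e, ip_sub_left hΩb (h1.add h2) h3 hτ, ip_add_left hΩb h1 h2 hτ, ip_smul_left, upperConv, b]

/-- The gradients of stresses here are classical, and additivity uses differentiability of the
entries, hence the restriction to the open elements. -/
lemma transportField_add_right_ae (hT : IsMesh Ω T) (v : VelocitySpace Ω) (σ σ' : F.Sh) :
    transportField v (σ + σ').1 =ᵐ[volume.restrict Ω]
      fun x => transportField v σ.1 x + transportField v σ'.1 x := by
  filter_upwards [hT.ae_mem] with x hx
  have hconv : conv v (σ + σ').1 x = conv v σ.1 x + conv v σ'.1 x := by
    ext i j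
    simp only [conv, Matrix.of_apply, Matrix.add_apply, ← Finset.sum_add_distrib, ← mul_add,
      gradient_apply]
    refine Finset.sum_congr rfl fun l _ => ?_
    congr 1
    have := fderiv_add ((F.stress_poly σ.1 σ.2 i j).differentiableAt hx)
      ((F.stress_poly σ'.1 σ'.2 i j).differentiableAt hx)
    exact congrArg (fun L : E d →L[ℝ] ℝ => L (EuclideanSpace.single l 1)) this
  have hs : (σ + σ').1 x = σ.1 x + σ'.1 x := rfl
  simp only [transportField, hconv, hs, add_mul, mul_add]
  module

lemma transportField_smul_right_ae (hT : IsMesh Ω T) (v : VelocitySpace Ω) (c : ℝ) (σ : F.Sh) :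
    transportField v (c • σ).1 =ᵐ[volume.restrict Ω] fun x => c • transportField v σ.1 x := by
  filter_upwards [hT.ae_mem] with x hx
  have hconv : conv v (c • σ).1 x = c • conv v σ.1 x := by
    ext i j
    simp only [conv, Matrix.of_apply, Matrix.smul_apply, smul_eq_mul, Finset.mul_sum,
      gradient_apply]
    refine Finset.sum_congr rfl fun l _ => ?_
    have := fderiv_const_smul ((F.stress_poly σ.1 σ.2 i j).differentiableAt hx) c
    have h2 := congrArg (fun L : E d →L[ℝ] ℝ => L (EuclideanSpace.single l 1)) this
    have h3 : fderiv ℝ (fun y => (c • σ).1 y i j) x (EuclideanSpace.single l 1) =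
      c * fderiv ℝ (fun y => σ.1 y i j) x (EuclideanSpace.single l 1) := h2
    rw [h3]; ring
  have hs : (c • σ).1 x = c • σ.1 x := rfl
  simp only [transportField, hconv, hs, Matrix.smul_mul, Matrix.mul_smul]
  module

/-- Pairing with a bounded tensor field. -/
def pairing (hΩb : Bornology.IsBounded Ω) (hT : IsMesh Ω T) (A : TensorField d)
    (hA : BddField Ω A) : F.Sh →ₗ[ℝ] ℝ where
  toFun τ := ip Ω A τ.1
  map_add' σ τ := by
    rw [ip_comm, ip_comm Ω A, ip_comm Ω A]
    exact ip_add_left hΩb (bddField_stress hT σ) (bddField_stress hT τ) hA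
  map_smul' c τ := by
    rw [ip_comm, ip_comm Ω A]
    exact ip_smul_left c

variable (F) in
/-- A discretely divergence free velocity as an element of `X_h`. -/
def incl : F.Vh →ₗ[ℝ] F.Xh := Submodule.inclusion (p := F.Vh) (p' := F.Xh) fun _ hv => hv.1

/-- The form `(σ, τ)` on `Σ_h`. -/
def formS (hΩb : Bornology.IsBounded Ω) (hT : IsMesh Ω T) : F.Sh →ₗ[ℝ] F.Sh →ₗ[ℝ] ℝ where
  toFun σ := pairing hΩb hT σ.1 (bddField_stress hT σ)
  map_add' σ σ' := LinearMap.ext fun τ =>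
    ip_add_left hΩb (bddField_stress hT σ) (bddField_stress hT σ') (bddField_stress hT τ)
  map_smul' c _ := LinearMap.ext fun _ => ip_smul_left c

/-- The form `(𝔻 v, τ)` on `V_h × Σ_h`. -/
def formVS (hΩb : Bornology.IsBounded Ω) (hT : IsMesh Ω T) : F.Vh →ₗ[ℝ] F.Sh →ₗ[ℝ] ℝ where
  toFun v := pairing hΩb hT (symGrad v.1) (bddField_symGrad hT (F.incl v))
  map_add' v w := LinearMap.ext fun τ => (ip_congr_left (symGrad_add_ae v.1 w.1)).trans
    (ip_add_left hΩb (bddField_symGrad hT (F.incl v)) (bddField_symGrad hT (F.incl w))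
      (bddField_stress hT τ))
  map_smul' c v := LinearMap.ext fun _ => (ip_congr_left (symGrad_smul_ae c v.1)).trans
    (ip_smul_left c)

lemma ip_symGrad_add_left (hΩb : Bornology.IsBounded Ω) (hT : IsMesh Ω T) (v v' w : F.Vh) :
    ip Ω (symGrad (v + v').1) (symGrad w.1) =
      ip Ω (symGrad v.1) (symGrad w.1) + ip Ω (symGrad v'.1) (symGrad w.1) :=
  (ip_congr_left (symGrad_add_ae v.1 v'.1)).trans
    (ip_add_left hΩb (bddField_symGrad hT (F.incl v)) (bddField_symGrad hT (F.incl v'))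
      (bddField_symGrad hT (F.incl w)))

lemma ip_symGrad_smul_left (c : ℝ) (v w : F.Vh) :
    ip Ω (symGrad (c • v).1) (symGrad w.1) = c • ip Ω (symGrad v.1) (symGrad w.1) :=
  (ip_congr_left (symGrad_smul_ae c v.1)).trans (ip_smul_left c)

/-- Pairing of symmetric gradients. -/
def pairingV (hΩb : Bornology.IsBounded Ω) (hT : IsMesh Ω T) (v : F.Vh) : F.Vh →ₗ[ℝ] ℝ where
  toFun w := ip Ω (symGrad v.1) (symGrad w.1)
  map_add' w w' := by
    rw [ip_comm, ip_symGrad_add_left hΩb hT w w' v, ip_comm Ω (symGrad v.1),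
      ip_comm Ω (symGrad v.1)]
  map_smul' c w := (ip_comm _ _ _).trans ((ip_symGrad_smul_left c w v).trans
    (congrArg (c • ·) (ip_comm _ _ _)))

/-- The form `(𝔻 v, 𝔻 w)` on `V_h`. -/
def formV (hΩb : Bornology.IsBounded Ω) (hT : IsMesh Ω T) : F.Vh →ₗ[ℝ] F.Vh →ₗ[ℝ] ℝ where
  toFun v := pairingV hΩb hT v
  map_add' v v' := LinearMap.ext fun w => ip_symGrad_add_left hΩb hT v v' w
  map_smul' c v := LinearMap.ext fun w => ip_symGrad_smul_left c v w

/-- The form `c` on `V_h × Σ_h × Σ_h`. -/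
def formC (hΩb : Bornology.IsBounded Ω) (hT : IsMesh Ω T) :
    F.Vh →ₗ[ℝ] F.Sh →ₗ[ℝ] F.Sh →ₗ[ℝ] ℝ :=
  have hN : ∀ (v : F.Vh) (σ : F.Sh), BddField Ω (transportField v.1 σ.1) := fun v σ =>
    bddField_transportField hT (F.incl v) σ
  LinearMap.mk₂ ℝ (fun v σ => pairing hΩb hT (transportField v.1 σ.1) (hN v σ))
    (fun v v' σ => LinearMap.ext fun τ =>
      (ip_congr_left (transportField_add_left_ae v.1 v'.1 σ.1)).trans
        (ip_add_left hΩb (hN v σ) (hN v' σ) (bddField_stress hT τ)))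
    (fun c v σ => LinearMap.ext fun _ =>
      (ip_congr_left (transportField_smul_left_ae c v.1 σ.1)).trans (ip_smul_left c))
    (fun v σ σ' => LinearMap.ext fun τ =>
      (ip_congr_left (transportField_add_right_ae hT v.1 σ σ')).trans
        (ip_add_left hΩb (hN v σ) (hN v σ') (bddField_stress hT τ)))
    (fun c v σ => LinearMap.ext fun _ =>
      (ip_congr_left (transportField_smul_right_ae hT v.1 c σ)).trans (ip_smul_left c))

lemma formC_apply (hΩb : Bornology.IsBounded Ω) (hT : IsMesh Ω T) (v : F.Vh) (σ τ : F.Sh) :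
    formC hΩb hT v σ τ = upperConv v.1 σ.1 τ.1 :=
  (upperConv_eq hΩb hT (F.incl v) σ τ).symm

/-- A stress of norm zero vanishes almost everywhere, hence everywhere on the open elements by
continuity, and on the skeleton by normalization. -/
lemma formS_pos (hΩb : Bornology.IsBounded Ω) (hT : IsMesh Ω T) (σ : F.Sh) (hσ : σ ≠ 0) :
    0 < ip Ω σ.1 σ.1 := by
  refine lt_of_le_of_ne (ip_self_nonneg _ _) fun h => hσ (stress_eq_zero fun i j => ?_)
  have h1 := ae_eq_zero_of_ip_self hΩb (bddField_stress hT σ) h.symm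
  rw [hT.restrict_eq] at h1
  refine Measure.eqOn_open_of_ae_eq (f := fun x => σ.1 x i j) (g := fun _ => 0)
    (by filter_upwards [h1] with x hx using hx i j) isOpen_openUnion
    (fun x hx => ((F.stress_poly σ.1 σ.2 i j).continuousAt hx).continuousWithinAt)
    continuousOn_const

/-- Korn's inequality controls the gradient and the Poincaré inequality the function itself. -/
lemma formV_pos (hd : d = 2 ∨ d = 3) (hΩo : IsOpen Ω) (hΩb : Bornology.IsBounded Ω) {CK : ℝ}
    (hCK : IsKornConstant Ω CK) (v : F.Vh) (hv : v ≠ 0) :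
    0 < ip Ω (symGrad v.1) (symGrad v.1) := by
  refine lt_of_le_of_ne (ip_self_nonneg _ _) fun h => hv ?_
  have h1 := hCK.2 v.1
  rw [l2norm, l2norm, ← h, Real.sqrt_zero, mul_zero] at h1
  obtain ⟨C, hC, hP⟩ := H10_poincare (Ω := Ω) hd hΩo hΩb
  refine Subtype.ext (funext fun i => ?_)
  have h2 : ‖(v.1 i).1.2‖ ≤ 0 := (norm_le_l2norm_grad v.1 i).trans h1
  have h3 : ‖(v.1 i).1.1‖ ≤ 0 := (hP _ (v.1 i).2).trans
    (mul_nonpos_of_nonneg_of_nonpos hC.le h2)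
  exact Subtype.ext (Prod.ext (norm_le_zero_iff.1 h3) (norm_le_zero_iff.1 h2))

end FESpaces

/-! ### The Frobenius norm and the L^∞ norm of tensor fields. -/

section Frobenius

variable {d : ℕ} {Ω : Set (E d)}

/-- The Frobenius norm. -/
def fro (A : Matrix (Fin d) (Fin d) ℝ) : ℝ := √(∑ i, ∑ j, A i j ^ 2)

lemma sum_sq_nonneg (A : Matrix (Fin d) (Fin d) ℝ) : 0 ≤ ∑ i, ∑ j, A i j ^ 2 :=
  Finset.sum_nonneg fun _ _ => Finset.sum_nonneg fun _ _ => sq_nonneg _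

lemma fro_nonneg (A : Matrix (Fin d) (Fin d) ℝ) : 0 ≤ fro A := Real.sqrt_nonneg _

lemma fro_sq (A : Matrix (Fin d) (Fin d) ℝ) : fro A ^ 2 = ∑ i, ∑ j, A i j ^ 2 :=
  Real.sq_sqrt (sum_sq_nonneg A)

lemma fro_transpose (A : Matrix (Fin d) (Fin d) ℝ) : fro A.transpose = fro A := by
  rw [fro, fro, Finset.sum_comm]
  rfl

lemma abs_sum_mul_le_fro (A B : Matrix (Fin d) (Fin d) ℝ) :
    |∑ i, ∑ j, A i j * B i j| ≤ fro A * fro B := by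
  refine abs_le_of_sq_le_sq ?_ (mul_nonneg (fro_nonneg _) (fro_nonneg _))
  rw [mul_pow, fro_sq, fro_sq]
  simp only [← Fintype.sum_prod_type']
  exact Finset.sum_mul_sq_le_sq_mul_sq _ _ _

lemma fro_add_le (A B : Matrix (Fin d) (Fin d) ℝ) : fro (A + B) ≤ fro A + fro B := by
  refine (sq_le_sq₀ (fro_nonneg _) (add_nonneg (fro_nonneg _) (fro_nonneg _))).1 ?_
  have h := (le_abs_self _).trans (abs_sum_mul_le_fro A B)
  rw [add_sq, fro_sq, fro_sq, fro_sq]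
  have : ∑ i, ∑ j, (A + B) i j ^ 2 = ∑ i, ∑ j, A i j ^ 2 + 2 * ∑ i, ∑ j, A i j * B i j +
      ∑ i, ∑ j, B i j ^ 2 := by
    simp only [Finset.mul_sum, ← Finset.sum_add_distrib, Matrix.add_apply]
    exact Finset.sum_congr rfl fun i _ => Finset.sum_congr rfl fun j _ => by ring
  rw [this]
  nlinarith

lemma fro_mul_le (A B : Matrix (Fin d) (Fin d) ℝ) : fro (A * B) ≤ fro A * fro B := by
  refine (sq_le_sq₀ (fro_nonneg _) (mul_nonneg (fro_nonneg _) (fro_nonneg _))).1 ?_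
  rw [mul_pow, fro_sq, fro_sq, fro_sq, Finset.sum_comm (f := fun i j => B i j ^ 2),
    Finset.sum_mul_sum]
  refine Finset.sum_le_sum fun i _ => Finset.sum_le_sum fun j _ => ?_
  rw [Matrix.mul_apply]
  exact Finset.sum_mul_sq_le_sq_mul_sq _ _ _

lemma fro_le_of_abs_le {A : Matrix (Fin d) (Fin d) ℝ} {a : ℝ} (ha : 0 ≤ a)
    (h : ∀ i j, |A i j| ≤ a) : fro A ≤ d * a := by
  refine Real.sqrt_le_iff.2 ⟨by positivity, ?_⟩
  calc ∑ i, ∑ j, A i j ^ 2 ≤ ∑ _i : Fin d, ∑ _j : Fin d, a ^ 2 :=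
        Finset.sum_le_sum fun i _ => Finset.sum_le_sum fun j _ => sq_le_sq' (abs_le.1 (h i j)).1
          (abs_le.1 (h i j)).2
    _ = (d * a) ^ 2 := by simp; ring

lemma abs_le_fro (A : Matrix (Fin d) (Fin d) ℝ) (i j : Fin d) : |A i j| ≤ fro A := by
  refine Real.abs_le_sqrt ?_
  exact (Finset.single_le_sum (f := fun j => A i j ^ 2) (fun _ _ => sq_nonneg _)
    (Finset.mem_univ j)).trans (Finset.single_le_sum (f := fun i => ∑ j, A i j ^ 2)
    (fun _ _ => Finset.sum_nonneg fun _ _ => sq_nonneg _) (Finset.mem_univ i))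

lemma BddField.memLp_fro {A : TensorField d} (hA : BddField Ω A) :
    MemLp (fun x => fro (A x)) ∞ (volume.restrict Ω) := by
  have h1 : MemLp (fun x => ∑ i, ∑ j, |A x i j|) ∞ (volume.restrict Ω) :=
    memLp_finsetSum _ fun i _ => memLp_finsetSum _ fun j _ => (hA i j).norm
  refine h1.mono ?_ (Eventually.of_forall fun x => ?_)
  · refine (AEMeasurable.sqrt ?_).aestronglyMeasurable
    exact Finset.aemeasurable_fun_sum _ fun i _ => Finset.aemeasurable_fun_sum _ fun j _ =>
      (hA i j).aestronglyMeasurable.aemeasurable.pow_const 2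
  · rw [Real.norm_of_nonneg (fro_nonneg _)]
    refine le_trans ?_ (Real.le_norm_self _)
    refine Real.sqrt_le_iff.2 ⟨by positivity, ?_⟩
    simp only [← Fintype.sum_prod_type', ← sq_abs (A x _ _)]
    exact Finset.sum_sq_le_sq_sum_of_nonneg fun _ _ => abs_nonneg _

lemma fro_le_supNorm {A : TensorField d} (hA : BddField Ω A) :
    ∀ᵐ x ∂(volume.restrict Ω), fro (A x) ≤ supNorm Ω A := by
  have hm := hA.memLp_fro
  have h2 := ae_le_eLpNormEssSup (f := fun x => fro (A x)) (μ := volume.restrict Ω)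
  filter_upwards [h2] with x hx
  have h3 := ENNReal.toReal_mono (by rw [← eLpNorm_exponent_top]; exact hm.2.ne) hx
  rw [toReal_enorm, Real.norm_of_nonneg (fro_nonneg _), ← eLpNorm_exponent_top] at h3
  exact h3

lemma supNorm_le {A : TensorField d} {C : ℝ} (hC : 0 ≤ C)
    (h : ∀ᵐ x ∂(volume.restrict Ω), fro (A x) ≤ C) : supNorm Ω A ≤ C := by
  refine ENNReal.toReal_le_of_le_ofReal hC ?_
  rw [eLpNorm_exponent_top]
  refine eLpNormEssSup_le_of_ae_bound ?_
  filter_upwards [h] with x hx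
  rw [Real.norm_of_nonneg (Real.sqrt_nonneg _)]
  exact hx

end Frobenius

/-! ### Skew-symmetry of b and the lower bound for c. -/

/-- Integration by parts for a transport term with smooth coefficients. -/
lemma integral_mul_div_of_compact {d : ℕ} {P φ : E d → ℝ} {q : Fin d → E d → ℝ}
    (hP : ContDiff ℝ ∞ P) (hq : ∀ l, ContDiff ℝ ∞ (q l)) (hφ : ContDiff ℝ ∞ φ)
    (hc : HasCompactSupport φ) :
    ∫ x, ∑ l, (P x * q l x * fderiv ℝ φ x (EuclideanSpace.single l 1) +
        P x * fderiv ℝ (q l) x (EuclideanSpace.single l 1) * φ x) =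
      -∫ x, (∑ l, q l x * fderiv ℝ P x (EuclideanSpace.single l 1)) * φ x := by
  set e : Fin d → E d := fun l => EuclideanSpace.single l 1
  have hcont : ∀ {ψ : E d → ℝ}, ContDiff ℝ ∞ ψ → ∀ l, Continuous fun x => fderiv ℝ ψ x (e l) :=
    fun hψ l => (hψ.continuous_fderiv (by simp)).clm_apply continuous_const
  have hs2 : ∀ l, HasCompactSupport fun x => fderiv ℝ φ x (e l) := fun l =>
    (hc.fderiv ℝ).comp_left (g := fun L : E d →L[ℝ] ℝ => L (e l)) rfl
  have j1 : ∀ l, Integrable fun x => P x * q l x * fderiv ℝ φ x (e l) := fun l =>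
    ((hP.continuous.mul (hq l).continuous).mul
      (hcont hφ l)).integrable_of_hasCompactSupport (hs2 l).mul_left
  have j2 : ∀ l, Integrable fun x => P x * fderiv ℝ (q l) x (e l) * φ x := fun l =>
    ((hP.continuous.mul (hcont (hq l) l)).mul
      hφ.continuous).integrable_of_hasCompactSupport hc.mul_left
  have j3 : ∀ l, Integrable fun x => q l x * fderiv ℝ P x (e l) * φ x := fun l =>
    (((hq l).continuous.mul (hcont hP l)).mul
      hφ.continuous).integrable_of_hasCompactSupport hc.mul_left
  have j4 : ∀ l, Integrable fun x => P x * q l x * fderiv ℝ φ x (e l) +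
      P x * fderiv ℝ (q l) x (e l) * φ x := fun l => (j1 l).add (j2 l)
  simp only [Finset.sum_mul]
  rw [integral_finsetSum _ fun l _ => j4 l, integral_finsetSum _ fun l _ => j3 l,
    ← Finset.sum_neg_distrib]
  refine Finset.sum_congr rfl fun l _ => ?_
  have e1 : ∫ x, P x * q l x * fderiv ℝ φ x (e l) =
      -∫ x, P x * fderiv ℝ (q l) x (e l) * φ x + q l x * fderiv ℝ P x (e l) * φ x := by
    rw [integral_mul_fderiv_of_compact (hP.mul (hq l)) hφ hc]
    congr 2
    ext x
    rw [fderiv_fun_mul (hP.differentiable (by simp) x) ((hq l).differentiable (by simp) x)]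
    simp
    ring
  rw [integral_add (j1 l) (j2 l), e1, integral_add (j2 l) (j3 l)]
  ring

namespace FESpaces

variable {d : ℕ} {Ω : Set (E d)} {T : Geometry.SimplicialComplex ℝ (E d)} {k m : ℕ}
  {F : FESpaces Ω T k m}

/-- The distributional derivative `u·∇g`, if it is a function, is computed element by element. -/
lemma transport_ae_eq (hΩo : IsOpen Ω) (hT : IsMesh Ω T) (v : F.Xh) {g : E d → ℝ}
    (hg : IsPiecewisePoly T m g) {w : E d → ℝ} (hw : MemLp w 2 (volume.restrict Ω))
    (h : ∀ φ, IsTestFunction Ω φ → ∫ x in Ω, w x * φ x =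
      -∫ x in Ω, g x * ((∑ k, comp v.1 k x * gradient φ x k) + div v.1 x * φ x)) :
    w =ᵐ[volume.restrict Ω] fun x => ∑ k, comp v.1 k x * gradient g x k := by
  refine hT.ae_of_elements fun K hK => ?_
  have hKΩ : interior K ⊆ Ω := (interior_subset_openUnion hK).trans hT.openUnion_subset
  obtain ⟨P, hP, hp1, hp2⟩ : ∃ P : E d → ℝ, ContDiff ℝ ∞ P ∧ (∀ x ∈ interior K, g x = P x) ∧
      ∀ x ∈ interior K, g =ᶠ[𝓝 x] P := by
    obtain ⟨p, -, h1, h2⟩ := hg.eventuallyEq hK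
    exact ⟨_, contDiff_polyFun p, h1, h2⟩
  obtain ⟨Q, hQ, hq1, hq2⟩ : ∃ Q : Fin d → E d → ℝ, (∀ l, ContDiff ℝ ∞ (Q l)) ∧
      (∀ l, ∀ x ∈ interior K, F.vel v l x = Q l x) ∧
      ∀ l, ∀ x ∈ interior K, F.vel v l =ᶠ[𝓝 x] Q l := by
    choose q _ h1 h2 using fun i => (vel_poly v i).eventuallyEq hK
    exact ⟨fun l => polyFun (q l), fun l => contDiff_polyFun (q l), h1, h2⟩
  obtain ⟨N, hN⟩ : ∃ N : E d → ℝ,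
      N = fun x => ∑ l, Q l x * fderiv ℝ P x (EuclideanSpace.single l 1) := ⟨_, rfl⟩
  have hNc : Continuous N := by
    rw [hN]
    exact continuous_finsetSum _ fun l _ => (hQ l).continuous.mul
      ((hP.continuous_fderiv (by simp)).clm_apply continuous_const)
  have hwl : LocallyIntegrable w (volume.restrict Ω) := hw.locallyIntegrable (by norm_num)
  -- Test functions supported in one open element see only the polynomials P and Q there, not the
  -- jumps across faces, so classical integration by parts identifies w with N.
  have key : ∀ᵐ x, x ∈ interior K → w x - N x = 0 := by
    refine isOpen_interior.ae_eq_zero_of_integral_contDiff_smul_eq_zero ?_ fun φ hφ hc hs => ?_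
    · exact ((locallyIntegrableOn_of_locallyIntegrable_restrict hwl).mono_set hKΩ).sub
        (hNc.locallyIntegrable.locallyIntegrableOn _)
    have hφ0 : ∀ x ∉ interior K, φ x = 0 := fun x hx =>
      image_eq_zero_of_notMem_tsupport fun h' => hx (hs h')
    have hdφ0 : ∀ x ∉ interior K, fderiv ℝ φ x = 0 := fun x hx =>
      fderiv_of_notMem_tsupport (𝕜 := ℝ) fun h' => hx (hs h')
    have i1 : IntegrableOn (fun x => w x * φ x) Ω := hw.integrable_mul
      (hφ.continuous.memLp_of_hasCompactSupport hc : MemLp φ 2 (volume.restrict Ω))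
    have i2 : Integrable (fun x => N x * φ x) :=
      (hNc.mul hφ.continuous).integrable_of_hasCompactSupport hc.mul_left
    have e1 := h φ ⟨hφ, hc, hs.trans hKΩ⟩
    obtain ⟨R, hR⟩ : ∃ R : E d → ℝ, R = fun x => ∑ l,
      (P x * Q l x * fderiv ℝ φ x (EuclideanSpace.single l 1) +
        P x * fderiv ℝ (Q l) x (EuclideanSpace.single l 1) * φ x) := ⟨_, rfl⟩
    have e3 : ∫ x in Ω, g x * ((∑ k, comp v.1 k x * gradient φ x k) + div v.1 x * φ x) =
        ∫ x, R x := by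
      rw [← setIntegral_eq_integral_of_forall_compl_eq_zero (s := Ω) (f := R) (fun x hx => by
        have hx' : x ∉ interior K := fun h' => hx (hKΩ h')
        simp [hR, hφ0 x hx', hdφ0 x hx'])]
      refine integral_congr_ae ?_
      have hv : ∀ᵐ x ∂(volume.restrict Ω), ∀ l, comp v.1 l x = F.vel v l x :=
        ae_all_iff.2 fun l => vel_ae v l
      filter_upwards [hv, div_ae v.1, grad_ae hT v] with x hx hdx hgx
      by_cases hxK : x ∈ interior K
      · simp only [hR, gradient_apply, hx, hdx, hp1 x hxK, hq1 _ x hxK, Finset.mul_sum, Finset.sum_mul,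
          mul_add, Finset.sum_add_distrib]
        congr 1
        · exact Finset.sum_congr rfl fun l _ => by ring
        · refine Finset.sum_congr rfl fun l _ => ?_
          rw [grad, Matrix.of_apply, hgx l, gradient_apply, (hq2 l x hxK).fderiv_eq]
          ring
      · simp only [hR, gradient_apply, hφ0 x hxK, hdφ0 x hxK]
        simp
    have e4 : ∫ x, R x = -∫ x, N x * φ x := by
      rw [hR, hN]
      exact integral_mul_div_of_compact hP hQ hφ hc
    rw [← setIntegral_eq_integral_of_forall_compl_eq_zero (s := Ω)
      (fun x hx => by rw [hφ0 x fun h' => hx (hKΩ h'), zero_smul])]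
    have e5 : ∫ x in Ω, φ x • (w x - N x) =
        (∫ x in Ω, w x * φ x) - ∫ x in Ω, N x * φ x := by
      rw [← integral_sub i1 i2.integrableOn]
      congr 1
      ext x
      rw [smul_eq_mul]
      ring
    have e6 : ∫ x in Ω, N x * φ x = ∫ x, N x * φ x :=
      setIntegral_eq_integral_of_forall_compl_eq_zero
        (fun x hx => by rw [hφ0 x fun h' => hx (hKΩ h'), mul_zero])
    rw [e5, e6, e1, e3, e4]
    ring
  have hv : ∀ᵐ x, ∀ l, x ∈ Ω → comp v.1 l x = F.vel v l x := ae_all_iff.2 fun l =>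
    (ae_restrict_iff' hΩo.measurableSet).1 (vel_ae v l)
  filter_upwards [key, hv] with x hx hvx hxK
  rw [sub_eq_zero.1 (hx hxK), hN]
  refine Finset.sum_congr rfl fun l _ => ?_
  rw [hvx l (hKΩ hxK), hq1 l x hxK, gradient_apply, (hp2 x hxK).fderiv_eq]

/-- This is `transport_energy` for the Lipschitz representative of v, with the abstract density w of
u·∇g replaced by the elementwise derivative through `transport_ae_eq`. -/
lemma integral_transport_mul_self (hd : 0 < d) (hΩo : IsOpen Ω) (hΩb : Bornology.IsBounded Ω)
    (hT : IsMesh Ω T) (v : F.Xh) {g : E d → ℝ} (hg : IsPiecewisePoly T m g)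
    (hg0 : ∀ x ∉ openUnion T, g x = 0) (h : TransportInL2 v.1 g) :
    ∫ x in Ω, (∑ k, comp v.1 k x * gradient g x k) * g x + 1 / 2 * (div v.1 x * g x ^ 2) = 0 := by
  obtain ⟨w, hw, h⟩ := h
  have hne : Ωᶜ.Nonempty := by
    have : Nonempty (Fin d) := ⟨⟨0, hd⟩⟩
    rw [nonempty_compl]
    rintro rfl
    exact NormedSpace.unbounded_univ ℝ (E d) hΩb
  obtain ⟨L, hL0, hL⟩ := exists_lipschitz_velField hT hΩb v
  have hpd : ∀ x ∈ openUnion T, DifferentiableAt ℝ (F.velField v) x := fun x hx =>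
    (differentiableAt_euclidean).2 fun i => (vel_poly v i).differentiableAt hx
  have hp0 : ∀ x ∉ Ω, F.velField v x = 0 := fun x hx => by ext l; exact vel_zero v l hx
  obtain ⟨B, hB0, hB⟩ := hg.exists_bound hT
  have hgB : ∀ x, |g x| ≤ B := fun x => by
    by_cases hx : x ∈ openUnion T
    · exact (hB x hx).1
    · rw [hg0 x hx, abs_zero]; exact hB0
  have : Fact (volume Ω < ⊤) := ⟨hΩb.measure_lt_top⟩
  have hv : ∀ᵐ x ∂(volume.restrict Ω), ∀ l, comp v.1 l x = F.vel v l x :=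
    ae_all_iff.2 fun l => vel_ae v l
  have hDtr : ∀ᵐ x ∂(volume.restrict Ω),
      div v.1 x = ∑ l, fderiv ℝ (F.velField v) x (EuclideanSpace.single l 1) l := by
    filter_upwards [div_ae v.1, grad_ae hT v, hT.ae_mem] with x h1 h2 hx
    refine h1.trans (Finset.sum_congr rfl fun l _ => ?_)
    rw [grad, Matrix.of_apply, h2 l, gradient_apply]
    have h3 := ((EuclideanSpace.proj (𝕜 := ℝ) l : E d →L[ℝ] ℝ).hasFDerivAt.comp x
      (hpd x hx).hasFDerivAt).fderiv
    exact congrArg (fun M : E d →L[ℝ] ℝ => M (EuclideanSpace.single l 1)) h3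
  have hweak : ∀ φ, IsTestFunction Ω φ → ∫ x in Ω, w x * φ x =
      -∫ x in Ω, g x * (fderiv ℝ φ x (F.velField v x) + div v.1 x * φ x) := by
    intro φ hφ
    rw [h φ hφ]
    congr 1
    refine integral_congr_ae ?_
    filter_upwards [hv] with x hx
    have : ∑ l, comp v.1 l x * gradient φ x l = fderiv ℝ φ x (F.velField v x) := by
      rw [clm_apply_eq_sum (fderiv ℝ φ x)]
      refine Finset.sum_congr rfl fun l _ => ?_
      rw [gradient_apply]
      exact congrArg (· * _) (hx l)
    rw [this]
  rw [← transport_energy hΩo hΩb hne hT.openUnion_subset hT.ae_mem hL0 hL hp0 hpd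
    (hg.measurable hg0) hgB (fun x hx => hg.continuousAt hx) hg0 (hw.integrable (by norm_num))
    (integrable_of_memLp_top hΩb (memLp_top_div hT v)) hDtr hweak]
  refine integral_congr_ae ?_
  filter_upwards [transport_ae_eq hΩo hT v hg hw h] with x hx
  rw [hx]

/-- The form `b(u,·,·)` is skew-symmetric. -/
lemma b_self (hd : 0 < d) (hΩo : IsOpen Ω) (hΩb : Bornology.IsBounded Ω) (hT : IsMesh Ω T)
    (u : F.Vh) (σ : F.Sh) : b u.1 σ.1 σ.1 = 0 := by
  have hσ := bddField_stress hT σ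
  have hc : ∀ i j, IntegrableOn (fun x => conv u.1 σ.1 x i j * σ.1 x i j) Ω := fun i j =>
    integrable_of_memLp_top hΩb (memLp_top_mul (bddField_conv hT (F.incl u) σ i j) (hσ i j))
  have hds : ∀ i j, IntegrableOn (fun x => (div u.1 x • σ.1 x) i j * σ.1 x i j) Ω := fun i j =>
    integrable_of_memLp_top hΩb (memLp_top_mul (bddField_div_smul hT (F.incl u) σ i j) (hσ i j))
  have key : ∀ i j, (∫ x in Ω, conv u.1 σ.1 x i j * σ.1 x i j) +
      1 / 2 * ∫ x in Ω, (div u.1 x • σ.1 x) i j * σ.1 x i j = 0 := by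
    intro i j
    have hg0 : ∀ x ∉ openUnion T, σ.1 x i j = 0 := fun x hx => by
      rw [stress_zero_of_notMem σ hx]; rfl
    rw [← integral_const_mul, ← integral_add (hc i j) ((hds i j).const_mul _),
      ← integral_transport_mul_self hd hΩo hΩb hT (F.incl u) (F.stress_poly σ.1 σ.2 i j) hg0
      (F.stress_transport σ.1 σ.2 u.1 u.2 i j)]
    refine integral_congr_ae (Eventually.of_forall fun x => ?_)
    simp only [conv, Matrix.of_apply, Matrix.smul_apply, smul_eq_mul, sq, mul_assoc]
    rfl
  rw [b, ip, ip, integral_finsetSum _ fun i _ => integrable_finsetSum _ fun j _ => hc i j,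
    integral_finsetSum _ fun i _ => integrable_finsetSum _ fun j _ => hds i j, Finset.mul_sum,
    ← Finset.sum_add_distrib]
  refine Finset.sum_eq_zero fun i _ => ?_
  rw [integral_finsetSum _ fun j _ => hc i j, integral_finsetSum _ fun j _ => hds i j,
    Finset.mul_sum, ← Finset.sum_add_distrib]
  exact Finset.sum_eq_zero fun j _ => key i j

/-- The transport part drops out by `b_self`, and each stretching term is at most ‖∇u‖_∞ ‖σ‖², as
the Frobenius norm is submultiplicative. -/
lemma upperConv_self (hd : 0 < d) (hΩo : IsOpen Ω) (hΩb : Bornology.IsBounded Ω)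
    (hT : IsMesh Ω T) (u : F.Vh) (σ : F.Sh) :
    -(2 * supNorm Ω (grad u.1) * ip Ω σ.1 σ.1) ≤ upperConv u.1 σ.1 σ.1 := by
  have hg := bddField_grad hT (F.incl u)
  have hσ := bddField_stress hT σ
  have h1 : ∀ A : TensorField d, BddField Ω A →
      (∀ᵐ x ∂(volume.restrict Ω), fro (A x) ≤ supNorm Ω (grad u.1) * fro (σ.1 x)) →
      ip Ω A σ.1 ≤ supNorm Ω (grad u.1) * ip Ω σ.1 σ.1 := by
    intro A hA hAx
    rw [ip, ip, ← integral_const_mul]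
    refine integral_mono_ae (hA.integrable_ip hΩb hσ) ((hσ.integrable_ip hΩb hσ).const_mul _) ?_
    filter_upwards [hAx] with x hx
    refine ((le_abs_self _).trans (abs_sum_mul_le_fro _ _)).trans
      ((mul_le_mul_of_nonneg_right hx (fro_nonneg _)).trans (le_of_eq ?_))
    rw [mul_assoc, ← sq, fro_sq]
    simp only [sq]
  have h2 := h1 _ (hg.mul hσ) (by
    filter_upwards [fro_le_supNorm hg] with x hx
    exact (fro_mul_le _ _).trans (mul_le_mul_of_nonneg_right hx (fro_nonneg _)))
  have h3 := h1 _ (hσ.mul hg.transpose) (by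
    filter_upwards [fro_le_supNorm hg] with x hx
    refine (fro_mul_le _ _).trans ?_
    rw [fro_transpose, mul_comm]
    exact mul_le_mul_of_nonneg_right hx (fro_nonneg _))
  rw [upperConv, b_self hd hΩo hΩb hT u σ]
  change ip Ω (fun x => grad u.1 x * σ.1 x) σ.1 ≤ _ at h2
  change ip Ω (fun x => σ.1 x * (grad u.1 x).transpose) σ.1 ≤ _ at h3
  linarith

end FESpaces

/-! ### Inverse and Sobolev estimates on a single element. -/

section Elements

variable {d : ℕ}

/-- The inverse estimate for piecewise polynomials on an element of a quasi-uniform mesh. -/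
lemma exists_element_inverse_estimate (hd : 0 < d) (n : ℕ) {ρ : ℝ} (hρ : 0 < ρ) :
    ∃ C : ℝ, 0 ≤ C ∧ ∀ (Ω : Set (E d)) (T : Geometry.SimplicialComplex ℝ (E d)), IsMesh Ω T →
      IsQuasiUniform ρ T → ∀ g : E d → ℝ, IsPiecewisePoly T n g → ∀ K ∈ elements T,
      ∀ x ∈ interior K, meshSize T ^ d * g x ^ 2 ≤ C * ∫ y in interior K, g y ^ 2 ∧
        meshSize T ^ (d + 2) * ‖fderiv ℝ g x‖ ^ 2 ≤ C * ∫ y in interior K, g y ^ 2 := by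
  obtain ⟨C, hC, H⟩ := exists_inverse_estimate d n hρ
  refine ⟨C, hC, fun Ω T hT hq g hg K hK x hx => ?_⟩
  have hh := hT.meshSize_pos hd hK
  obtain ⟨c, hc⟩ := hq K hK
  obtain ⟨p, hp, hp1, hp2⟩ := hg.eventuallyEq hK
  have hcK : c ∈ K := hc (Metric.mem_closedBall_self (by positivity))
  obtain ⟨a₁, a₂⟩ := H _ hh c p hp x (hT.subset_closedBall hK hcK (interior_subset hx))
  -- The element lies between the balls of radii ρ h and h about c, so concentric balls take the
  -- place of a reference simplex.
  have hI : ∫ y in Metric.ball c (ρ * meshSize T), polyFun p y ^ 2 ≤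
      ∫ y in interior K, g y ^ 2 := by
    have e : ∫ y in interior K, g y ^ 2 = ∫ y in interior K, polyFun p y ^ 2 :=
      setIntegral_congr_fun isOpen_interior.measurableSet fun y hy => by
        simp only [hp1 y hy]
    rw [e]
    refine setIntegral_mono_set ?_ (Eventually.of_forall fun _ => sq_nonneg _)
      (Eventually.of_forall ?_)
    · exact (((continuous_polyFun p).pow 2).continuousOn.integrableOn_compact
        (isCompact_of_mem_elements hK)).mono_set interior_subset
    · exact Metric.isOpen_ball.subset_interior_iff.2 (Metric.ball_subset_closedBall.trans hc)
  rw [hp1 x hx, (hp2 x hx).fderiv_eq]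
  have := mul_le_mul_of_nonneg_left hI hC
  exact ⟨a₁.trans this, a₂.trans this⟩

lemma IsMesh.volume_interior_le {Ω : Set (E d)} {T : Geometry.SimplicialComplex ℝ (E d)}
    (hT : IsMesh Ω T) {K : Set (E d)} (hK : K ∈ elements T) (hd : 0 < d) :
    (volume (interior K)).toReal ≤
      (volume (Metric.ball (0 : E d) 1)).toReal * meshSize T ^ d := by
  obtain ⟨c, hc⟩ := nonempty_interior_of_mem_elements hK
  have h1 : volume (interior K) ≤ volume (Metric.closedBall c (meshSize T)) :=
    measure_mono (interior_subset.trans (hT.subset_closedBall hK (interior_subset hc)))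
  rw [Measure.addHaar_closedBall _ _ (hT.meshSize_pos hd hK).le] at h1
  have h2 := ENNReal.toReal_mono
    (ENNReal.mul_ne_top ENNReal.ofReal_ne_top measure_ball_lt_top.ne) h1
  rw [ENNReal.toReal_mul, ENNReal.toReal_ofReal (by have := hT.meshSize_pos hd hK; positivity),
    finrank_euclideanSpace_fin, mul_comm] at h2
  exact h2

/-- The power of h is 2 d (1/2 - 1/d) = d - 2. -/
lemma rpow_sobolev_sq (hd : 2 ≤ d) {κ h : ℝ} (hκ : 0 ≤ κ) (hh : 0 < h) :
    ((κ * h ^ d) ^ ((1 : ℝ) / 2 - 1 / d)) ^ 2 =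
      (κ ^ ((1 : ℝ) / 2 - 1 / d)) ^ 2 * h ^ (d - 2) := by
  have hd' : (d : ℝ) ≠ 0 := by positivity
  rw [Real.mul_rpow hκ (by positivity), mul_pow]
  congr 1
  rw [← Real.rpow_natCast h d, ← Real.rpow_mul hh.le, ← Real.rpow_natCast (h ^ _) 2,
    ← Real.rpow_mul hh.le, ← Real.rpow_natCast h (d - 2), Nat.cast_sub hd]
  congr 1
  push_cast
  field_simp

/-- The Sobolev inequality, scaled to an element. -/
lemma exists_element_sobolev (hd : d = 2 ∨ d = 3) {Ω : Set (E d)}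
    (hΩb : Bornology.IsBounded Ω) :
    ∃ C : ℝ, 0 < C ∧ ∀ T : Geometry.SimplicialComplex ℝ (E d), IsMesh Ω T →
      ∀ K ∈ elements T, ∀ t : VelocitySpace Ω,
      ∑ i, ∫ x in interior K, comp t i x ^ 2 ≤ C * meshSize T ^ (d - 2) * l2norm Ω (grad t) ^ 2 := by
  obtain ⟨C, hC, H⟩ := H10_sobolev (Ω := Ω) hd hΩb
  have hd2 : 2 ≤ d := by omega
  set κ := (volume (Metric.ball (0 : E d) 1)).toReal
  have hκ : 0 ≤ κ := ENNReal.toReal_nonneg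
  have hexp : 0 ≤ (1 : ℝ) / 2 - 1 / d :=
    sub_nonneg.2 (one_div_le_one_div_of_le (by norm_num) (by exact_mod_cast hd2))
  refine ⟨C ^ 2 * (κ ^ ((1 : ℝ) / 2 - 1 / d)) ^ 2 + 1, by positivity, fun T hT K hK t => ?_⟩
  have hh := hT.meshSize_pos (by omega) hK
  have hKΩ : interior K ⊆ Ω := (interior_subset_openUnion hK).trans hT.openUnion_subset
  rw [l2norm_sq, ip_grad_self, Finset.mul_sum]
  refine Finset.sum_le_sum fun i _ => ?_
  have h1 := H (interior K) isOpen_interior.measurableSet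
    (hΩb.subset hKΩ).measure_lt_top.ne (t i).1 (t i).2
  have h2 := pow_le_pow_left₀ (norm_nonneg _) h1 2
  rw [norm_toLpRestrict_sq, Measure.restrict_restrict isOpen_interior.measurableSet,
    inter_eq_left.2 hKΩ, mul_pow, mul_pow] at h2
  refine h2.trans (mul_le_mul_of_nonneg_right ?_ (sq_nonneg _))
  have h3 : ((volume (interior K)).toReal ^ ((1 : ℝ) / 2 - 1 / d)) ^ 2 ≤
      (κ ^ ((1 : ℝ) / 2 - 1 / d)) ^ 2 * meshSize T ^ (d - 2) := by
    rw [← rpow_sobolev_sq hd2 hκ hh]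
    gcongr
    exact hT.volume_interior_le hK (by omega)
  calc _ ≤ C ^ 2 * ((κ ^ ((1 : ℝ) / 2 - 1 / d)) ^ 2 * meshSize T ^ (d - 2)) := by gcongr
    _ ≤ _ := by rw [← mul_assoc]; gcongr; linarith

lemma integral_mul_le_sqrt_mul_sqrt {μ : Measure (E d)} {f g : E d → ℝ} (hf : MemLp f 2 μ)
    (hg : MemLp g 2 μ) (hf0 : ∀ x, 0 ≤ f x) (hg0 : ∀ x, 0 ≤ g x) :
    ∫ x, f x * g x ∂μ ≤ √(∫ x, f x ^ 2 ∂μ) * √(∫ x, g x ^ 2 ∂μ) := by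
  have h := integral_mul_le_Lp_mul_Lq_of_nonneg (μ := μ) Real.HolderConjugate.two_two
    (Eventually.of_forall hf0) (Eventually.of_forall hg0) (by simpa using hf) (by simpa using hg)
  simpa [Real.sqrt_eq_rpow] using h

end Elements

/-! ### Continuity of c with the factor h⁻². -/

namespace FESpaces

variable {d : ℕ} {Ω : Set (E d)} {T : Geometry.SimplicialComplex ℝ (E d)} {k m : ℕ}
  {F : FESpaces Ω T k m}

lemma setIntegral_sq_vel_le (hΩb : Bornology.IsBounded Ω) (hT : IsMesh Ω T) (t : F.Xh) (i : Fin d)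
    {K : Set (E d)} (hK : K ∈ elements T) :
    ∫ y in interior K, F.vel t i y ^ 2 ≤ ‖(t.1 i).1.1‖ ^ 2 := by
  have hKΩ : interior K ⊆ Ω := (interior_subset_openUnion hK).trans hT.openUnion_subset
  have e : ‖(t.1 i).1.1‖ ^ 2 = ∫ y in Ω, F.vel t i y ^ 2 := by
    rw [← real_inner_self_eq_norm_sq, L2.inner_def]
    refine integral_congr_ae ?_
    filter_upwards [vel_ae t i] with y hy
    rw [← hy, sq]
    rfl
  rw [e]
  refine setIntegral_mono_set ?_ (Eventually.of_forall fun _ => sq_nonneg _)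
    (Eventually.of_forall hKΩ)
  simp only [sq]
  have := (vel_poly t i).memLp_top hT
  exact integrable_of_memLp_top hΩb (memLp_top_mul this this)

/-- A pointwise bound for the gradient of a discrete velocity on an element. -/
lemma exists_abs_grad_le (hd : d = 2 ∨ d = 3) (hΩo : IsOpen Ω) (hΩb : Bornology.IsBounded Ω)
    {ρ : ℝ} (hρ : 0 < ρ) (hT : IsMesh Ω T) (hq : IsQuasiUniform ρ T) {CK : ℝ}
    (hCK : IsKornConstant Ω CK) :
    ∃ a : ℝ, 0 ≤ a ∧ ∀ (t : F.Xh) (i j : Fin d), ∀ x ∈ openUnion T,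
      |gradient (F.vel t i) x j| ≤ a * l2norm Ω (symGrad t.1) := by
  have hd0 : 0 < d := by omega
  obtain ⟨C, hC, H⟩ := exists_element_inverse_estimate hd0 k hρ
  obtain ⟨Cp, hCp, hP⟩ := H10_poincare (Ω := Ω) hd hΩo hΩb
  have hCK0 := hCK.1
  have hh0 : 0 ≤ meshSize T := Real.sSup_nonneg (by rintro _ ⟨K, _, rfl⟩; exact Metric.diam_nonneg)
  -- The constant depends on the mesh size and, through C, on the degree of the velocities. It only
  -- serves the qualitative claim of differentiability.
  refine ⟨√(C / meshSize T ^ (d + 2)) * Cp * CK, by positivity, fun t i j x hxU => ?_⟩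
  obtain ⟨K, hK, hxK⟩ := mem_openUnion.1 hxU
  have hh := hT.meshSize_pos hd0 hK
  have h0 : |gradient (F.vel t i) x j| ≤ ‖fderiv ℝ (F.vel t i) x‖ := by
    rw [← norm_gradient]
    exact PiLp.norm_apply_le (gradient (F.vel t i) x) j
  refine h0.trans ?_
  have h1 := (H Ω T hT hq _ (vel_poly t i) K hK x hxK).2
  have h2 := setIntegral_sq_vel_le hΩb hT t i hK
  have h3 : ‖(t.1 i).1.1‖ ≤ Cp * (CK * l2norm Ω (symGrad t.1)) :=
    (hP _ (t.1 i).2).trans (mul_le_mul_of_nonneg_left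
      ((norm_le_l2norm_grad t.1 i).trans (hCK.2 t.1)) hCp.le)
  have h4 : ‖fderiv ℝ (F.vel t i) x‖ ^ 2 ≤ C / meshSize T ^ (d + 2) *
      (Cp * (CK * l2norm Ω (symGrad t.1))) ^ 2 := by
    rw [div_mul_eq_mul_div, le_div_iff₀ (by positivity), mul_comm]
    refine h1.trans (mul_le_mul_of_nonneg_left (h2.trans ?_) hC)
    exact pow_le_pow_left₀ (norm_nonneg _) h3 2
  have h5 := Real.sqrt_le_sqrt h4
  rw [Real.sqrt_sq (norm_nonneg _), Real.sqrt_mul (by positivity), Real.sqrt_sq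
    ((norm_nonneg _).trans h3)] at h5
  refine h5.trans (le_of_eq ?_)
  ring

/-- The velocity gradients of a finite element space are controlled in `L^∞` by the energy norm. -/
lemma exists_supNorm_add_le (hd : d = 2 ∨ d = 3) (hΩo : IsOpen Ω) (hΩb : Bornology.IsBounded Ω)
    {ρ : ℝ} (hρ : 0 < ρ) (hT : IsMesh Ω T) (hq : IsQuasiUniform ρ T) {CK : ℝ}
    (hCK : IsKornConstant Ω CK) :
    ∃ γ : ℝ, 0 ≤ γ ∧ ∀ u t : F.Xh, supNorm Ω (grad (u + t).1) ≤
      supNorm Ω (grad u.1) + γ * l2norm Ω (symGrad t.1) := by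
  obtain ⟨a, ha, H⟩ := exists_abs_grad_le (F := F) hd hΩo hΩb hρ hT hq hCK
  have key : ∀ t : F.Xh, ∀ᵐ x ∂(volume.restrict Ω),
      fro (grad t.1 x) ≤ d * a * l2norm Ω (symGrad t.1) := by
    intro t
    filter_upwards [grad_ae hT t, hT.ae_mem] with x hx hxU
    rw [mul_assoc]
    refine fro_le_of_abs_le (mul_nonneg ha (l2norm_nonneg _)) fun i j => ?_
    rw [grad, Matrix.of_apply, hx i]
    exact H t i j x hxU
  refine ⟨d * a, by positivity, fun u t => ?_⟩
  refine supNorm_le (add_nonneg ENNReal.toReal_nonneg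
    (mul_nonneg (by positivity) (l2norm_nonneg _))) ?_
  filter_upwards [fro_le_supNorm (bddField_grad hT u), key t, grad_add_ae u.1 t.1] with x h1 h2 h3
  have h4 : grad (u + t).1 x = grad u.1 x + grad t.1 x := h3
  rw [h4]
  exact (fro_add_le _ _).trans (add_le_add h1 h2)

/-- The pointwise bound for the convective derivative on an element. -/
lemma fro_transportField_le {u : VelocitySpace Ω} {σ : TensorField d} {x : E d}
    (hdiv : div u x = ∑ i, grad u x i i) {a e : ℝ} (he : 0 ≤ e) (h1 : fro (σ x) ≤ a)
    (h2 : ∑ i, ∑ j, ‖fderiv ℝ (fun y => σ y i j) x‖ ^ 2 ≤ e ^ 2) :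
    fro (transportField u σ x) ≤
      (∑ i, |comp u i x|) * e + (d + 2) * fro (grad u x) * a := by
  have ha : 0 ≤ a := (fro_nonneg _).trans h1
  have hsub : ∀ A B : Matrix (Fin d) (Fin d) ℝ, fro (A - B) ≤ fro A + fro B := fun A B => by
    have := fro_add_le A (-B)
    rw [← sub_eq_add_neg] at this
    simpa [fro] using this
  have hsmul : ∀ (c : ℝ) (A : Matrix (Fin d) (Fin d) ℝ), fro (c • A) = |c| * fro A := fun c A => by
    rw [fro, fro, ← Real.sqrt_sq_eq_abs, ← Real.sqrt_mul (sq_nonneg c)]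
    simp only [Matrix.smul_apply, smul_eq_mul, mul_pow, Finset.mul_sum]
  have hconv : fro (conv u σ x) ≤ (∑ i, |comp u i x|) * e := by
    refine Real.sqrt_le_iff.2 ⟨by positivity, ?_⟩
    rw [mul_pow]
    refine le_trans ?_ (mul_le_mul_of_nonneg_left h2 (sq_nonneg _))
    simp only [Finset.mul_sum]
    refine Finset.sum_le_sum fun i _ => Finset.sum_le_sum fun j _ => ?_
    rw [← mul_pow, ← sq_abs]
    refine pow_le_pow_left₀ (abs_nonneg _) ?_ 2
    rw [conv, Matrix.of_apply, Finset.sum_mul]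
    refine (Finset.abs_sum_le_sum_abs _ _).trans (Finset.sum_le_sum fun l _ => ?_)
    rw [abs_mul]
    refine mul_le_mul_of_nonneg_left ?_ (abs_nonneg _)
    rw [← norm_gradient]
    exact PiLp.norm_apply_le (gradient (fun y => σ y i j) x) l
  have hdiv' : |div u x| ≤ d * fro (grad u x) := by
    rw [hdiv]
    refine (Finset.abs_sum_le_sum_abs _ _).trans
      ((Finset.sum_le_sum fun i _ => abs_le_fro (grad u x) i i).trans (le_of_eq ?_))
    simp
  have h3 := hsub (conv u σ x + (1 / 2 : ℝ) • (div u x • σ x) - grad u x * σ x)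
    (σ x * (grad u x).transpose)
  have h4 := hsub (conv u σ x + (1 / 2 : ℝ) • (div u x • σ x)) (grad u x * σ x)
  have h5 := fro_add_le (conv u σ x) ((1 / 2 : ℝ) • (div u x • σ x))
  have h6 := fro_mul_le (grad u x) (σ x)
  have h7 := fro_mul_le (σ x) (grad u x).transpose
  rw [fro_transpose] at h7
  rw [hsmul, hsmul, abs_of_pos (by norm_num : (0:ℝ) < 1 / 2)] at h5
  have h8 : fro (grad u x) * fro (σ x) ≤ fro (grad u x) * a :=
    mul_le_mul_of_nonneg_left h1 (fro_nonneg _)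
  have h9 : |div u x| * fro (σ x) ≤ d * fro (grad u x) * a :=
    mul_le_mul hdiv' h1 (fro_nonneg _) (mul_nonneg (by positivity) (fro_nonneg _))
  have h10 : 0 ≤ d * fro (grad u x) * a :=
    mul_nonneg (mul_nonneg (by positivity) (fro_nonneg _)) ha
  change fro (conv u σ x + (1 / 2 : ℝ) • (div u x • σ x) - grad u x * σ x -
    σ x * (grad u x).transpose) ≤ _
  -- The coefficients of |∇u| a add up to d/2 + 2, from half the divergence and the two matrix
  -- products; d + 2 is a convenient upper bound.
  nlinarith

end FESpaces

lemma ip_eq_sum_elements {d : ℕ} {Ω : Set (E d)} {T : Geometry.SimplicialComplex ℝ (E d)}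
    (hΩb : Bornology.IsBounded Ω) (hT : IsMesh Ω T) {A B : TensorField d} (hA : BddField Ω A)
    (hB : BddField Ω B) : ip Ω A B = ∑ K ∈ hT.finite_elements.toFinset, ip (interior K) A B :=
  hT.setIntegral_eq_sum (hA.integrable_ip hΩb hB)

namespace FESpaces

variable {d : ℕ} {Ω : Set (E d)} {T : Geometry.SimplicialComplex ℝ (E d)} {k m : ℕ}
  {F : FESpaces Ω T k m}

/-- The weight that dominates the velocity and its gradient in the convective derivative. -/
def weight (u : VelocitySpace Ω) (h : ℝ) (x : E d) : ℝ :=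
  (∑ i, |comp u i x|) / h + (d + 2) * fro (grad u x)

lemma weight_nonneg (u : VelocitySpace Ω) {h : ℝ} (hh : 0 ≤ h) (x : E d) : 0 ≤ weight u h x :=
  add_nonneg (by positivity) (mul_nonneg (by positivity) (fro_nonneg _))

lemma memLp_weight (hT : IsMesh Ω T) (u : F.Xh) (h : ℝ) :
    MemLp (weight u.1 h) ∞ (volume.restrict Ω) := by
  have h1 : MemLp (fun x => h⁻¹ * ∑ i, |comp u.1 i x|) ∞ (volume.restrict Ω) :=
    (memLp_finsetSum _ fun i _ => (memLp_top_comp hT u i).norm).const_mul _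
  have h2 := h1.add ((bddField_grad hT u).memLp_fro.const_mul ((d : ℝ) + 2))
  refine h2.ae_eq (Eventually.of_forall fun x => ?_)
  simp only [weight, Pi.add_apply, div_eq_inv_mul]

lemma weight_sq_le (u : VelocitySpace Ω) (h : ℝ) (x : E d) :
    weight u h x ^ 2 ≤ 2 * d / h ^ 2 * ∑ i, comp u i x ^ 2 +
      2 * (d + 2) ^ 2 * ∑ i, ∑ j, grad u x i j * grad u x i j := by
  have h1 : (∑ i, |comp u i x|) ^ 2 ≤ d * ∑ i, comp u i x ^ 2 := by
    have := sq_sum_le_card_mul_sum_sq (s := Finset.univ) (f := fun i => |comp u i x|)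
    simpa using this
  have h2 := add_sq_le (a := (∑ i, |comp u i x|) / h) (b := (d + 2) * fro (grad u x))
  rw [mul_pow, fro_sq, div_pow] at h2
  simp only [sq (grad u x _ _)] at h2
  refine h2.trans ?_
  have h3 : (∑ i, |comp u i x|) ^ 2 / h ^ 2 ≤ (d * ∑ i, comp u i x ^ 2) / h ^ 2 := by gcongr
  calc _ ≤ 2 * ((d * ∑ i, comp u i x ^ 2) / h ^ 2 +
        (d + 2) ^ 2 * ∑ i, ∑ j, grad u x i j * grad u x i j) := by linarith
    _ = _ := by ring

/-- The velocity enters through a Sobolev bound and not through an inverse estimate, which keeps its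
polynomial degree out of the constant. -/
lemma setIntegral_weight_sq_le (hd : 2 ≤ d) (hΩb : Bornology.IsBounded Ω) (hT : IsMesh Ω T)
    (u : F.Xh) {K : Set (E d)} (hK : K ∈ elements T) {Cs : ℝ}
    (hCs : ∑ i, ∫ x in interior K, comp u.1 i x ^ 2 ≤
      Cs * meshSize T ^ (d - 2) * l2norm Ω (grad u.1) ^ 2) :
    ∫ x in interior K, weight u.1 (meshSize T) x ^ 2 ≤
      (2 * d / meshSize T ^ 2 * (Cs * meshSize T ^ (d - 2)) + 2 * (d + 2) ^ 2) *
        l2norm Ω (grad u.1) ^ 2 := by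
  have hKΩ : interior K ⊆ Ω := (interior_subset_openUnion hK).trans hT.openUnion_subset
  have hg := bddField_grad hT u
  have i1 : ∀ i, IntegrableOn (fun x => comp u.1 i x ^ 2) (interior K) := fun i => by
    simp only [sq]
    exact (integrable_of_memLp_top hΩb (memLp_top_mul (memLp_top_comp hT u i)
      (memLp_top_comp hT u i))).mono_set hKΩ
  have i1' : IntegrableOn (fun x => ∑ i, comp u.1 i x ^ 2) (interior K) :=
    integrable_finsetSum _ fun i _ => i1 i
  have i2 := hg.integrable_ip hΩb hg
  have i3 : IntegrableOn (fun x => weight u.1 (meshSize T) x ^ 2) (interior K) := by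
    simp only [sq]
    exact (integrable_of_memLp_top hΩb (memLp_top_mul (memLp_weight hT u _)
      (memLp_weight hT u _))).mono_set hKΩ
  have h1 := integral_mono (i3) ((i1'.const_mul (2 * d / meshSize T ^ 2)).add
    ((i2.mono_set hKΩ).const_mul (2 * ((d : ℝ) + 2) ^ 2)))
    fun x => weight_sq_le u.1 (meshSize T) x
  refine h1.trans ?_
  simp only [Pi.add_apply]
  rw [integral_add (i1'.const_mul _) ((i2.mono_set hKΩ).const_mul _), integral_const_mul,
    integral_const_mul, integral_finsetSum _ fun i _ => i1 i, add_mul]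
  have h2 : ∫ x in interior K, ∑ i, ∑ j, grad u.1 x i j * grad u.1 x i j ≤
      l2norm Ω (grad u.1) ^ 2 := by
    rw [l2norm_sq, ip]
    exact setIntegral_mono_set i2 (Eventually.of_forall fun x => Finset.sum_nonneg fun _ _ =>
      Finset.sum_nonneg fun _ _ => mul_self_nonneg _) (Eventually.of_forall hKΩ)
  have h3 : 0 ≤ 2 * d / meshSize T ^ 2 := by positivity
  have h4 := mul_le_mul_of_nonneg_left hCs h3
  have h5 := mul_le_mul_of_nonneg_left h2 (by positivity : (0:ℝ) ≤ 2 * ((d : ℝ) + 2) ^ 2)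
  linarith

/-- The constants of the pointwise bounds on an element. -/
lemma exists_element_stress_le (hd : 0 < d) (m : ℕ) {ρ : ℝ} (hρ : 0 < ρ) :
    ∃ C : ℝ, 0 ≤ C ∧ ∀ (Ω : Set (E d)) (T : Geometry.SimplicialComplex ℝ (E d)),
      Bornology.IsBounded Ω → IsMesh Ω T → IsQuasiUniform ρ T → ∀ (k : ℕ) (F : FESpaces Ω T k m)
      (σ : F.Sh), ∀ K ∈ elements T, ∀ x ∈ interior K,
      fro (σ.1 x) ≤ √(C * ip (interior K) σ.1 σ.1 / meshSize T ^ d) ∧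
      ∑ i, ∑ j, ‖fderiv ℝ (fun y => σ.1 y i j) x‖ ^ 2 ≤
        (√(C * ip (interior K) σ.1 σ.1 / meshSize T ^ d) / meshSize T) ^ 2 := by
  obtain ⟨C, hC, H⟩ := exists_element_inverse_estimate hd m hρ
  refine ⟨C, hC, fun Ω T hΩb hT hq k F σ K hK x hx => ?_⟩
  have hh := hT.meshSize_pos hd hK
  have hKΩ : interior K ⊆ Ω := (interior_subset_openUnion hK).trans hT.openUnion_subset
  have hσ := bddField_stress hT σ
  have i1 : ∀ i j, IntegrableOn (fun x => σ.1 x i j * σ.1 x i j) (interior K) := fun i j =>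
    (integrable_of_memLp_top hΩb (memLp_top_mul (hσ i j) (hσ i j))).mono_set hKΩ
  have e : ip (interior K) σ.1 σ.1 = ∑ i, ∑ j, ∫ y in interior K, σ.1 y i j ^ 2 := by
    rw [ip, integral_finsetSum _ fun i _ => integrable_finsetSum _ fun j _ => i1 i j]
    refine Finset.sum_congr rfl fun i _ => ?_
    rw [integral_finsetSum _ fun j _ => i1 i j]
    simp only [sq]
  have h0 := ip_self_nonneg (interior K) σ.1
  have hb := fun i j => H Ω T hT hq _ (F.stress_poly σ.1 σ.2 i j) K hK x hx
  constructor
  · refine Real.sqrt_le_sqrt ?_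
    rw [le_div_iff₀ (by positivity), mul_comm, e]
    simp only [Finset.mul_sum]
    exact Finset.sum_le_sum fun i _ => Finset.sum_le_sum fun j _ => (hb i j).1
  · rw [div_pow, Real.sq_sqrt (by positivity), div_div, ← pow_add, le_div_iff₀ (by positivity),
      mul_comm, e]
    simp only [Finset.mul_sum]
    exact Finset.sum_le_sum fun i _ => Finset.sum_le_sum fun j _ => (hb i j).2

/-- With |σ| ≤ a and |∇σ| ≤ a / h pointwise, the transport field is at most a times `weight`, and
the Cauchy–Schwarz inequality pairs the weight with τ. -/
lemma abs_ip_element_le (hΩb : Bornology.IsBounded Ω) (hT : IsMesh Ω T) (u : F.Xh)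
    (σ τ : F.Sh) {K : Set (E d)} (hK : K ∈ elements T) (hd : 0 < d) {a : ℝ} (ha : 0 ≤ a)
    (h : ∀ x ∈ interior K, fro (σ.1 x) ≤ a ∧
      ∑ i, ∑ j, ‖fderiv ℝ (fun y => σ.1 y i j) x‖ ^ 2 ≤ (a / meshSize T) ^ 2) :
    |ip (interior K) (transportField u.1 σ.1) τ.1| ≤
      a * √(∫ x in interior K, weight u.1 (meshSize T) x ^ 2) *
        √(ip (interior K) τ.1 τ.1) := by
  have hh := hT.meshSize_pos hd hK
  have hKΩ : interior K ⊆ Ω := (interior_subset_openUnion hK).trans hT.openUnion_subset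
  have hμ : volume.restrict (interior K) ≤ volume.restrict Ω := Measure.restrict_mono hKΩ le_rfl
  have : Fact (volume Ω < ⊤) := ⟨hΩb.measure_lt_top⟩
  have hW : MemLp (weight u.1 (meshSize T)) 2 (volume.restrict (interior K)) :=
    ((memLp_weight hT u _).mono_exponent le_top).mono_measure hμ
  have hτ : MemLp (fun x => fro (τ.1 x)) 2 (volume.restrict (interior K)) :=
    ((bddField_stress hT τ).memLp_fro.mono_exponent le_top).mono_measure hμ
  have hCS := integral_mul_le_sqrt_mul_sqrt hW hτ (weight_nonneg u.1 hh.le) fun x => fro_nonneg _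
  simp only [fro_sq] at hCS
  have e : ip (interior K) τ.1 τ.1 = ∫ x in interior K, ∑ i, ∑ j, τ.1 x i j ^ 2 := by
    simp only [ip, sq]
  rw [mul_assoc, e]
  refine le_trans ?_ (mul_le_mul_of_nonneg_left hCS ha)
  rw [← integral_const_mul, ip, ← Real.norm_eq_abs]
  refine norm_integral_le_of_norm_le ((hW.integrable_mul hτ).const_mul a) ?_
  have hae : ∀ᵐ x ∂(volume.restrict (interior K)), div u.1 x = ∑ i, grad u.1 x i i :=
    ae_mono hμ (div_ae u.1)
  filter_upwards [hae, ae_restrict_mem isOpen_interior.measurableSet] with x hdx hx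
  rw [Real.norm_eq_abs]
  refine (abs_sum_mul_le_fro _ _).trans ?_
  rw [← mul_assoc]
  refine mul_le_mul_of_nonneg_right ?_ (fro_nonneg _)
  refine (fro_transportField_le hdx (by positivity) (h x hx).1 (h x hx).2).trans (le_of_eq ?_)
  rw [weight]
  ring

/-- The convective part scales as h^{-d} h^{-2} h^{d-2} = h^{-4}. The gradient part h^{-d} = h^{-4}
h^{4-d} is of lower order, and its excess power is bounded through h ≤ δ. -/
lemma element_constant_le (hd : d = 2 ∨ d = 3) {C Cs δ h : ℝ} (hC : 0 ≤ C) (hh : 0 < h)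
    (hδ : h ≤ δ) :
    C / h ^ d * (2 * d / h ^ 2 * (Cs * h ^ (d - 2)) + 2 * (d + 2) ^ 2) ≤
      C * (2 * d * Cs + 2 * (d + 2) ^ 2 * δ ^ (4 - d)) / (h ^ 2) ^ 2 := by
  have h1 : h ^ (4 - d) ≤ δ ^ (4 - d) := by gcongr
  have e : C / h ^ d * (2 * d / h ^ 2 * (Cs * h ^ (d - 2)) + 2 * (d + 2) ^ 2) =
      C * (2 * d * Cs + 2 * (d + 2) ^ 2 * h ^ (4 - d)) / (h ^ 2) ^ 2 := by
    rcases hd with rfl | rfl <;> · norm_num; field_simp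
  rw [e]
  gcongr

lemma element_product_le {q W s t g L h : ℝ} (hs : 0 ≤ s) (hg : 0 ≤ g) (hL : 0 ≤ L) (hq : 0 ≤ q)
    (hW : W ≤ t * g ^ 2) (ht : q * t ≤ L / (h ^ 2) ^ 2) :
    √(q * s) * √W ≤ √L / h ^ 2 * g * √s := by
  rw [← Real.sqrt_mul (by positivity)]
  refine Real.sqrt_le_iff.2 ⟨by positivity, ?_⟩
  rw [mul_pow, mul_pow, div_pow, Real.sq_sqrt hL, Real.sq_sqrt hs]
  calc q * s * W ≤ q * s * (t * g ^ 2) := by gcongr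
    _ = (q * t) * (g ^ 2 * s) := by ring
    _ ≤ L / (h ^ 2) ^ 2 * (g ^ 2 * s) := by gcongr
    _ = _ := by ring

/-- The continuity of the form `c` on an element. -/
lemma exists_abs_ip_element_le (hd : d = 2 ∨ d = 3) (hΩb : Bornology.IsBounded Ω) {ρ : ℝ}
    (hρ : 0 < ρ) (m : ℕ) :
    ∃ A : ℝ, 0 ≤ A ∧ ∀ T : Geometry.SimplicialComplex ℝ (E d), IsMesh Ω T → IsQuasiUniform ρ T →
      ∀ (k : ℕ) (F : FESpaces Ω T k m) (u : F.Xh) (σ τ : F.Sh), ∀ K ∈ elements T,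
      |ip (interior K) (transportField u.1 σ.1) τ.1| ≤
        A / meshSize T ^ 2 * l2norm Ω (grad u.1) *
          (√(ip (interior K) σ.1 σ.1) * √(ip (interior K) τ.1 τ.1)) := by
  have hd0 : 0 < d := by omega
  obtain ⟨C, hC, H⟩ := exists_element_stress_le hd0 m hρ
  obtain ⟨Cs, hCs, HS⟩ := exists_element_sobolev hd hΩb
  obtain ⟨L, hL⟩ : ∃ L : ℝ, L =
    C * (2 * d * Cs + 2 * (d + 2) ^ 2 * Metric.diam Ω ^ (4 - d)) := ⟨_, rfl⟩
  have hδ0 : 0 ≤ Metric.diam Ω := Metric.diam_nonneg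
  have hL0 : 0 ≤ L := by rw [hL]; positivity
  refine ⟨√L, Real.sqrt_nonneg _, fun T hT hq k F u σ τ K hK => ?_⟩
  have hh := hT.meshSize_pos hd0 hK
  refine (abs_ip_element_le hΩb hT u σ τ hK hd0 (Real.sqrt_nonneg _)
    (fun x hx => H Ω T hΩb hT hq k F σ K hK x hx)).trans ?_
  rw [← mul_assoc]
  refine mul_le_mul_of_nonneg_right ?_ (Real.sqrt_nonneg _)
  have h1 := setIntegral_weight_sq_le (by omega) hΩb hT u hK (HS T hT K hK u.1)
  have h2 := element_constant_le hd (Cs := Cs) hC hh (hT.meshSize_le hΩb)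
  rw [← hL] at h2
  rw [mul_div_right_comm]
  exact element_product_le (ip_self_nonneg _ _) (l2norm_nonneg _) hL0 (by positivity) h1 h2

/-- The continuity of the form `c` in the energy norms. -/
theorem exists_abs_upperConv_le (hd : d = 2 ∨ d = 3) (hΩb : Bornology.IsBounded Ω) {ρ : ℝ}
    (hρ : 0 < ρ) (m : ℕ) :
    ∃ A : ℝ, 0 < A ∧ ∀ T : Geometry.SimplicialComplex ℝ (E d), IsMesh Ω T → IsQuasiUniform ρ T →
      ∀ (k : ℕ) (F : FESpaces Ω T k m) (u : F.Xh) (σ τ : F.Sh),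
      |upperConv u.1 σ.1 τ.1| ≤
        A / meshSize T ^ 2 * l2norm Ω (grad u.1) * l2norm Ω σ.1 * l2norm Ω τ.1 := by
  obtain ⟨A, hA, key⟩ := exists_abs_ip_element_le hd hΩb hρ m
  refine ⟨A + 1, by positivity, fun T hT hq k F u σ τ => ?_⟩
  have hσ := bddField_stress hT σ
  have hτ := bddField_stress hT τ
  -- The velocity factor is the global norm ‖∇u‖ on every element, so only the two stresses have to
  -- be summed, by the discrete Cauchy–Schwarz inequality.
  have hsum : ∑ K ∈ hT.finite_elements.toFinset,
      √(ip (interior K) σ.1 σ.1) * √(ip (interior K) τ.1 τ.1) ≤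
      l2norm Ω σ.1 * l2norm Ω τ.1 := by
    rw [l2norm, l2norm, ip_eq_sum_elements hΩb hT hσ hσ, ip_eq_sum_elements hΩb hT hτ hτ]
    exact Real.sum_sqrt_mul_sqrt_le _ (fun K => ip_self_nonneg _ _) fun K => ip_self_nonneg _ _
  have hg := l2norm_nonneg (Ω := Ω) (grad u.1)
  have hs : 0 ≤ l2norm Ω σ.1 * l2norm Ω τ.1 := mul_nonneg (l2norm_nonneg _) (l2norm_nonneg _)
  rw [upperConv_eq hΩb hT, ip_eq_sum_elements hΩb hT (bddField_transportField hT u σ) hτ]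
  refine (Finset.abs_sum_le_sum_abs _ _).trans
    ((Finset.sum_le_sum fun K hK => key T hT hq k F u σ τ K (by simpa using hK)).trans ?_)
  rw [← Finset.mul_sum]
  calc _ ≤ A / meshSize T ^ 2 * l2norm Ω (grad u.1) * (l2norm Ω σ.1 * l2norm Ω τ.1) := by
        gcongr
    _ ≤ (A + 1) / meshSize T ^ 2 * l2norm Ω (grad u.1) * (l2norm Ω σ.1 * l2norm Ω τ.1) := by
        gcongr
        linarith
    _ = _ := by ring

end FESpaces

/-! ### Comparison with Ĉ_L and the assembled abstract theorem. -/

section Abstract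

/-- With β = A C_K / h² and N = ‖f‖₋₁ C_K the numerator becomes β² N, so that Ĉ_L can be compared
with the constant of `lipschitz_deriv`. -/
lemma CLhat_eq {A CK Nf h lam α M : ℝ} (hS : 0 < Sconst lam α M * lam⁻¹) :
    CLhat A CK Nf h lam α M = (A * CK / h ^ 2) ^ 2 * (Nf * CK) /
      (2 * √2 * (Sconst lam α M * lam⁻¹) * √(C0const lam α M * (1 - α))) := by
  rw [CLhat, CLconst]
  have e : 2 * Sconst lam α M * lam⁻¹ * C0const lam α M * (1 - α) =
      2 * ((Sconst lam α M * lam⁻¹) * (C0const lam α M * (1 - α))) := by ring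
  rw [e, Real.sqrt_mul (by norm_num), Real.sqrt_mul hS.le]
  have h2 := Real.mul_self_sqrt hS.le
  set s := √(Sconst lam α M * lam⁻¹)
  rw [← h2]
  simp only [div_eq_mul_inv, mul_inv, mul_pow, inv_pow]
  ring

/-- The two constants differ only in the numerical factor of the denominator, 8 against 2√2. -/
lemma lipschitz_constant_le {A CK Nf h lam α M : ℝ} (hN : 0 ≤ Nf * CK)
    (hS : 0 < Sconst lam α M * lam⁻¹) (hC : 0 ≤ C0const lam α M * (1 - α)) :
    (A * CK / h ^ 2) ^ 2 * (Nf * CK) /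
      (8 * (Sconst lam α M * lam⁻¹) * √(C0const lam α M * (1 - α))) ≤
        CLhat A CK Nf h lam α M := by
  rw [CLhat_eq hS]
  rcases hC.eq_or_lt with h0 | h0
  · simp [← h0]
  have h1 : √2 ≤ 4 := Real.sqrt_le_iff.2 ⟨by norm_num, by norm_num⟩
  have h2 := Real.sqrt_pos.2 h0
  refine div_le_div_of_nonneg_left (by positivity) (by positivity) ?_
  gcongr
  linarith

namespace PicardForms

variable {V S : Type*} [AddCommGroup V] [Module ℝ V] [AddCommGroup S] [Module ℝ S]

/-- The well-posedness, differentiability and Lipschitz estimate for the solution operator of a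
Picard step. -/
theorem wellPosed_and_lipschitz [FiniteDimensional ℝ V] [FiniteDimensional ℝ S]
    (P : PicardForms V S) {lam α A CK Nf h : ℝ} (hl : 0 < lam) (h0 : 0 < α) (h1 : α < 1)
    (hN : 0 ≤ Nf * CK) (hβ : P.β = A * CK / h ^ 2) {f : V →ₗ[ℝ] ℝ}
    (hf : ∀ v, |f v| ≤ Nf * CK * √(P.aV v v)) {step : V × S → V × S → Prop}
    {lin : V × S → V × S → V × S → Prop} {G : V × S → V × S} {G' : V × S → V × S → V × S}
    (hstep : ∀ x z, step x z ↔ P.IsStep lam α x.1 0 f z)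
    (hlin : ∀ x y z, lin x y z ↔ P.IsStep lam α x.1 (-(lam • P.c y.1 (G x).2)) 0 z)
    (hG : ∀ x, (∃ z, step x z) → step x (G x))
    (hG' : ∀ x y, (∃ z, lin x y z) → lin x y (G' x y)) {N : V × S → ℝ}
    (hNs : ∀ z, N z = P.star z) {bd : V → ℝ} (hbd : ∀ u, P.bd u = bd u) :
    (∀ x, 2 * lam * bd x.1 < 1 → (∃! z, step x z) ∧ (∀ y, ∃! z, lin x y z) ∧
      (IsLinearMap ℝ (G' x) ∧ (∃ B : ℝ, ∀ y, N (G' x y) ≤ B * N y) ∧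
        ∀ ε : ℝ, 0 < ε → ∃ δ : ℝ, 0 < δ ∧ ∀ y, N y < δ →
          N (G (x + y) - G x - G' x y) ≤ ε * N y)) ∧
    ∀ (x y z : V × S) (M : ℝ), M = max (bd x.1) (bd (x + y).1) →
      0 < 1 - 2 * lam * M - 2 * lam →
      N (G' (x + y) z - G' x z) ≤ CLhat A CK Nf h lam α M * N z * N y := by
  obtain rfl : N = P.star := funext hNs
  obtain rfl : P.bd = bd := funext hbd
  have hex : ∀ x : V × S, 2 * lam * P.bd x.1 < 1 →
      (∃! z, step x z) ∧ ∀ y, ∃! z, lin x y z := by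
    intro x hx
    simp only [hstep, hlin]
    exact ⟨existsUnique_isStep hl.le h0 h1 hx _ _,
      fun y => existsUnique_isStep hl.le h0 h1 hx _ _⟩
  have hGs : ∀ x : V × S, 2 * lam * P.bd x.1 < 1 → P.IsStep lam α x.1 0 f (G x) := fun x hx =>
    (hstep x _).1 (hG x (hex x hx).1.exists)
  have hGl : ∀ x y : V × S, 2 * lam * P.bd x.1 < 1 →
      P.IsStep lam α x.1 (-(lam • P.c y.1 (G x).2)) 0 (G' x y) := fun x y hx =>
    (hlin x y _).1 (hG' x y ((hex x hx).2 y).exists)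
  refine ⟨fun x hx => ⟨(hex x hx).1, (hex x hx).2,
    frechet hl h0 h1 hGs hx fun y => hGl x y hx⟩, fun x y z M hM hM0 => ?_⟩
  have hu : P.bd x.1 ≤ M := by rw [hM]; exact le_max_left _ _
  have hut : P.bd (x + y).1 ≤ M := by rw [hM]; exact le_max_right _ _
  have hlt : ∀ {r : ℝ}, r ≤ M → 2 * lam * r < 1 := fun hr => by nlinarith
  have hS : 0 < Sconst lam α M * lam⁻¹ :=
    mul_pos (lt_min hM0 (by nlinarith)) (inv_pos.2 hl)
  have hC0 : 0 ≤ C0const lam α M * (1 - α) :=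
    mul_nonneg (le_min (div_nonneg (by linarith) (by linarith)) (by linarith)) (by linarith)
  have key := lipschitz_deriv hl h0 h1 hN hf hM0 hu hut (hGs x (hlt hu)) (hGs (x + y) (hlt hut))
    (hGl x z (hlt hu)) (hGl (x + y) z (hlt hut))
  rw [hβ] at key
  have hK := lipschitz_constant_le (A := A) (h := h) hN hS hC0
  have hle : ∀ w : V × S, √(P.aV w.1 w.1) ≤ P.star w := fun w =>
    Real.sqrt_le_sqrt (le_add_of_nonneg_right (aS_nonneg _))
  have hK0 := le_trans (by positivity) hK
  exact key.trans (mul_le_mul (mul_le_mul hK (hle z) (Real.sqrt_nonneg _) hK0) (hle y)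
    (Real.sqrt_nonneg _) (mul_nonneg hK0 (Real.sqrt_nonneg _)))

end PicardForms

end Abstract

/-! ### The discrete Oldroyd-B system as an instance of the abstract one. -/

namespace FESpaces

variable {d : ℕ} {Ω : Set (E d)} {T : Geometry.SimplicialComplex ℝ (E d)} {k m : ℕ}
  {F : FESpaces Ω T k m}

lemma formS_apply (hΩb : Bornology.IsBounded Ω) (hT : IsMesh Ω T) (σ τ : F.Sh) :
    formS hΩb hT σ τ = ip Ω σ.1 τ.1 := rfl

lemma formVS_apply (hΩb : Bornology.IsBounded Ω) (hT : IsMesh Ω T) (v : F.Vh) (τ : F.Sh) :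
    formVS hΩb hT v τ = ip Ω (symGrad v.1) τ.1 := rfl

lemma formV_apply (hΩb : Bornology.IsBounded Ω) (hT : IsMesh Ω T) (v w : F.Vh) :
    formV hΩb hT v w = ip Ω (symGrad v.1) (symGrad w.1) := rfl

lemma l2norm_symGrad_eq (hΩb : Bornology.IsBounded Ω) (hT : IsMesh Ω T) (v : F.Vh) :
    l2norm Ω (symGrad v.1) = √(formV hΩb hT v v) :=
  congrArg Real.sqrt (formV_apply hΩb hT v v).symm

lemma l2norm_stress_eq (hΩb : Bornology.IsBounded Ω) (hT : IsMesh Ω T) (σ : F.Sh) :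
    l2norm Ω σ.1 = √(formS hΩb hT σ σ) :=
  congrArg Real.sqrt (formS_apply hΩb hT σ σ).symm

lemma picardForms_c_le (hΩb : Bornology.IsBounded Ω) (hT : IsMesh Ω T) {β : ℝ} {t : F.Vh}
    {ζ τ : F.Sh} (h : |upperConv t.1 ζ.1 τ.1| ≤
      β * l2norm Ω (symGrad t.1) * l2norm Ω ζ.1 * l2norm Ω τ.1) :
    |formC hΩb hT t ζ τ| ≤ β * √(formV hΩb hT t t) * √(formS hΩb hT ζ ζ) *
      √(formS hΩb hT τ τ) := by
  have e : ∀ {x x' v v' z z' w w' : ℝ}, x' = x → v = v' → z = z' → w = w' →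
      x ≤ β * v * z * w → x' ≤ β * v' * z' * w' := by
    rintro _ _ _ _ _ _ _ _ rfl rfl rfl rfl h
    exact h
  exact e (congrArg abs (formC_apply hΩb hT t ζ τ)) (l2norm_symGrad_eq hΩb hT t)
    (l2norm_stress_eq hΩb hT ζ) (l2norm_stress_eq hΩb hT τ) h

lemma picardForms_c_self (hd : d = 2 ∨ d = 3) (hΩo : IsOpen Ω) (hΩb : Bornology.IsBounded Ω)
    (hT : IsMesh Ω T) (u : F.Vh) (σ : F.Sh) :
    -(2 * supNorm Ω (grad u.1) * formS hΩb hT σ σ) ≤ formC hΩb hT u σ σ := by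
  rw [formC_apply, formS_apply]
  exact upperConv_self (by omega) hΩo hΩb hT u σ

lemma picardForms_bd_add (hΩb : Bornology.IsBounded Ω) (hT : IsMesh Ω T) {γ : ℝ} {u t : F.Vh}
    (h : supNorm Ω (grad (u + t).1) ≤ supNorm Ω (grad u.1) + γ * l2norm Ω (symGrad t.1)) :
    supNorm Ω (grad (u + t).1) ≤ supNorm Ω (grad u.1) + γ * √(formV hΩb hT t t) := by
  rw [l2norm_symGrad_eq hΩb hT t] at h
  exact h

/-- The forms of the discrete Oldroyd-B system. -/
def picardForms (hd : d = 2 ∨ d = 3) (hΩo : IsOpen Ω) (hΩb : Bornology.IsBounded Ω)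
    (hT : IsMesh Ω T) {CK β γ : ℝ} (hCK : IsKornConstant Ω CK) (hβ : 0 ≤ β) (hγ : 0 ≤ γ)
    (hc : ∀ (t : F.Vh) (ζ τ : F.Sh), |upperConv t.1 ζ.1 τ.1| ≤
      β * l2norm Ω (symGrad t.1) * l2norm Ω ζ.1 * l2norm Ω τ.1)
    (hb : ∀ u t : F.Vh, supNorm Ω (grad (u + t).1) ≤
      supNorm Ω (grad u.1) + γ * l2norm Ω (symGrad t.1)) : PicardForms F.Vh F.Sh where
  aS := formS hΩb hT
  aV := formV hΩb hT
  aVS := formVS hΩb hT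
  c := formC hΩb hT
  bd u := supNorm Ω (grad u.1)
  β := β
  γ := γ
  aS_pos := formS_pos hΩb hT
  aV_pos := formV_pos hd hΩo hΩb hCK
  β_nonneg := hβ
  γ_nonneg := hγ
  c_le t ζ τ := picardForms_c_le hΩb hT (hc t ζ τ)
  c_self u σ := picardForms_c_self hd hΩo hΩb hT u σ
  bd_add u t := picardForms_bd_add hΩb hT (hb u t)

section

variable {hd : d = 2 ∨ d = 3} {hΩo : IsOpen Ω} {hΩb : Bornology.IsBounded Ω}
    {hT : IsMesh Ω T} {CK β γ : ℝ} {hCK : IsKornConstant Ω CK} {hβ : 0 ≤ β} {hγ : 0 ≤ γ}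
    {hc : ∀ (t : F.Vh) (ζ τ : F.Sh), |upperConv t.1 ζ.1 τ.1| ≤
      β * l2norm Ω (symGrad t.1) * l2norm Ω ζ.1 * l2norm Ω τ.1}
    {hb : ∀ u t : F.Vh, supNorm Ω (grad (u + t).1) ≤
      supNorm Ω (grad u.1) + γ * l2norm Ω (symGrad t.1)}

/-- The restriction of a functional on `X` to `V_h`. -/
def restrictVh (F : FESpaces Ω T k m) (f : VelocitySpace Ω →L[ℝ] ℝ) : F.Vh →ₗ[ℝ] ℝ :=
  f.toLinearMap ∘ₗ F.Vh.subtype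

lemma starNorm_eq (z : F.VS) :
    F.starNorm z = (picardForms hd hΩo hΩb hT hCK hβ hγ hc hb).star z :=
  congrArg Real.sqrt (congrArg₂ (· + ·)
    ((l2norm_sq Ω (symGrad z.1.1)).trans (formV_apply hΩb hT z.1 z.1).symm)
    ((l2norm_sq Ω z.2.1).trans (formS_apply hΩb hT z.2 z.2).symm))

lemma velocity_equation_iff (hΩb : Bornology.IsBounded Ω) (hT : IsMesh Ω T) {α r : ℝ} {z : F.VS}
    {v : F.Vh} : ip Ω z.2.1 (symGrad v.1) + 2 * (1 - α) * ip Ω (symGrad z.1.1) (symGrad v.1) = r ↔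
      formVS hΩb hT v z.2 + 2 * (1 - α) * formV hΩb hT z.1 v = r :=
  Eq.congr (congrArg₂ (fun a b => a + 2 * (1 - α) * b)
    ((ip_comm Ω _ _).trans (formVS_apply hΩb hT v z.2).symm) (formV_apply hΩb hT z.1 v).symm) rfl

lemma isPicardStep_iff_forms (hΩb : Bornology.IsBounded Ω) (hT : IsMesh Ω T) {lam α : ℝ}
    {f : VelocitySpace Ω →L[ℝ] ℝ} {x z : F.VS} :
    F.IsPicardStep lam α f x z ↔ (∀ τ, formS hΩb hT z.2 τ + lam * formC hΩb hT x.1 z.2 τ -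
      2 * α * formVS hΩb hT z.1 τ = 0) ∧
      ∀ v, formVS hΩb hT v z.2 + 2 * (1 - α) * formV hΩb hT z.1 v = f v.1 := by
  refine and_congr (forall_congr' fun τ => ?_)
    (forall_congr' fun v => velocity_equation_iff hΩb hT)
  have h1 := formC_apply hΩb hT x.1 z.2 τ
  have h2 := formS_apply hΩb hT z.2 τ
  have h3 := formVS_apply hΩb hT z.1 τ
  constructor <;> intro h
  · linear_combination h + (h2 + lam * h1 - 2 * α * h3)
  · linear_combination h - (h2 + lam * h1 - 2 * α * h3)

lemma isLinearizedStep_iff_forms (hΩb : Bornology.IsBounded Ω) (hT : IsMesh Ω T) {lam α : ℝ}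
    {f : VelocitySpace Ω →L[ℝ] ℝ} {x y z : F.VS} :
    F.IsLinearizedStep lam α f x y z ↔
      (∀ τ, formS hΩb hT z.2 τ + lam * formC hΩb hT x.1 z.2 τ -
        2 * α * formVS hΩb hT z.1 τ = -(lam * formC hΩb hT y.1 (F.G lam α f x).2 τ)) ∧
      ∀ v, formVS hΩb hT v z.2 + 2 * (1 - α) * formV hΩb hT z.1 v = 0 := by
  refine and_congr (forall_congr' fun τ => ?_)
    (forall_congr' fun v => velocity_equation_iff hΩb hT)
  have h1 := formC_apply hΩb hT x.1 z.2 τ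
  have h2 := formS_apply hΩb hT z.2 τ
  have h3 := formVS_apply hΩb hT z.1 τ
  have h4 := formC_apply hΩb hT y.1 (F.G lam α f x).2 τ
  constructor <;> intro h
  · linear_combination h + (h2 + lam * (h1 + h4) - 2 * α * h3)
  · linear_combination h - (h2 + lam * (h1 + h4) - 2 * α * h3)

lemma isPicardStep_iff {lam α : ℝ} {f : VelocitySpace Ω →L[ℝ] ℝ} {x z : F.VS} :
    F.IsPicardStep lam α f x z ↔ (picardForms hd hΩo hΩb hT hCK hβ hγ hc hb).IsStep lam α x.1 0
      (F.restrictVh f) z :=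
  isPicardStep_iff_forms hΩb hT

lemma isLinearizedStep_iff {lam α : ℝ} {f : VelocitySpace Ω →L[ℝ] ℝ} {x y z : F.VS} :
    F.IsLinearizedStep lam α f x y z ↔
      (picardForms hd hΩo hΩb hT hCK hβ hγ hc hb).IsStep lam α x.1
        (-(lam • (picardForms hd hΩo hΩb hT hCK hβ hγ hc hb).c y.1 (F.G lam α f x).2)) 0 z :=
  isLinearizedStep_iff_forms hΩb hT

end

/-- The discrete Oldroyd-B system is an instance of the abstract system. -/
theorem exists_picardForms (hd : d = 2 ∨ d = 3) (hΩo : IsOpen Ω) (hΩb : Bornology.IsBounded Ω)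
    {ρ : ℝ} (hρ : 0 < ρ) (hT : IsMesh Ω T) (hq : IsQuasiUniform ρ T) {CK A : ℝ}
    (hCK : IsKornConstant Ω CK) (hA : 0 < A)
    (hc : ∀ (u : F.Xh) (σ τ : F.Sh), |upperConv u.1 σ.1 τ.1| ≤
      A / meshSize T ^ 2 * l2norm Ω (grad u.1) * l2norm Ω σ.1 * l2norm Ω τ.1) :
    ∃ P : PicardForms F.Vh F.Sh, P.β = A * CK / meshSize T ^ 2 ∧
      (∀ u, P.bd u = supNorm Ω (grad u.1)) ∧
      (∀ v, √(P.aV v v) = l2norm Ω (symGrad v.1)) ∧ (∀ z, F.starNorm z = P.star z) ∧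
      (∀ lam α f x z, F.IsPicardStep lam α f x z ↔
        P.IsStep lam α x.1 0 (F.restrictVh f) z) ∧
      ∀ lam α f x y z, F.IsLinearizedStep lam α f x y z ↔
        P.IsStep lam α x.1 (-(lam • P.c y.1 (F.G lam α f x).2)) 0 z := by
  have hsup := exists_supNorm_add_le (F := F) hd hΩo hΩb hρ hT hq hCK
  obtain ⟨γ, hγ, hbγ⟩ := hsup
  have hCK0 := hCK.1
  have hβ : 0 ≤ A * CK / meshSize T ^ 2 := by positivity
  have hc' : ∀ (t : F.Vh) (ζ τ : F.Sh), |upperConv t.1 ζ.1 τ.1| ≤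
      A * CK / meshSize T ^ 2 * l2norm Ω (symGrad t.1) * l2norm Ω ζ.1 * l2norm Ω τ.1 := by
    intro t ζ τ
    refine (hc (F.incl t) ζ τ).trans ?_
    -- Korn's inequality passes from ∇t to 𝔻(t), the quantity in the energy norm; this puts C_K into
    -- β.
    have h3 : A / meshSize T ^ 2 * l2norm Ω (grad t.1) ≤
        A * CK / meshSize T ^ 2 * l2norm Ω (symGrad t.1) :=
      (mul_le_mul_of_nonneg_left (hCK.2 t.1) (by positivity)).trans (le_of_eq (by ring))
    exact mul_le_mul_of_nonneg_right (mul_le_mul_of_nonneg_right h3 (l2norm_nonneg _))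
      (l2norm_nonneg _)
  have hb : ∀ u t : F.Vh, supNorm Ω (grad (u + t).1) ≤
      supNorm Ω (grad u.1) + γ * l2norm Ω (symGrad t.1) := fun u t =>
    hbγ (F.incl u) (F.incl t)
  refine ⟨picardForms hd hΩo hΩb hT hCK hβ hγ hc' hb, ?_, ?_, ?_, ?_, ?_, ?_⟩
  · rfl
  · exact fun _ => rfl
  · exact fun v => (l2norm_symGrad_eq hΩb hT v).symm
  · exact fun z => starNorm_eq z
  · exact fun _ _ _ _ _ => isPicardStep_iff
  · exact fun _ _ _ _ _ _ => isLinearizedStep_iff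

lemma isPicardStep_G {lam α : ℝ} {f : VelocitySpace Ω →L[ℝ] ℝ} {x : F.VS}
    (h : ∃ z, F.IsPicardStep lam α f x z) : F.IsPicardStep lam α f x (F.G lam α f x) :=
  Classical.epsilon_spec (p := fun z => F.IsPicardStep lam α f x z) h

lemma isLinearizedStep_G' {lam α : ℝ} {f : VelocitySpace Ω →L[ℝ] ℝ} {x y : F.VS}
    (h : ∃ z, F.IsLinearizedStep lam α f x y z) :
    F.IsLinearizedStep lam α f x y (F.G' lam α f x y) :=
  Classical.epsilon_spec (p := fun z => F.IsLinearizedStep lam α f x y z) h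

end FESpaces

end OldroydB

end

/-! ### The main theorem. -/

theorem mainTheorem3 (d : ℕ) (hd : d = 2 ∨ d = 3) (Ω : Set (OldroydB.E d))
    (hΩo : IsOpen Ω) (hΩb : Bornology.IsBounded Ω) (ρ : ℝ) (hρ : 0 < ρ) (m : ℕ) :
    ∃ C : ℝ, 0 < C ∧
      ∀ T : Geometry.SimplicialComplex ℝ (OldroydB.E d),
        OldroydB.IsMesh Ω T → OldroydB.IsQuasiUniform ρ T →
      ∀ (k : ℕ) (F : OldroydB.FESpaces Ω T k m) (CK : ℝ), OldroydB.IsKornConstant Ω CK →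
      ∀ (lam α : ℝ) (f : OldroydB.VelocitySpace Ω →L[ℝ] ℝ), 0 < lam → 0 < α → α < 1 →
        (∀ x : F.VS, 2 * lam * OldroydB.supNorm Ω (OldroydB.grad x.1.1) < 1 →
          (∃! z, F.IsPicardStep lam α f x z) ∧
          (∀ y, ∃! z, F.IsLinearizedStep lam α f x y z) ∧
          F.HasFrechetDeriv (F.G lam α f) (F.G' lam α f x) x) ∧
        (∀ (x y z : F.VS) (M : ℝ),
          M = max (OldroydB.supNorm Ω (OldroydB.grad x.1.1))
            (OldroydB.supNorm Ω (OldroydB.grad (x + y).1.1)) →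
          0 < 1 - 2 * lam * M - 2 * lam →
          F.starNorm (F.G' lam α f (x + y) z - F.G' lam α f x z) ≤
            OldroydB.CLhat C CK (OldroydB.dualNorm f) (OldroydB.meshSize T) lam α M *
              F.starNorm z * F.starNorm y) := by
  -- The continuity constant of c, fixed before the mesh, the spaces and the parameters, is itself
  -- the constant C.
  obtain ⟨A, hA, hcA⟩ := OldroydB.FESpaces.exists_abs_upperConv_le hd hΩb hρ m
  refine ⟨A, hA, fun T hT hq k F CK hCK lam α f hlam h0 h1 => ?_⟩
  have hforms := OldroydB.FESpaces.exists_picardForms hd hΩo hΩb hρ hT hq hCK hA (hcA T hT hq k F)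
  obtain ⟨P, hβP, hbd, haV, hstar, hstep, hlin⟩ := hforms
  obtain ⟨hN, hf⟩ := OldroydB.abs_apply_le_dualNorm hd hΩo hΩb f
  have := OldroydB.FESpaces.finiteDimensional_Vh (F := F) hΩo hT
  have := OldroydB.FESpaces.finiteDimensional_Sh (F := F) hT
  -- Relative to ‖𝔻(v)‖ the load has norm at most ‖f‖₋₁ C_K. With the two factors in β², this is the
  -- third C_K in Ĉ_L.
  have hf' : ∀ v : F.Vh, |F.restrictVh f v| ≤ OldroydB.dualNorm f * CK * √(P.aV v v) := fun v =>
    ((hf v.1).trans (mul_le_mul_of_nonneg_left (hCK.2 v.1) hN)).trans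
      (le_of_eq ((mul_assoc _ _ _).symm.trans (congrArg _ (haV v).symm)))
  exact P.wellPosed_and_lipschitz (step := F.IsPicardStep lam α f)
    (lin := F.IsLinearizedStep lam α f) (G := F.G lam α f) (G' := F.G' lam α f)
    (N := F.starNorm) (bd := fun u => OldroydB.supNorm Ω (OldroydB.grad u.1))
    hlam h0 h1 (mul_nonneg hN hCK.1.le) hβP hf' (hstep lam α f) (hlin lam α f)
    (fun _ => OldroydB.FESpaces.isPicardStep_G) (fun _ _ => OldroydB.FESpaces.isLinearizedStep_G')
    hstar hbd
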